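/- **Theorem.** Let $n$ threads $p_0,\dots,p_{n-1}$ run asynchronously (arbitrary interleaving of atomic steps; any thread may crash, i.e. stop taking steps), and let an object be given by sequential code: every request is a (possibly looping) piece of code that reads shared variables, writes them, allocates new variables with a given initial value (under a name never allocated before), and finally returns a value. Consider the following implementation L-UC of $\mathrm{ApplyOp}(req)$ for this object. *Shared base objects.* An LL/SC object $S=\langle applied[\cdot], papplied[\cdot], seq, var\_list, rvals[\cdot]\rangle$, initially $\langle \bar 0,\bar 0,0,\text{(header of an empty list)},\bar\bot\rangle$; a Fetch&Add integer $Toggles$, initially $0$; registers $Announce[i]$, initially $\bot$; for every variable $x$ an LL/SC record $\langle val[0..1], toggle, seq\rangle$, initially $\langle\langle v,v\rangle,0,0\rangle$ with $v$ the initial value of $x$, and $\langle\langle\bot,\bot\rangle,0,0\rangle$ for a newly created record; nodes $\langle var, next\rangle$ (and list headers with a field $next$) whose $next$ pointers are CAS objects, initially null. A variable is named by the address of its record. Each thread $p_i$ has a local integer $toggle_i$, initially $-2^i$. *$\mathrm{ApplyOp}(req)$ by $p_i$.* $Announce[i]:=req$; $toggle_i:=-toggle_i$; Fetch&Add$(Toggles,toggle_i)$;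 run $\mathrm{Attempt}$ twice; return $S.rvals[i]$. *$\mathrm{Attempt}$.* Create a node $pvar$ with a new record. Then do the following twice. Let the directory $D$ be empty, $ls:=\mathrm{LL}(S)$, $lact:=Toggles$, $ltop:=ls.var\_list$; let $tmp.seq:=ls.seq+1$, $tmp.papplied:=ls.applied$, $tmp.applied[q]:=$ the $q$-th bit of $lact$, $tmp.rvals:=ls.rvals$. For each $q$ in increasing order with $ls.applied[q]\ne ls.papplied[q]$, run the code of the request read from $Announce[q]$ and store its return value in $tmp.rvals[q]$, where the accesses of the code are performed as follows. *Allocation with initial value $v$:* CAS$(ltop.next,\text{null},pvar)$, and if it succeeds create another node with a new record for $pvar$; $ltop:=ltop.next$; enter $ltop.var$ into $D$ with the value $val[0]$ of its record, and then set its entry to $v$; the name of the new variable is $ltop.var$. *Read of $x$:* use the entry of $x$ in $D$ if there is one; otherwise $sv:=\mathrm{LL}(x)$, and enter $sv.val[1-sv.toggle]$ into $D$ if $sv.seq=tmp.seq$, $sv.val[sv.toggle]$ if $sv.seq<tmp.seq$, and if $sv.seq>tmp.seq$ go directly to the validation. *Write to $x$:* set the entry of $x$ in $D$. *Validation:* if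 $\mathrm{VL}(S)$ fails, end this iteration. Otherwise for each entry $(x,v)$ of $D$: $sv:=\mathrm{LL}(x)$; if $sv.seq>tmp.seq$ leave this loop; if $sv.seq=tmp.seq$ go on to the next entry; otherwise SC to $x$ the record in which $val[sv.toggle]$ is kept, $val[1-sv.toggle]=v$, the toggle is $1-sv.toggle$, and the sequence number is $tmp.seq$. Finally let $tmp.var\_list$ be a new empty list and perform $\mathrm{SC}(S,tmp)$. Then the following hold. 1. *Linearizability.* In every (finite or infinite) execution one can assign to each completed operation, and to some uncompleted ones, a point between its invocation and its response such that every completed operation returns the value that it returns in a sequential execution of these operations, from the initial state, in the order of the points. 2. *Wait-freedom.* If the sequential code of every request terminates in every state of the object that is reachable sequentially, then in every execution each operation returns, unless its thread takes only finitely many steps. 3. *Step complexity.* There is an absolute constant $K$ such that, whenever the sequential code of every request makes at most $w$ accesses in every sequentially reachable state, each operation performs at most $K\,(n+kw)$ shared-memory accesses, where $k$ is the interval contention of the operation (the number of threads that are active at some time during its execution). Here an access to a base object is charged by the number of fields stored there ($3n+2$ for $S$, $n$ for reading the bits of $Toggles$, $4$ for the record of a variable). For an operation that has not returned, the same bound holds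 for the part executed so far, with the contention so far. -/

import Mathlib

/-! ## Sequential objects

The simulated object is given by sequential code that acts on shared variables. -/

namespace LUC

/-- A reference created by `new`: the index of the allocating thread and the value of that
thread's private allocation counter. -/
abbrev Ref := ℕ × ℕ

/-- Names of the variables of the simulated object: the variables `V` that exist initially, and
dynamically allocated ones. A variable is named by the address of its `ItemSV` record. -/
abbrev Addr (V : Type*) := V ⊕ Ref

/-- What a piece of sequential code does next, when its control state is in `σ`. -/
inductive Instr (V Val Ret σ : Type*)
  /-- finish and return `r` -/
  | ret (r : Ret)
  /-- read `x` and continue according to the value found -/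
  | read (x : Addr V) (k : Val → σ)
  /-- write `v` to `x` -/
  | write (x : Addr V) (v : Val) (c : σ)
  /-- allocate a new variable with initial value `v`; continue according to its name -/
  | alloc (v : Val) (k : Addr V → σ)

/-- The sequential implementation of an object: a piece of (possibly looping) code per request. -/
structure SeqObject (Req Ret V Val σ : Type*) where
  /-- initial values of the initial variables -/
  init : V → Val
  /-- the content `⊥` of uninitialised memory -/
  bot : Val
  /-- the code that implements a request -/
  start : Req → σ
  /-- the next instruction of the code -/
  instr : σ → Instr V Val Ret σ

/-- State of the sequential object: contents of the variables, and the set of allocated ones. -/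
structure Heap (V Val : Type*) where
  val : Addr V → Val
  used : Set (Addr V)

section Sequential

variable {Req Ret V Val σ : Type*} [DecidableEq V] (O : SeqObject Req Ret V Val σ)

/-- The initial state of the sequential object. -/
def Heap.initial : Heap V Val where
  val := Sum.elim O.init (fun _ => O.bot)
  used := Set.range Sum.inl

/-- One access of the sequential code to a variable. The allocator may return any name that has
not been allocated before. -/
inductive SeqStep : Heap V Val × σ → Heap V Val × σ → Prop
  | read (h : Heap V Val) (c : σ) (x : Addr V) (k : Val → σ)
      (hc : O.instr c = .read x k) : SeqStep (h, c) (h, k (h.val x))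
  | write (h : Heap V Val) (c : σ) (x : Addr V) (v : Val) (c₁ : σ)
      (hc : O.instr c = .write x v c₁) :
      SeqStep (h, c) (⟨Function.update h.val x v, h.used⟩, c₁)
  | alloc (h : Heap V Val) (c : σ) (v : Val) (k : Addr V → σ) (x : Addr V)
      (hc : O.instr c = .alloc v k) (hx : x ∉ h.used) :
      SeqStep (h, c) (⟨Function.update h.val x v, insert x h.used⟩, k x)

/-- `SeqSteps O m a b`: the sequential code gets from `a` to `b` by exactly `m` accesses. -/
inductive SeqSteps : ℕ → Heap V Val × σ → Heap V Val × σ → Prop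
  | refl (a : Heap V Val × σ) : SeqSteps 0 a a
  | tail (m : ℕ) (a b d : Heap V Val × σ) (hab : SeqSteps m a b) (hbd : SeqStep O b d) :
      SeqSteps (m + 1) a d

/-- `SeqApply O h req r h₁`: request `req`, executed alone in state `h`, can return `r` and leave
the object in state `h₁`. -/
def SeqApply (h : Heap V Val) (req : Req) (r : Ret) (h₁ : Heap V Val) : Prop :=
  ∃ (m : ℕ) (c : σ), SeqSteps O m (h, O.start req) (h₁, c) ∧ O.instr c = .ret r

/-- A list of requests with their return values, executed one after the other. -/
inductive SeqApplyList : Heap V Val → List (Req × Ret) → Heap V Val → Prop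
  | nil (h : Heap V Val) : SeqApplyList h [] h
  | cons (h h₁ h₂ : Heap V Val) (req : Req) (r : Ret) (l : List (Req × Ret))
      (hd : SeqApply O h req r h₁) (tl : SeqApplyList h₁ l h₂) :
      SeqApplyList h ((req, r) :: l) h₂

/-- States of the object that some sequence of requests can produce. -/
def Reachable (h : Heap V Val) : Prop :=
  ∃ l : List (Req × Ret), SeqApplyList O (Heap.initial O) l h

/-- The sequential code of every request terminates in every reachable state. -/
def SeqTerminates : Prop :=
  ∀ (h : Heap V Val) (req : Req), Reachable O h →
    ¬ ∃ f : ℕ → Heap V Val × σ, f 0 = (h, O.start req) ∧ ∀ i, SeqStep O (f i) (f (i + 1))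

/-- In every reachable state, the sequential code of every request stops within `w` accesses. -/
def SeqTimeBound (w : ℕ) : Prop :=
  ∀ (h : Heap V Val) (req : Req), Reachable O h →
    ∀ (m : ℕ) (b : Heap V Val × σ), SeqSteps O m (h, O.start req) b → m ≤ w

end Sequential

/-! ## Base objects -/

/-- An LL/SC object: its value, and for each thread whether the object is unchanged since that
thread's latest LL. -/
structure LLSC (n : ℕ) (α : Type*) where
  val : α
  link : Fin n → Bool

/-- The effect of LL by `p`; the primitive returns `o.val`. -/
def LLSC.ll {n : ℕ} {α : Type*} (o : LLSC n α) (p : Fin n) : LLSC n α :=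
  { o with link := Function.update o.link p true }

/-- The effect of SC by `p`; the primitive succeeds iff `o.link p`. -/
def LLSC.sc {n : ℕ} {α : Type*} (o : LLSC n α) (p : Fin n) (v : α) : LLSC n α :=
  if o.link p then ⟨v, fun _ => false⟩ else o

/-- The result of VL by `p`. -/
def LLSC.vl {n : ℕ} {α : Type*} (o : LLSC n α) (p : Fin n) : Bool := o.link p

/-- The effect of CAS on a cell with content `o`. -/
def casEffect {α : Type*} [DecidableEq α] (o u v : α) : α := if o = u then v else o

/-- Elements of the lists of newly allocated variables. A list is given by its header, whose
`next` field is the pointer to the first proper node; `cell r` is the `NewVar` node that was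
created together with the `ItemSV` record at address `r`, and its `var` field is that address. -/
inductive Node
  /-- header of the list in the initial value of `S` -/
  | head0
  /-- header created by `new List()` -/
  | head (r : Ref)
  /-- `NewVar` node -/
  | cell (r : Ref)
  deriving DecidableEq

/-- The contents of the object `S`. -/
structure State (n : ℕ) (Ret : Type*) where
  applied : Fin n → Bool
  papplied : Fin n → Bool
  seq : ℕ
  varList : Node
  rvals : Fin n → Option Ret

/-- The data record of a variable (`false`, `true` stand for the indices `0`, `1`). -/
structure ItemSV (Val : Type*) where
  val : Bool → Val
  toggle : Bool
  seq : ℕ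

/-! ## The algorithm -/

/-- The local variables of one iteration of the loop of `Attempt`. -/
structure Frame (n : ℕ) (Ret V Val : Type*) where
  /-- which of the two calls of `Attempt` -/
  attempt : Fin 2
  /-- which of the two iterations of its loop -/
  iter : Fin 2
  ls : State n Ret
  tmp : State n Ret
  ltop : Node
  /-- the directory; the name of a variable is at the same time the pointer to its record -/
  D : AList (fun _ : Addr V => Val)

/-- Program counter of a thread, with the local variables that are live there. -/
inductive PC (n : ℕ) (Req Ret V Val σ : Type*)
  /-- no operation is being executed -/
  | idle
  /-- `Announce[i] = req` -/
  | announce (req : Req)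
  /-- `toggle_i = -toggle_i; Fetch&Add(Toggles, toggle_i)` -/
  | fetchAdd
  /-- `ls = LL(S)` -/
  | llS (attempt iter : Fin 2)
  /-- `lact = Toggles`, and preparation of `tmp` -/
  | readToggles (attempt iter : Fin 2) (ls : State n Ret)
  /-- head of the loop over the pending requests; `todo` are those still to be applied;
  reads `Announce[q]` for the first of them -/
  | select (f : Frame n Ret V Val) (todo : List (Fin n))
  /-- next access in the code of the request of `q` -/
  | simulate (f : Frame n Ret V Val) (q : Fin n) (todo : List (Fin n)) (c : σ)
  /-- `ltop = ltop->next` -/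
  | allocNext (f : Frame n Ret V Val) (q : Fin n) (todo : List (Fin n)) (v : Val)
      (k : Addr V → σ)
  /-- add `<x, ltop->var, ltop->var.val[0]>` to `D`, for `ltop->var` at address `r` -/
  | allocVal (f : Frame n Ret V Val) (q : Fin n) (todo : List (Fin n)) (v : Val)
      (k : Addr V → σ) (r : Ref)
  /-- `VL(S)` -/
  | validate (f : Frame n Ret V Val)
  /-- head of the loop that writes back the directory; performs `LL(*svp)` -/
  | flush (f : Frame n Ret V Val) (recs : List (Σ _ : Addr V, Val))
  /-- `SC(*svp, ...)` -/
  | store (f : Frame n Ret V Val) (x : Addr V) (v : Val) (sv : ItemSV Val)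
      (recs : List (Σ _ : Addr V, Val))
  /-- `tmp.var_list = new List(); SC(S, tmp)` -/
  | commit (f : Frame n Ret V Val)
  /-- read `S.rvals[i]` -/
  | readRet
  /-- return `r` to the caller -/
  | respond (r : Ret)

/-- The local state of a thread. -/
structure Local (n : ℕ) (Req Ret V Val σ : Type*) where
  pc : PC n Req Ret V Val σ
  /-- `toggle_i` -/
  toggle : ℤ
  /-- allocation counter -/
  cnt : ℕ
  /-- the `NewVar` node `pvar` (and its record `psv`), prepared but not yet in any list -/
  pvar : Ref

/-- A configuration: base objects and local states. -/
structure Config (n : ℕ) (Req Ret V Val σ : Type*) where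
  S : LLSC n (State n Ret)
  /-- the Fetch&Add object -/
  toggles : ℤ
  /-- read/write registers -/
  announce : Fin n → Option Req
  /-- LL/SC objects, one record per variable -/
  item : Addr V → LLSC n (ItemSV Val)
  /-- CAS objects: the `next` fields (`none` is null) -/
  next : Node → Option Ref
  loc : Fin n → Local n Req Ret V Val σ

section Algorithm

variable {n : ℕ} {Req Ret V Val σ : Type*} [DecidableEq V] (O : SeqObject Req Ret V Val σ)

/-- The initial configuration. All records that are not in use hold `<<⊥, ⊥>, 0, 0>`, so `new`
only has to pick the next reference of the thread. -/
def initial (n : ℕ) : Config n Req Ret V Val σ where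
  S := ⟨⟨fun _ => false, fun _ => false, 0, .head0, fun _ => none⟩, fun _ => false⟩
  toggles := 0
  announce := fun _ => none
  item := fun x => ⟨⟨fun _ => Sum.elim O.init (fun _ => O.bot) x, false, 0⟩, fun _ => false⟩
  next := fun _ => none
  loc := fun p => ⟨.idle, -(2 ^ (p : ℕ)), 1, ((p : ℕ), 0)⟩

/-- Change the local state of `p`. -/
def Config.setLoc (C : Config n Req Ret V Val σ) (p : Fin n) (L : Local n Req Ret V Val σ) :
    Config n Req Ret V Val σ :=
  { C with loc := Function.update C.loc p L }

/-- Change the program counter of `p`. -/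
def Config.goto (C : Config n Req Ret V Val σ) (p : Fin n) (pc : PC n Req Ret V Val σ) :
    Config n Req Ret V Val σ :=
  C.setLoc p { C.loc p with pc := pc }

/-- `pvar = new NewVar()`, together with its record `psv = new ItemSV()`. -/
def Config.newVar (C : Config n Req Ret V Val σ) (p : Fin n) : Config n Req Ret V Val σ :=
  C.setLoc p { C.loc p with pvar := ((p : ℕ), (C.loc p).cnt), cnt := (C.loc p).cnt + 1 }

/-- Entry of a call of `Attempt`. -/
def Config.startAttempt (C : Config n Req Ret V Val σ) (p : Fin n) (a : Fin 2) :
    Config n Req Ret V Val σ :=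
  (C.newVar p).goto p (.llS a 0)

/-- End of iteration `j` of the loop in call `a` of `Attempt`. -/
def Config.endIter (C : Config n Req Ret V Val σ) (p : Fin n) (a j : Fin 2) :
    Config n Req Ret V Val σ :=
  if j = 0 then C.goto p (.llS a 1)
  else if a = 0 then C.startAttempt p 1
  else C.goto p .readRet

/-- The step of thread `p`: at most one primitive on a base object, and local computation. A
thread that would follow a null pointer is blocked: its steps change nothing. -/
def stepOf (C : Config n Req Ret V Val σ) (p : Fin n) : Config n Req Ret V Val σ :=
  match (C.loc p).pc with
  | .idle => C
  | .announce req =>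
      { C with announce := Function.update C.announce p (some req) }.goto p .fetchAdd
  | .fetchAdd =>
      let t := -(C.loc p).toggle
      ({ C with toggles := C.toggles + t }.setLoc p
        { C.loc p with toggle := t }).startAttempt p 0
  | .llS a j => { C with S := C.S.ll p }.goto p (.readToggles a j C.S.val)
  | .readToggles a j ls =>
      C.goto p (.select
        { attempt := a
          iter := j
          ls := ls
          ltop := ls.varList
          tmp :=
            { seq := ls.seq + 1
              papplied := ls.applied
              applied := fun q => C.toggles.testBit q
              rvals := ls.rvals
              varList := ls.varList }
          D := ∅ }
        ((List.finRange n).filter (fun q => ls.applied q != ls.papplied q)))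
  | .select f [] => C.goto p (.validate f)
  | .select f (q :: todo) =>
      match C.announce q with
      | some req => C.goto p (.simulate f q todo (O.start req))
      | none => C
  | .simulate f q todo c =>
      match O.instr c with
      | .ret r =>
          C.goto p (.select
            { f with tmp := { f.tmp with rvals := Function.update f.tmp.rvals q (some r) } } todo)
      | .read x k =>
          match f.D.lookup x with
          | some v => C.goto p (.simulate f q todo (k v))
          | none =>
              let sv := (C.item x).val
              let C₁ := { C with item := Function.update C.item x ((C.item x).ll p) }
              if f.tmp.seq = sv.seq then
                C₁.goto p (.simulate { f with D := f.D.insert x (sv.val (!sv.toggle)) } q todo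
                  (k (sv.val (!sv.toggle))))
              else if sv.seq < f.tmp.seq then
                C₁.goto p (.simulate { f with D := f.D.insert x (sv.val sv.toggle) } q todo
                  (k (sv.val sv.toggle)))
              else C₁.goto p (.validate f)
      | .write x v c₁ => C.goto p (.simulate { f with D := f.D.insert x v } q todo c₁)
      | .alloc v k =>
          -- `CAS(ltop->next, null, pvar)`; if it succeeds, prepare another node
          let ptr := casEffect (C.next f.ltop) none (some (C.loc p).pvar)
          let C₁ := { C with next := Function.update C.next f.ltop ptr }
          (if C.next f.ltop = none then C₁.newVar p else C₁).goto p (.allocNext f q todo v k)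
  | .allocNext f q todo v k =>
      match C.next f.ltop with
      | some r => C.goto p (.allocVal { f with ltop := .cell r } q todo v k r)
      | none => C
  | .allocVal f q todo v k r =>
      -- enter the new variable into `D`, then let the code initialise it with `v`
      C.goto p (.simulate
        { f with D := (f.D.insert (.inr r) ((C.item (.inr r)).val.val false)).insert (.inr r) v }
        q todo (k (.inr r)))
  | .validate f =>
      if C.S.vl p then C.goto p (.flush f f.D.entries) else C.endIter p f.attempt f.iter
  | .flush f [] => C.goto p (.commit f)
  | .flush f (⟨x, v⟩ :: recs) =>
      let sv := (C.item x).val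
      let C₁ := { C with item := Function.update C.item x ((C.item x).ll p) }
      if f.tmp.seq < sv.seq then C₁.goto p (.commit f)
      else if sv.seq = f.tmp.seq then C₁.goto p (.flush f recs)
      else C₁.goto p (.store f x v sv recs)
  | .store f x v sv recs =>
      -- keep the current value, put `v` in the other entry and turn the toggle to it
      { C with item := Function.update C.item x ((C.item x).sc p
          ⟨Function.update sv.val (!sv.toggle) v, !sv.toggle, f.tmp.seq⟩) }.goto p (.flush f recs)
  | .commit f =>
      let hd := Node.head ((p : ℕ), (C.loc p).cnt)
      ({ C with S := C.S.sc p { f.tmp with varList := hd } }.setLoc p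
        { C.loc p with cnt := (C.loc p).cnt + 1 }).endIter p f.attempt f.iter
  | .readRet =>
      match C.S.val.rvals p with
      | some r => C.goto p (.respond r)
      | none => C
  | .respond _ => C

/-- Number of shared-memory accesses in the next step of `p`. An access to a base object is
charged by the size of the record stored there: `3 * n + 2` for `S`, `n` for reading the bits of
`Toggles`, `4` for the record of a variable. Hence every primitive is charged at least once. -/
def accesses (C : Config n Req Ret V Val σ) (p : Fin n) : ℕ :=
  match (C.loc p).pc with
  | .idle => 0
  | .announce _ => 1
  | .fetchAdd => 1
  | .llS _ _ => 3 * n + 2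
  | .readToggles _ _ _ => n
  | .select _ [] => 0
  | .select _ (_ :: _) => 1
  | .simulate f _ _ c =>
      match O.instr c with
      | .ret _ => 0
      | .read x _ => if f.D.lookup x = none then 4 else 0
      | .write _ _ _ => 0
      | .alloc _ _ => 1
  | .allocNext _ _ _ _ _ => 1
  | .allocVal _ _ _ _ _ _ => 2
  | .validate _ => 1
  | .flush _ [] => 0
  | .flush _ (_ :: _) => 4
  | .store _ _ _ _ _ => 4
  | .commit _ => 3 * n + 2
  | .readRet => 3 * n + 2
  | .respond _ => 0

/-! ## Executions -/

/-- Events of an execution. -/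
inductive Event (n : ℕ) (Req Ret : Type*)
  /-- `p` calls `ApplyOp(req)` -/
  | inv (p : Fin n) (req : Req)
  /-- `p` takes a step of the algorithm -/
  | step (p : Fin n)
  /-- the call of `p` returns `r` -/
  | res (p : Fin n) (r : Ret)

/-- The thread to which an event belongs. -/
def Event.thread : Event n Req Ret → Fin n
  | .inv p _ => p
  | .step p => p
  | .res p _ => p

/-- Transitions between configurations. -/
inductive Trans :
    Config n Req Ret V Val σ → Event n Req Ret → Config n Req Ret V Val σ → Prop
  | inv (C : Config n Req Ret V Val σ) (p : Fin n) (req : Req)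
      (h : (C.loc p).pc = .idle) : Trans C (.inv p req) (C.goto p (.announce req))
  | step (C : Config n Req Ret V Val σ) (p : Fin n)
      (h : (C.loc p).pc ≠ .idle) (h₁ : ∀ r, (C.loc p).pc ≠ .respond r) :
      Trans C (.step p) (stepOf O C p)
  | res (C : Config n Req Ret V Val σ) (p : Fin n) (r : Ret)
      (h : (C.loc p).pc = .respond r) : Trans C (.res p r) (C.goto p .idle)

/-- `IsExecution O N C e`: the configurations `C 0, C 1, ...` and the events `e 0, e 1, ...`
(`e t` leads from `C t` to `C (t + 1)`) form an execution with `N` events; `N = ⊤` for infinite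
executions. Events of different threads interleave arbitrarily, and a thread that crashes just
has no further events. -/
def IsExecution (N : ℕ∞) (C : ℕ → Config n Req Ret V Val σ) (e : ℕ → Event n Req Ret) : Prop :=
  C 0 = initial O n ∧ ∀ t : ℕ, (t : ℕ∞) < N → Trans O (C t) (e t) (C (t + 1))

/-- The operation of `p` invoked by event `t` returns `r` by event `u`. -/
def Returns (N : ℕ∞) (e : ℕ → Event n Req Ret) (t : ℕ) (p : Fin n) (u : ℕ) (r : Ret) : Prop :=
  t < u ∧ (u : ℕ∞) < N ∧ e u = .res p r ∧ ∀ s, t < s → s < u → ∀ r₁, e s ≠ .res p r₁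

/-- An operation with a linearization point, in the form (event of its invocation, its request,
the value that it returns in the sequential execution). -/
abbrev LinOp (Req Ret : Type*) := ℕ × Req × Ret

/-- Linearizability of an execution. `lin m` lists the operations whose linearization point is
at configuration `m`, in the order that breaks ties, and `H m` is the state of the object after
the operations that are linearized before configuration `m`. -/
def Linearizable (N : ℕ∞) (e : ℕ → Event n Req Ret) : Prop :=
  ∃ (lin : ℕ → List (LinOp Req Ret)) (H : ℕ → Heap V Val),
    -- the return values are those of a sequential execution in the order of the points
    H 0 = Heap.initial O ∧
    (∀ m, SeqApplyList O (H m) ((lin m).map Prod.snd) (H (m + 1))) ∧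
    -- points belong to operations of the execution, after the invocation and before the
    -- response, and completed operations return the values of the sequential execution
    (∀ m, ∀ op ∈ lin m, op.1 < m ∧ (m : ℕ∞) ≤ N ∧ ∃ p, e op.1 = .inv p op.2.1 ∧
      ∀ u r, Returns N e op.1 p u r → m ≤ u ∧ r = op.2.2) ∧
    -- an operation has at most one point
    (∀ m, ((lin m).map Prod.fst).Nodup) ∧
    (∀ m₁ m₂, ∀ op₁ ∈ lin m₁, ∀ op₂ ∈ lin m₂, op₁.1 = op₂.1 → m₁ = m₂) ∧
    -- every completed operation has a point
    (∀ (t : ℕ) p req u r, (t : ℕ∞) < N → e t = .inv p req → Returns N e t p u r →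
      ∃ m, ∃ op ∈ lin m, op.1 = t)

/-- Wait-freedom of an infinite execution: every operation returns, unless its thread takes only
finitely many steps. -/
def WaitFree (e : ℕ → Event n Req Ret) : Prop :=
  ∀ t p req, e t = .inv p req → {s | (e s).thread = p}.Infinite → ∃ u r, Returns ⊤ e t p u r

/-- The shared-memory accesses of `p` in the events from `t` up to, not including, `m`. -/
noncomputable def accessesIn (C : ℕ → Config n Req Ret V Val σ) (e : ℕ → Event n Req Ret) (p : Fin n)
    (t m : ℕ) : ℕ :=
  open Classical in ∑ s ∈ Finset.Ico t m, if e s = .step p then accesses O (C s) p else 0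

/-- The number of threads that execute an operation in one of the configurations
`t + 1, ..., m`. -/
noncomputable def contention (C : ℕ → Config n Req Ret V Val σ) (t m : ℕ) : ℕ :=
  Set.ncard {q : Fin n | ∃ s, t < s ∧ s ≤ m ∧ ((C s).loc q).pc ≠ .idle}

end Algorithm

end LUC

namespace LUC

variable {n : ℕ} {Req Ret V Val σ : Type*}

/-- Auxiliary variables of the proof: the heap `hist s` of the simulated object in round `s`, the
heap that each thread has computed in its current simulation, and the position (round, index) of
each node that has been put into a list. -/
structure Ghost (n : ℕ) (V Val : Type*) where
  hist : ℕ → Heap V Val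
  hp : Fin n → Heap V Val
  rank : Node → Option (ℕ × ℕ)

/-- Change the heap that `p` has computed. -/
def Ghost.setHeap (G : Ghost n V Val) (p : Fin n) (h : Heap V Val) : Ghost n V Val :=
  { G with hp := Function.update G.hp p h }

/-- Record the position of a node. -/
def Ghost.setRank (G : Ghost n V Val) (a : Node) (i : Option (ℕ × ℕ)) : Ghost n V Val :=
  { G with rank := Function.update G.rank a i }

/-- Record the heap of a round. -/
def Ghost.setHist (G : Ghost n V Val) (s : ℕ) (h : Heap V Val) : Ghost n V Val :=
  { G with hist := Function.update G.hist s h }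

@[simp] theorem setLoc_S (C : Config n Req Ret V Val σ) (p : Fin n) (L) :
    (C.setLoc p L).S = C.S := rfl
@[simp] theorem setLoc_toggles (C : Config n Req Ret V Val σ) (p : Fin n) (L) :
    (C.setLoc p L).toggles = C.toggles := rfl
@[simp] theorem setLoc_announce (C : Config n Req Ret V Val σ) (p : Fin n) (L) :
    (C.setLoc p L).announce = C.announce := rfl
@[simp] theorem setLoc_item (C : Config n Req Ret V Val σ) (p : Fin n) (L) :
    (C.setLoc p L).item = C.item := rfl
@[simp] theorem setLoc_next (C : Config n Req Ret V Val σ) (p : Fin n) (L) :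
    (C.setLoc p L).next = C.next := rfl
@[simp] theorem setLoc_loc_self (C : Config n Req Ret V Val σ) (p : Fin n) (L) :
    (C.setLoc p L).loc p = L := by simp [Config.setLoc]
theorem setLoc_loc_ne (C : Config n Req Ret V Val σ) {p q : Fin n} (h : q ≠ p) (L) :
    (C.setLoc p L).loc q = C.loc q := by simp [Config.setLoc, h]

/-- The local state after an iteration of the loop of `Attempt`. -/
def endLoc (p : Fin n) (L : Local n Req Ret V Val σ) (a j : Fin 2) : Local n Req Ret V Val σ :=
  if j = 0 then { L with pc := .llS a 1 }
  else if a = 0 then ⟨.llS 1 0, L.toggle, L.cnt + 1, ((p : ℕ), L.cnt)⟩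
  else { L with pc := .readRet }

theorem setLoc_setLoc (C : Config n Req Ret V Val σ) (p : Fin n) (L L') :
    (C.setLoc p L).setLoc p L' = C.setLoc p L' := by
  simp [Config.setLoc]

theorem endIter_eq (C : Config n Req Ret V Val σ) (p : Fin n) (a j : Fin 2) :
    C.endIter p a j = C.setLoc p (endLoc p (C.loc p) a j) := by
  unfold Config.endIter endLoc
  split_ifs <;> simp [Config.goto, Config.startAttempt, Config.newVar, setLoc_setLoc]

/-- The requests that are pending in the state `s` of `S`. -/
def pend (s : State n Ret) : List (Fin n) :=
  (List.finRange n).filter (fun q => s.applied q != s.papplied q)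

theorem mem_pend {s : State n Ret} {q : Fin n} : q ∈ pend s ↔ s.applied q ≠ s.papplied q := by
  simp [pend]

theorem nodup_pend (s : State n Ret) : (pend s).Nodup :=
  (List.nodup_finRange n).filter _

/-- The frame with which an iteration starts. -/
def firstFrame (C : Config n Req Ret V Val σ) (a j : Fin 2) (ls : State n Ret) :
    Frame n Ret V Val where
  attempt := a
  iter := j
  ls := ls
  ltop := ls.varList
  tmp :=
    { seq := ls.seq + 1
      papplied := ls.applied
      applied := fun q => C.toggles.testBit q
      rvals := ls.rvals
      varList := ls.varList }
  D := ∅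

/-- Store the return value of the request of `q`. -/
def Frame.setRet (f : Frame n Ret V Val) (q : Fin n) (r : Ret) : Frame n Ret V Val :=
  { f with tmp := { f.tmp with rvals := Function.update f.tmp.rvals q (some r) } }

variable [DecidableEq V] (O : SeqObject Req Ret V Val σ)

/-- LL of the record of `x` by `p`. -/
def Config.llItem (C : Config n Req Ret V Val σ) (p : Fin n) (x : Addr V) :
    Config n Req Ret V Val σ :=
  { C with item := Function.update C.item x ((C.item x).ll p) }

/-- The steps of a thread, together with the changes of the auxiliary variables. -/
inductive GStep (C : Config n Req Ret V Val σ) (G : Ghost n V Val) (p : Fin n) :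
    Config n Req Ret V Val σ → Ghost n V Val → Prop
  | announce (req : Req) (h : (C.loc p).pc = .announce req) :
      GStep C G p ({ C with announce := Function.update C.announce p (some req) }.setLoc p
        { C.loc p with pc := .fetchAdd }) G
  | fetchAdd (h : (C.loc p).pc = .fetchAdd) :
      GStep C G p ({ C with toggles := C.toggles + -(C.loc p).toggle }.setLoc p
        ⟨.llS 0 0, -(C.loc p).toggle, (C.loc p).cnt + 1, ((p : ℕ), (C.loc p).cnt)⟩) G
  | llS (a j : Fin 2) (h : (C.loc p).pc = .llS a j) :
      GStep C G p ({ C with S := C.S.ll p }.setLoc p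
        { C.loc p with pc := .readToggles a j C.S.val }) G
  | readToggles (a j : Fin 2) (ls : State n Ret) (h : (C.loc p).pc = .readToggles a j ls) :
      GStep C G p (C.setLoc p { C.loc p with pc := .select (firstFrame C a j ls) (pend ls) })
        (G.setHeap p (G.hist ls.seq))
  | selectNil (f : Frame n Ret V Val) (h : (C.loc p).pc = .select f []) :
      GStep C G p (C.setLoc p { C.loc p with pc := .validate f }) G
  | selectCons (f : Frame n Ret V Val) (q : Fin n) (todo : List (Fin n)) (req : Req)
      (h : (C.loc p).pc = .select f (q :: todo)) (hq : C.announce q = some req) :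
      GStep C G p (C.setLoc p { C.loc p with pc := .simulate f q todo (O.start req) }) G
  | selectStuck (f : Frame n Ret V Val) (q : Fin n) (todo : List (Fin n))
      (h : (C.loc p).pc = .select f (q :: todo)) (hq : C.announce q = none) : GStep C G p C G
  | ret (f : Frame n Ret V Val) (q : Fin n) (todo : List (Fin n)) (c : σ) (r : Ret)
      (h : (C.loc p).pc = .simulate f q todo c) (hc : O.instr c = .ret r) :
      GStep C G p (C.setLoc p { C.loc p with pc := .select (f.setRet q r) todo }) G
  | readDir (f : Frame n Ret V Val) (q : Fin n) (todo : List (Fin n)) (c : σ) (x : Addr V)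
      (k : Val → σ) (v : Val) (h : (C.loc p).pc = .simulate f q todo c)
      (hc : O.instr c = .read x k) (hv : f.D.lookup x = some v) :
      GStep C G p (C.setLoc p { C.loc p with pc := .simulate f q todo (k v) }) G
  | readItem (f : Frame n Ret V Val) (q : Fin n) (todo : List (Fin n)) (c : σ) (x : Addr V)
      (k : Val → σ) (v : Val) (h : (C.loc p).pc = .simulate f q todo c)
      (hc : O.instr c = .read x k) (hx : f.D.lookup x = none)
      (hv : f.tmp.seq = (C.item x).val.seq ∧ v = (C.item x).val.val (!(C.item x).val.toggle) ∨
        (C.item x).val.seq < f.tmp.seq ∧ v = (C.item x).val.val (C.item x).val.toggle) :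
      GStep C G p ((C.llItem p x).setLoc p
        { C.loc p with pc := .simulate { f with D := f.D.insert x v } q todo (k v) }) G
  | readLate (f : Frame n Ret V Val) (q : Fin n) (todo : List (Fin n)) (c : σ) (x : Addr V)
      (k : Val → σ) (h : (C.loc p).pc = .simulate f q todo c)
      (hc : O.instr c = .read x k) (hx : f.D.lookup x = none)
      (hv : f.tmp.seq < (C.item x).val.seq) :
      GStep C G p ((C.llItem p x).setLoc p { C.loc p with pc := .validate f }) G
  | write (f : Frame n Ret V Val) (q : Fin n) (todo : List (Fin n)) (c : σ) (x : Addr V)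
      (v : Val) (c₁ : σ) (h : (C.loc p).pc = .simulate f q todo c)
      (hc : O.instr c = .write x v c₁) :
      GStep C G p (C.setLoc p
        { C.loc p with pc := .simulate { f with D := f.D.insert x v } q todo c₁ })
        (G.setHeap p ⟨Function.update (G.hp p).val x v, (G.hp p).used⟩)
  | allocCas (f : Frame n Ret V Val) (q : Fin n) (todo : List (Fin n)) (c : σ) (v : Val)
      (k : Addr V → σ) (h : (C.loc p).pc = .simulate f q todo c)
      (hc : O.instr c = .alloc v k) (hn : C.next f.ltop = none) :
      GStep C G p ({ C with next := Function.update C.next f.ltop (some (C.loc p).pvar) }.setLoc p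
        ⟨.allocNext f q todo v k, (C.loc p).toggle, (C.loc p).cnt + 1, ((p : ℕ), (C.loc p).cnt)⟩)
        (G.setRank (.cell (C.loc p).pvar) ((G.rank f.ltop).map fun a => (a.1, a.2 + 1)))
  | allocFail (f : Frame n Ret V Val) (q : Fin n) (todo : List (Fin n)) (c : σ) (v : Val)
      (k : Addr V → σ) (h : (C.loc p).pc = .simulate f q todo c)
      (hc : O.instr c = .alloc v k) (hn : C.next f.ltop ≠ none) :
      GStep C G p (C.setLoc p { C.loc p with pc := .allocNext f q todo v k }) G
  | allocNext (f : Frame n Ret V Val) (q : Fin n) (todo : List (Fin n)) (v : Val)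
      (k : Addr V → σ) (r : Ref) (h : (C.loc p).pc = .allocNext f q todo v k)
      (hr : C.next f.ltop = some r) :
      GStep C G p (C.setLoc p
        { C.loc p with pc := .allocVal { f with ltop := .cell r } q todo v k r }) G
  | allocStuck (f : Frame n Ret V Val) (q : Fin n) (todo : List (Fin n)) (v : Val)
      (k : Addr V → σ) (h : (C.loc p).pc = .allocNext f q todo v k)
      (hr : C.next f.ltop = none) : GStep C G p C G
  | allocVal (f : Frame n Ret V Val) (q : Fin n) (todo : List (Fin n)) (v : Val)
      (k : Addr V → σ) (r : Ref) (h : (C.loc p).pc = .allocVal f q todo v k r) :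
      GStep C G p (C.setLoc p
        { C.loc p with pc := .simulate { f with D := f.D.insert (.inr r) v } q todo (k (.inr r)) })
        (G.setHeap p ⟨Function.update (G.hp p).val (.inr r) v, insert (.inr r) (G.hp p).used⟩)
  | validate (f : Frame n Ret V Val) (h : (C.loc p).pc = .validate f)
      (hl : C.S.link p = true) :
      GStep C G p (C.setLoc p { C.loc p with pc := .flush f f.D.entries }) G
  | validateFail (f : Frame n Ret V Val) (h : (C.loc p).pc = .validate f)
      (hl : C.S.link p = false) :
      GStep C G p (C.setLoc p (endLoc p (C.loc p) f.attempt f.iter)) G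
  | flushNil (f : Frame n Ret V Val) (h : (C.loc p).pc = .flush f []) :
      GStep C G p (C.setLoc p { C.loc p with pc := .commit f }) G
  | flushLate (f : Frame n Ret V Val) (x : Addr V) (v : Val) (recs : List (Σ _ : Addr V, Val))
      (h : (C.loc p).pc = .flush f (⟨x, v⟩ :: recs)) (hs : f.tmp.seq < (C.item x).val.seq) :
      GStep C G p ((C.llItem p x).setLoc p { C.loc p with pc := .commit f }) G
  | flushSkip (f : Frame n Ret V Val) (x : Addr V) (v : Val) (recs : List (Σ _ : Addr V, Val))
      (h : (C.loc p).pc = .flush f (⟨x, v⟩ :: recs)) (hs : (C.item x).val.seq = f.tmp.seq) :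
      GStep C G p ((C.llItem p x).setLoc p { C.loc p with pc := .flush f recs }) G
  | flushStore (f : Frame n Ret V Val) (x : Addr V) (v : Val) (recs : List (Σ _ : Addr V, Val))
      (h : (C.loc p).pc = .flush f (⟨x, v⟩ :: recs)) (hs : (C.item x).val.seq < f.tmp.seq) :
      GStep C G p ((C.llItem p x).setLoc p
        { C.loc p with pc := .store f x v (C.item x).val recs }) G
  | store (f : Frame n Ret V Val) (x : Addr V) (v : Val) (sv : ItemSV Val)
      (recs : List (Σ _ : Addr V, Val))
      (h : (C.loc p).pc = .store f x v sv recs) (hl : (C.item x).link p = true) :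
      GStep C G p ({ C with
          item := Function.update C.item x
            ⟨⟨Function.update sv.val (!sv.toggle) v, !sv.toggle, f.tmp.seq⟩, fun _ => false⟩ }.setLoc p
        { C.loc p with pc := .flush f recs }) G
  | storeFail (f : Frame n Ret V Val) (x : Addr V) (v : Val) (sv : ItemSV Val)
      (recs : List (Σ _ : Addr V, Val))
      (h : (C.loc p).pc = .store f x v sv recs) (hl : (C.item x).link p = false) :
      GStep C G p (C.setLoc p { C.loc p with pc := .flush f recs }) G
  | commit (f : Frame n Ret V Val) (h : (C.loc p).pc = .commit f) (hl : C.S.link p = true) :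
      GStep C G p ({ C with
          S := ⟨{ f.tmp with varList := .head ((p : ℕ), (C.loc p).cnt) }, fun _ => false⟩ }.setLoc p
        (endLoc p { C.loc p with cnt := (C.loc p).cnt + 1 } f.attempt f.iter))
        ((G.setHist (f.ls.seq + 1) (G.hp p)).setRank (.head ((p : ℕ), (C.loc p).cnt))
          (some (f.ls.seq + 1, 0)))
  | commitFail (f : Frame n Ret V Val) (h : (C.loc p).pc = .commit f)
      (hl : C.S.link p = false) :
      GStep C G p (C.setLoc p
        (endLoc p { C.loc p with cnt := (C.loc p).cnt + 1 } f.attempt f.iter)) G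
  | readRet (r : Ret) (h : (C.loc p).pc = .readRet) (hr : C.S.val.rvals p = some r) :
      GStep C G p (C.setLoc p { C.loc p with pc := .respond r }) G
  | retStuck (h : (C.loc p).pc = .readRet) (hr : C.S.val.rvals p = none) : GStep C G p C G

variable {O} in
theorem GStep.exists_of_eq {C C₁ C₂ : Config n Req Ret V Val σ} {G G₁ : Ghost n V Val}
    {p : Fin n} (h : GStep O C G p C₁ G₁) (e : C₂ = C₁) : ∃ G', GStep O C G p C₂ G' :=
  ⟨G₁, e ▸ h⟩

theorem exists_gstep (C : Config n Req Ret V Val σ) (G : Ghost n V Val) (p : Fin n)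
    (h : (C.loc p).pc ≠ .idle) (h₁ : ∀ r, (C.loc p).pc ≠ .respond r) :
    ∃ G', GStep O C G p (stepOf O C p) G' := by
  cases hpc : (C.loc p).pc with
  | idle => exact absurd hpc h
  | respond r => exact absurd hpc (h₁ r)
  | announce req => simp only [stepOf, hpc]; exact ⟨_, .announce req hpc⟩
  | fetchAdd =>
    refine (GStep.fetchAdd hpc).exists_of_eq ?_
    simp [stepOf, hpc, Config.goto, Config.startAttempt, Config.newVar, setLoc_setLoc]
  | llS a j => simp only [stepOf, hpc]; exact ⟨_, .llS a j hpc⟩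
  | readToggles a j ls => simp only [stepOf, hpc]; exact ⟨_, .readToggles a j ls hpc⟩
  | select f todo =>
    cases todo with
    | nil => simp only [stepOf, hpc]; exact ⟨_, .selectNil f hpc⟩
    | cons q todo =>
      cases hq : C.announce q with
      | none => simp only [stepOf, hpc, hq]; exact ⟨_, .selectStuck f q todo hpc hq⟩
      | some req => simp only [stepOf, hpc, hq]; exact ⟨_, .selectCons f q todo req hpc hq⟩
  | simulate f q todo c =>
    cases hc : O.instr c with
    | ret r => simp only [stepOf, hpc, hc]; exact ⟨_, .ret f q todo c r hpc hc⟩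
    | read x k =>
      cases hx : f.D.lookup x with
      | some v => simp only [stepOf, hpc, hc, hx]; exact ⟨_, .readDir f q todo c x k v hpc hc hx⟩
      | none =>
        simp only [stepOf, hpc, hc, hx]
        split_ifs with h1 h2
        · exact ⟨_, .readItem f q todo c x k _ hpc hc hx (.inl ⟨h1, rfl⟩)⟩
        · exact ⟨_, .readItem f q todo c x k _ hpc hc hx (.inr ⟨h2, rfl⟩)⟩
        · exact ⟨_, .readLate f q todo c x k hpc hc hx (by omega)⟩
    | write x v c₁ => simp only [stepOf, hpc, hc]; exact ⟨_, .write f q todo c x v c₁ hpc hc⟩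
    | alloc v k =>
      by_cases hn : C.next f.ltop = none
      · refine (GStep.allocCas f q todo c v k hpc hc hn).exists_of_eq ?_
        simp [stepOf, hpc, hc, hn, casEffect, Config.goto, Config.newVar, setLoc_setLoc]
      · refine (GStep.allocFail f q todo c v k hpc hc hn).exists_of_eq ?_
        simp [stepOf, hpc, hc, hn, casEffect, Config.goto]
  | allocNext f q todo v k =>
    cases hr : C.next f.ltop with
    | none => simp only [stepOf, hpc, hr]; exact ⟨_, .allocStuck f q todo v k hpc hr⟩
    | some r => simp only [stepOf, hpc, hr]; exact ⟨_, .allocNext f q todo v k r hpc hr⟩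
  | allocVal f q todo v k r =>
    simp only [stepOf, hpc, AList.insert_insert]; exact ⟨_, .allocVal f q todo v k r hpc⟩
  | validate f =>
    cases hl : C.S.link p with
    | true => simp only [stepOf, hpc, LLSC.vl, hl, if_true]; exact ⟨_, .validate f hpc hl⟩
    | false =>
      simp only [stepOf, hpc, LLSC.vl, hl, endIter_eq]
      exact ⟨_, .validateFail f hpc hl⟩
  | flush f recs =>
    rcases recs with _ | ⟨⟨x, v⟩, recs⟩
    · simp only [stepOf, hpc]; exact ⟨_, .flushNil f hpc⟩
    · simp only [stepOf, hpc]
      split_ifs with h1 h2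
      · exact ⟨_, .flushLate f x v recs hpc h1⟩
      · exact ⟨_, .flushSkip f x v recs hpc h2⟩
      · exact ⟨_, .flushStore f x v recs hpc (by omega)⟩
  | store f x v sv recs =>
    cases hl : (C.item x).link p with
    | true =>
      simp only [stepOf, hpc, LLSC.sc, hl, if_true]
      exact ⟨_, .store f x v sv recs hpc hl⟩
    | false =>
      refine (GStep.storeFail f x v sv recs hpc hl).exists_of_eq ?_
      simp [stepOf, hpc, LLSC.sc, hl, Config.goto]
  | commit f =>
    cases hl : C.S.link p with
    | true =>
      refine (GStep.commit f hpc hl).exists_of_eq ?_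
      simp [stepOf, hpc, LLSC.sc, hl, endIter_eq, setLoc_setLoc]
    | false =>
      refine (GStep.commitFail f hpc hl).exists_of_eq ?_
      simp [stepOf, hpc, LLSC.sc, hl, endIter_eq, setLoc_setLoc]
  | readRet =>
    cases hr : C.S.val.rvals p with
    | none => simp only [stepOf, hpc, hr]; exact ⟨_, .retStuck hpc hr⟩
    | some r => simp only [stepOf, hpc, hr]; exact ⟨_, .readRet r hpc hr⟩

end LUC

namespace LUC

variable {n : ℕ} {Req Ret V Val σ : Type*}

theorem sum_bits_eq (b : Fin n → Bool) :
    ∑ i : Fin n, (if b i then (2 : ℤ) ^ (i : ℕ) else 0) = (Nat.ofBits b : ℤ) := by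
  induction n with
  | zero => simp
  | succ n ih =>
    rw [Fin.sum_univ_succ, Nat.ofBits_succ]
    have := ih (b ∘ Fin.succ)
    push_cast
    rw [← this, Finset.mul_sum, add_comm]
    congr 1
    · refine Finset.sum_congr rfl fun i _ => ?_
      simp only [Function.comp, Fin.val_succ, pow_succ]
      split_ifs <;> ring
    · cases b 0 <;> simp

theorem testBit_sum_bits (b : Fin n → Bool) (q : Fin n) :
    (∑ i : Fin n, (if b i then (2 : ℤ) ^ (i : ℕ) else 0)).testBit (q : ℕ) = b q := by
  rw [sum_bits_eq]
  exact Nat.testBit_ofBits_lt b q q.2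

/-- The local variables of an iteration after the preparation of `tmp`. -/
def PC.frame? : PC n Req Ret V Val σ → Option (Frame n Ret V Val)
  | .select f _ => some f
  | .simulate f _ _ _ => some f
  | .allocNext f _ _ _ _ => some f
  | .allocVal f _ _ _ _ _ => some f
  | .validate f => some f
  | .flush f _ => some f
  | .store f _ _ _ _ => some f
  | .commit f => some f
  | _ => none

/-- The value of `S` that was read last in the current iteration. -/
def PC.snap? : PC n Req Ret V Val σ → Option (State n Ret)
  | .readToggles _ _ ls => some ls
  | pc => pc.frame?.map (·.ls)

/-- Number of the current iteration, after its LL. -/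
def PC.loop? : PC n Req Ret V Val σ → Option ℕ
  | .readToggles a j _ => some (2 * a + j)
  | pc => pc.frame?.map fun f => 2 * f.attempt + f.iter

/-- The progress that the operation of a thread at `pc` must have made; `linked` tells whether `S`
is unchanged since the latest LL of the thread. -/
def PC.need (pc : PC n Req Ret V Val σ) (linked : Bool) : ℕ :=
  match pc with
  | .llS a j => 2 * a + j
  | pc => match pc.loop? with
    | some i => if linked then i else i + 1
    | none => 3

/-- The bit of `q` in `Toggles`. -/
def bit (C : Config n Req Ret V Val σ) (q : Fin n) : Bool := decide (0 < (C.loc q).toggle)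

/-- Progress of the operation of `q`: every successful SC will announce it (1), it is pending in
`S` (2), it has been applied (3). -/
def LevelGE (C : Config n Req Ret V Val σ) (q : Fin n) (i : ℕ) : Prop :=
  (1 ≤ i → C.S.val.applied q = bit C q ∨ ∀ p f, C.S.link p = true →
    (C.loc p).pc.frame? = some f → f.tmp.applied q = bit C q) ∧
  (2 ≤ i → C.S.val.applied q = bit C q) ∧
  (3 ≤ i → C.S.val.papplied q = bit C q)

theorem LevelGE.mono {C : Config n Req Ret V Val σ} {q : Fin n} {i j : ℕ} (h : LevelGE C q i)
    (hj : j ≤ i) : LevelGE C q j :=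
  ⟨fun k => h.1 (k.trans hj), fun k => h.2.1 (k.trans hj), fun k => h.2.2 (k.trans hj)⟩

/-- Properties of a value of `S` that `p` has read in its current iteration. -/
def SnapOk (C : Config n Req Ret V Val σ) (p : Fin n) (ls : State n Ret) : Prop :=
  (C.S.link p = true → ls = C.S.val) ∧ (C.S.link p = false → ls.seq < C.S.val.seq) ∧
    ∀ q, ls.applied q ≠ ls.papplied q → C.announce q ≠ none

/-- Properties of the local variables of the current iteration of `p`. -/
def FrameOk (C : Config n Req Ret V Val σ) (p : Fin n) (f : Frame n Ret V Val) : Prop :=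
  f.tmp.seq = f.ls.seq + 1 ∧ f.tmp.papplied = f.ls.applied ∧
    (C.S.link p = true → ∀ q, C.S.val.applied q = bit C q → f.tmp.applied q = bit C q)

/-- Invariant of `Toggles`, `S` and `Announce`. -/
structure CtlInv (C : Config n Req Ret V Val σ) : Prop where
  tog : C.toggles = ∑ i : Fin n, (if bit C i then (2 : ℤ) ^ (i : ℕ) else 0)
  abs : ∀ i, (C.loc i).toggle = 2 ^ (i : ℕ) ∨ (C.loc i).toggle = -2 ^ (i : ℕ)
  snap : ∀ p ls, (C.loc p).pc.snap? = some ls → SnapOk C p ls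
  frm : ∀ p f, (C.loc p).pc.frame? = some f → FrameOk C p f
  phase : ∀ q, C.S.val.applied q = bit C q ∨ C.S.val.papplied q = C.S.val.applied q
  level : ∀ q, LevelGE C q ((C.loc q).pc.need (C.S.link q))
  ann : ∀ q, (C.loc q).pc ≠ .idle → (∀ r, (C.loc q).pc ≠ .announce r) → C.announce q ≠ none

theorem CtlInv.of_local {C C' : Config n Req Ret V Val σ} (I : CtlInv C) (p : Fin n)
    (hS : C'.S.val = C.S.val) (hl : ∀ q, q ≠ p → C'.S.link q = C.S.link q)
    (hloc : ∀ q, q ≠ p → C'.loc q = C.loc q)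
    (hann : ∀ q, C.announce q ≠ none → C'.announce q ≠ none)
    (htogs : C'.toggles = C.toggles) (htog : (C'.loc p).toggle = (C.loc p).toggle)
    (hsnap : ∀ ls, (C'.loc p).pc.snap? = some ls → SnapOk C' p ls)
    (hseq : ∀ f, (C'.loc p).pc.frame? = some f →
      f.tmp.seq = f.ls.seq + 1 ∧ f.tmp.papplied = f.ls.applied)
    (hfrm : ∀ f, C'.S.link p = true → (C'.loc p).pc.frame? = some f →
      (∀ q, f.tmp.applied q = bit C q) ∨ C.S.link p = true ∧
        ∃ f₁, (C.loc p).pc.frame? = some f₁ ∧ f₁.tmp.applied = f.tmp.applied)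
    (hneed : LevelGE C p ((C'.loc p).pc.need (C'.S.link p)))
    (hannp : (C'.loc p).pc ≠ .idle → (∀ r, (C'.loc p).pc ≠ .announce r) →
      C'.announce p ≠ none) : CtlInv C' := by
  have hbit : ∀ q, bit C' q = bit C q := by
    intro q
    by_cases hq : q = p
    · subst hq; simp [bit, htog]
    · simp [bit, hloc q hq]
  have hlev : ∀ q i, LevelGE C q i → LevelGE C' q i := by
    intro q i h
    simp only [LevelGE, hS, hbit]
    refine ⟨fun hi => (h.1 hi).imp_right fun H r f hr hf => ?_, h.2.1, h.2.2⟩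
    by_cases hrp : r = p
    · subst hrp
      rcases hfrm f hr hf with h1 | ⟨h1, f₁, h2, h3⟩
      · exact h1 q
      · rw [← h3]; exact H r f₁ h1 h2
    · rw [hl r hrp] at hr
      rw [hloc r hrp] at hf
      exact H r f hr hf
  refine ⟨?_, ?_, ?_, ?_, ?_, ?_, ?_⟩
  · simp only [htogs, hbit]; exact I.tog
  · intro i
    by_cases hq : i = p
    · subst hq; rw [htog]; exact I.abs i
    · rw [hloc i hq]; exact I.abs i
  · intro q ls h
    by_cases hq : q = p
    · subst hq; exact hsnap ls h
    · rw [hloc q hq] at h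
      obtain ⟨h1, h2, h3⟩ := I.snap q ls h
      simp only [SnapOk, hS, hl q hq]
      exact ⟨h1, h2, fun q hq => hann q (h3 q hq)⟩
  · intro q f h
    by_cases hq : q = p
    · subst hq
      refine ⟨(hseq f h).1, (hseq f h).2, fun hlk r => ?_⟩
      rw [hS, hbit]
      rcases hfrm f hlk h with h1 | ⟨h1, f₁, h2, h3⟩
      · exact fun _ => h1 r
      · rw [← h3]; exact (I.frm q f₁ h2).2.2 h1 r
    · rw [hloc q hq] at h
      have := I.frm q f h
      simpa only [FrameOk, hS, hbit, hl q hq] using this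
  · intro q; rw [hS, hbit]; exact I.phase q
  · intro q
    by_cases hq : q = p
    · subst hq; exact hlev _ _ hneed
    · rw [hloc q hq, hl q hq]; exact hlev _ _ (I.level q)
  · intro q
    by_cases hq : q = p
    · subst hq; exact hannp
    · rw [hloc q hq]; exact fun h h' => hann q (I.ann q h h')

theorem CtlInv.of_frame {C : Config n Req Ret V Val σ} (I : CtlInv C) (p : Fin n)
    {item : Addr V → LLSC n (ItemSV Val)} {next : Node → Option Ref}
    {L : Local n Req Ret V Val σ} {f f' : Frame n Ret V Val}
    (hf : (C.loc p).pc.frame? = some f) (hf' : L.pc.frame? = some f')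
    (hls : f'.ls = f.ls) (ha : f'.attempt = f.attempt) (hi : f'.iter = f.iter)
    (hs : f'.tmp.seq = f.tmp.seq) (hp : f'.tmp.papplied = f.tmp.papplied)
    (hap : f'.tmp.applied = f.tmp.applied) (ht : L.toggle = (C.loc p).toggle) :
    CtlInv ({ C with item := item, next := next }.setLoc p L) := by
  have hsnap : ∀ (pc : PC n Req Ret V Val σ) f, pc.frame? = some f → pc.snap? = some f.ls := by
    intro pc f h; cases pc <;> simp_all [PC.frame?, PC.snap?]
  have hneed : ∀ (pc : PC n Req Ret V Val σ) f b, pc.frame? = some f →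
      pc.need b = if b then 2 * (f.attempt : ℕ) + f.iter else 2 * (f.attempt : ℕ) + f.iter + 1 := by
    intro pc f b h; cases pc <;> simp_all [PC.frame?, PC.need, PC.loop?]
  have hpc : (C.loc p).pc ≠ .idle ∧ ∀ r, (C.loc p).pc ≠ .announce r := by
    constructor <;> intros <;> intro h <;> simp [h, PC.frame?] at hf
  refine I.of_local p rfl (fun _ _ => rfl) (fun q hq => setLoc_loc_ne _ hq _) (fun _ h => h) rfl
    (by simpa using ht) ?_ ?_ ?_ ?_ ?_
  · intro ls h
    simp only [setLoc_loc_self, hsnap _ _ hf', Option.some.injEq] at h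
    rw [← h, hls]
    exact I.snap p f.ls (hsnap _ _ hf)
  · intro g h
    simp only [setLoc_loc_self, hf', Option.some.injEq] at h
    rw [← h, hs, hp, hls]
    exact ⟨(I.frm p f hf).1, (I.frm p f hf).2.1⟩
  · intro g hl h
    simp only [setLoc_loc_self, hf', Option.some.injEq] at h
    exact .inr ⟨hl, f, hf, by rw [← h, hap]⟩
  · have := I.level p
    rw [hneed _ _ _ hf] at this
    simp only [setLoc_loc_self, setLoc_S]
    rw [hneed _ _ _ hf', ha, hi]
    exact this
  · intro _ _
    exact I.ann p hpc.1 hpc.2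

theorem snap?_endLoc (p : Fin n) (L : Local n Req Ret V Val σ) (a j : Fin 2) :
    (endLoc p L a j).pc.snap? = none := by
  unfold endLoc; split_ifs <;> rfl

theorem frame?_endLoc (p : Fin n) (L : Local n Req Ret V Val σ) (a j : Fin 2) :
    (endLoc p L a j).pc.frame? = none := by
  unfold endLoc; split_ifs <;> rfl

theorem toggle_endLoc (p : Fin n) (L : Local n Req Ret V Val σ) (a j : Fin 2) :
    (endLoc p L a j).toggle = L.toggle := by
  unfold endLoc; split_ifs <;> rfl

theorem need_endLoc (p : Fin n) (L : Local n Req Ret V Val σ) (a j : Fin 2) (b : Bool) :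
    (endLoc p L a j).pc.need b ≤ 2 * a + j + 1 := by
  unfold endLoc
  split_ifs with h1 h2
  · subst h1; simp [PC.need]
  · have : (j : ℕ) ≠ 0 := fun h => h1 (Fin.ext h)
    subst h2; simp [PC.need]; omega
  · have : (j : ℕ) ≠ 0 := fun h => h1 (Fin.ext h)
    have : (a : ℕ) ≠ 0 := fun h => h2 (Fin.ext h)
    simp only [PC.need, PC.loop?, PC.frame?, Option.map]
    omega

theorem CtlInv.of_end {C : Config n Req Ret V Val σ} (I : CtlInv C) (p : Fin n)
    {L : Local n Req Ret V Val σ} {f : Frame n Ret V Val}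
    (hf : (C.loc p).pc.frame? = some f) (ht : L.toggle = (C.loc p).toggle)
    (hl : C.S.link p = false) :
    CtlInv (C.setLoc p (endLoc p L f.attempt f.iter)) := by
  have hpc : (C.loc p).pc ≠ .idle ∧ ∀ r, (C.loc p).pc ≠ .announce r := by
    constructor <;> intros <;> intro h <;> simp [h, PC.frame?] at hf
  refine I.of_local p rfl (fun _ _ => rfl) (fun q hq => setLoc_loc_ne _ hq _) (fun _ h => h) rfl
    (by simp [toggle_endLoc, ht]) ?_ ?_ ?_ ?_ ?_
  · simp [snap?_endLoc]
  · simp [frame?_endLoc]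
  · simp [frame?_endLoc]
  · have := I.level p
    rw [hl] at this
    refine this.mono ?_
    simp only [setLoc_loc_self]
    refine (need_endLoc ..).trans (le_of_eq ?_)
    cases h : (C.loc p).pc <;> simp_all [PC.frame?, PC.need, PC.loop?]
  · intro _ _
    exact I.ann p hpc.1 hpc.2

theorem CtlInv.announce_ne_none {C : Config n Req Ret V Val σ} (I : CtlInv C) {q : Fin n}
    (hq : C.S.val.applied q ≠ C.S.val.papplied q) :
    (C.loc q).pc ≠ .idle ∧ (∀ r, (C.loc q).pc ≠ .announce r) ∧ (C.loc q).pc ≠ .fetchAdd ∧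
      (C.loc q).pc ≠ .readRet ∧ ∀ r, (C.loc q).pc ≠ .respond r := by
  have : ¬ 3 ≤ (C.loc q).pc.need (C.S.link q) := by
    intro h
    have := I.level q
    exact hq ((this.2.1 (by omega)).trans (this.2.2 h).symm)
  refine ⟨?_, ?_, ?_, ?_, ?_⟩ <;> intros <;> intro h <;>
    exact this (by simp [h, PC.need, PC.loop?, PC.frame?])

theorem CtlInv.commit {C : Config n Req Ret V Val σ} (I : CtlInv C) (p : Fin n)
    {f : Frame n Ret V Val} (h : (C.loc p).pc = .commit f) (hl : C.S.link p = true) (hd : Node)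
    {L : Local n Req Ret V Val σ} (hL : L.toggle = (C.loc p).toggle) :
    CtlInv ({ C with S := ⟨{ f.tmp with varList := hd }, fun _ => false⟩ }.setLoc p
        (endLoc p L f.attempt f.iter)) := by
  have hf : (C.loc p).pc.frame? = some f := by simp [h, PC.frame?]
  obtain ⟨fs, fp, fa⟩ := I.frm p f hf
  have fa := fa hl
  have hls : f.ls = C.S.val := (I.snap p f.ls (by simp [h, PC.frame?, PC.snap?])).1 hl
  rw [hls] at fs fp
  set C' : Config n Req Ret V Val σ :=
    { C with S := ⟨{ f.tmp with varList := hd }, fun _ => false⟩ }.setLoc p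
        (endLoc p L f.attempt f.iter) with hC'
  have hloc : ∀ q, q ≠ p → C'.loc q = C.loc q := fun q hq => setLoc_loc_ne _ hq _
  have hlocp : C'.loc p = endLoc p L f.attempt f.iter := setLoc_loc_self _ _ _
  have hap : C'.S.val.applied = f.tmp.applied := rfl
  have hpap : C'.S.val.papplied = C.S.val.applied := fp
  have hlink : ∀ q, C'.S.link q = false := fun _ => rfl
  have hbit : ∀ q, bit C' q = bit C q := by
    intro q
    by_cases hq : q = p
    · subst hq; simp [bit, hlocp, toggle_endLoc, hL]
    · simp [bit, hloc q hq]
  have hlev : ∀ q i, LevelGE C q i → LevelGE C' q (i + 1) := by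
    intro q i H
    simp only [LevelGE, hbit, hlink, hap, hpap]
    refine ⟨fun _ => .inr (by simp), fun hi => ?_, fun hi => H.2.1 (by omega)⟩
    rcases H.1 (by omega) with h1 | h1
    · exact fa q h1
    · exact h1 p f hl hf
  refine ⟨?_, ?_, ?_, ?_, ?_, ?_, ?_⟩
  · simp only [hbit]; exact I.tog
  · intro i
    by_cases hq : i = p
    · subst hq; rw [hlocp, toggle_endLoc, hL]; exact I.abs i
    · rw [hloc i hq]; exact I.abs i
  · intro q ls h
    by_cases hq : q = p
    · subst hq; rw [hlocp, snap?_endLoc] at h; simp at h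
    · rw [hloc q hq] at h
      obtain ⟨h1, h2, h3⟩ := I.snap q ls h
      refine ⟨by simp [hlink], fun _ => ?_, h3⟩
      change ls.seq < f.tmp.seq
      rw [fs]
      cases hlq : C.S.link q with
      | true => rw [h1 hlq]; omega
      | false => have := h2 hlq; omega
  · intro q f h
    by_cases hq : q = p
    · subst hq; rw [hlocp, frame?_endLoc] at h; simp at h
    · rw [hloc q hq] at h
      have := I.frm q f h
      exact ⟨this.1, this.2.1, by simp [hlink]⟩
  · intro q
    rw [hap, hpap, hbit]
    by_cases hq : C.S.val.applied q = bit C q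
    · exact .inl (fa q hq)
    · by_cases hq' : f.tmp.applied q = bit C q
      · exact .inl hq'
      · right; revert hq hq'; cases bit C q <;> simp +contextual
  · intro q
    rw [hlink]
    by_cases hq : q = p
    · subst hq
      rw [hlocp]
      refine LevelGE.mono (hlev _ _ (I.level q)) ((need_endLoc ..).trans (le_of_eq ?_))
      simp [h, PC.need, PC.loop?, PC.frame?, hl]
    · rw [hloc q hq]
      by_cases h3 : ∃ i, (C.loc q).pc.loop? = some i
      · obtain ⟨i, h3⟩ := h3
        refine LevelGE.mono (hlev _ _ (I.level q)) ?_
        cases hpc : (C.loc q).pc <;> simp_all [PC.loop?, PC.need, PC.frame?] <;>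
          (split_ifs <;> omega)
      · refine LevelGE.mono (hlev _ _ (I.level q)) ?_
        cases hpc : (C.loc q).pc <;> simp_all [PC.loop?, PC.need, PC.frame?]
  · intro q
    by_cases hq : q = p
    · subst hq; exact fun _ _ => I.ann q (by simp [h]) (by simp [h])
    · rw [hloc q hq]; exact I.ann q

theorem CtlInv.fetchAdd {C : Config n Req Ret V Val σ} (I : CtlInv C) (p : Fin n)
    (h : (C.loc p).pc = .fetchAdd) {c : ℕ} {r : Ref} :
    CtlInv ({ C with toggles := C.toggles + -(C.loc p).toggle }.setLoc p
        ⟨.llS 0 0, -(C.loc p).toggle, c, r⟩) := by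
  set C' : Config n Req Ret V Val σ :=
    { C with toggles := C.toggles + -(C.loc p).toggle }.setLoc p
        ⟨.llS 0 0, -(C.loc p).toggle, c, r⟩ with hC'
  have hloc : ∀ q, q ≠ p → C'.loc q = C.loc q := fun q hq => setLoc_loc_ne _ hq _
  have hlocp : C'.loc p = ⟨.llS 0 0, -(C.loc p).toggle, c, r⟩ := setLoc_loc_self _ _ _
  have hbit : ∀ q, q ≠ p → bit C' q = bit C q := fun q hq => by simp [bit, hloc q hq]
  have hpos : (0 : ℤ) < 2 ^ (p : ℕ) := by positivity
  have hbitp : bit C' p = !bit C p := by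
    simp only [bit, hlocp]
    rcases I.abs p with h | h <;> rw [h] <;> simp [hpos]
  have hlv : C.S.val.applied p = bit C p ∧ C.S.val.papplied p = bit C p := by
    have := I.level p
    simp only [h, PC.need, PC.loop?, PC.frame?, Option.map] at this
    exact ⟨this.2.1 (by omega), this.2.2 le_rfl⟩
  refine ⟨?_, ?_, ?_, ?_, ?_, ?_, ?_⟩
  · change C.toggles + -(C.loc p).toggle = _
    have : ∑ i : Fin n, (if bit C' i then (2 : ℤ) ^ (i : ℕ) else 0) -
        ∑ i : Fin n, (if bit C i then (2 : ℤ) ^ (i : ℕ) else 0) = -(C.loc p).toggle := by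
      rw [← Finset.sum_sub_distrib, Finset.sum_eq_single p]
      · rw [hbitp]
        rcases I.abs p with h | h <;> simp [bit, h, hpos, hpos.le]
      · intro q _ hq; rw [hbit q hq]; simp
      · simp
    rw [I.tog]
    linarith
  · intro i
    by_cases hq : i = p
    · subst hq; rw [hlocp]; rcases I.abs i with h | h <;> simp [h]
    · rw [hloc i hq]; exact I.abs i
  · intro q ls h
    by_cases hq : q = p
    · subst hq; simp [hlocp, PC.snap?, PC.frame?] at h
    · rw [hloc q hq] at h
      exact I.snap q ls h
  · intro q f h
    by_cases hq : q = p
    · subst hq; simp [hlocp, PC.frame?] at h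
    · rw [hloc q hq] at h
      obtain ⟨h1, h2, h3⟩ := I.frm q f h
      refine ⟨h1, h2, fun hlk r hr => ?_⟩
      by_cases hrp : r = p
      · subst hrp
        exfalso
        change C.S.val.applied r = _ at hr
        rw [hlv.1, hbitp] at hr
        revert hr; cases bit C r <;> simp
      · rw [hbit r hrp] at hr ⊢; exact h3 hlk r hr
  · intro q
    by_cases hq : q = p
    · subst hq; exact .inr (hlv.2.trans hlv.1.symm)
    · rw [hbit q hq]; exact I.phase q
  · intro q
    by_cases hq : q = p
    · subst hq
      rw [hlocp]
      simp [LevelGE, PC.need]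
    · have := I.level q
      rw [hloc q hq]
      simp only [LevelGE, hbit q hq]
      refine ⟨fun hi => (this.1 hi).imp_right fun H r f hr hf => ?_, this.2.1, this.2.2⟩
      by_cases hrp : r = p
      · subst hrp; simp [hlocp, PC.frame?] at hf
      · rw [hloc r hrp] at hf; exact H r f hr hf
  · intro q
    by_cases hq : q = p
    · subst hq; exact fun _ _ => I.ann q (by simp [h]) (by simp [h])
    · rw [hloc q hq]; exact I.ann q

theorem CtlInv.init (O : SeqObject Req Ret V Val σ) : CtlInv (initial O n) := by
  have hb : ∀ q, bit (initial O n) q = false := by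
    intro q
    have hpos : (0 : ℤ) < 2 ^ (q : ℕ) := by positivity
    simp only [bit, initial]
    simp [hpos.le]
  refine ⟨?_, ?_, ?_, ?_, ?_, ?_, ?_⟩
  · simp [hb]; rfl
  · intro i; exact .inr rfl
  · intro p ls h; simp [initial, PC.snap?, PC.frame?] at h
  · intro p ls h; simp [initial, PC.frame?] at h
  · intro q; exact .inr rfl
  · intro q; simp only [LevelGE, hb]; exact ⟨fun _ => .inl rfl, fun _ => rfl, fun _ => rfl⟩
  · intro q h; exact absurd rfl h

theorem CtlInv.invoke {C : Config n Req Ret V Val σ} (I : CtlInv C) (p : Fin n) (req : Req)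
    (h : (C.loc p).pc = .idle) : CtlInv (C.goto p (.announce req)) := by
  refine I.of_local p rfl (fun _ _ => rfl) (fun q hq => setLoc_loc_ne _ hq _) (fun _ h => h) rfl
    (by simp [Config.goto]) ?_ ?_ ?_ ?_ ?_
  · simp [Config.goto, PC.snap?, PC.frame?]
  · simp [Config.goto, PC.frame?]
  · simp [Config.goto, PC.frame?]
  · have := I.level p
    rw [h] at this
    simpa [Config.goto, PC.need, PC.loop?, PC.frame?] using this
  · simp [Config.goto]

theorem CtlInv.respond {C : Config n Req Ret V Val σ} (I : CtlInv C) (p : Fin n) (r : Ret)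
    (h : (C.loc p).pc = .respond r) : CtlInv (C.goto p .idle) := by
  refine I.of_local p rfl (fun _ _ => rfl) (fun q hq => setLoc_loc_ne _ hq _) (fun _ h => h) rfl
    (by simp [Config.goto]) ?_ ?_ ?_ ?_ ?_
  · simp [Config.goto, PC.snap?, PC.frame?]
  · simp [Config.goto, PC.frame?]
  · simp [Config.goto, PC.frame?]
  · have := I.level p
    rw [h] at this
    simpa [Config.goto, PC.need, PC.loop?, PC.frame?] using this
  · simp [Config.goto]

variable [DecidableEq V] {O : SeqObject Req Ret V Val σ}

theorem CtlInv.step {C C' : Config n Req Ret V Val σ} {G G' : Ghost n V Val} {p : Fin n}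
    (I : CtlInv C) (hs : GStep O C G p C' G') : CtlInv C' := by
  cases hs with
  | selectStuck | allocStuck | retStuck => exact I
  | fetchAdd h => exact I.fetchAdd p h
  | commit f h hl => exact I.commit p h hl _ rfl
  | validateFail f h hl => exact I.of_end p (by rw [h]; rfl) rfl hl
  | commitFail f h hl => exact I.of_end p (by rw [h]; rfl) rfl hl
  | announce req h =>
    refine I.of_local p rfl (fun _ _ => rfl) (fun q hq => setLoc_loc_ne _ hq _) ?_ rfl
      (by simp) ?_ ?_ ?_ ?_ ?_
    · intro q hq
      by_cases hqp : q = p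
      · subst hqp; simp
      · simpa [hqp] using hq
    · simp [PC.snap?, PC.frame?]
    · simp [PC.frame?]
    · simp [PC.frame?]
    · have := I.level p
      rw [h] at this
      simpa [PC.need, PC.loop?, PC.frame?] using this
    · simp
  | llS a j h =>
    refine I.of_local p rfl (fun q hq => by simp [LLSC.ll, hq])
      (fun q hq => setLoc_loc_ne _ hq _) (fun _ h => h) rfl (by simp) ?_ ?_ ?_ ?_ ?_
    · intro ls hls
      simp only [setLoc_loc_self, PC.snap?, Option.some.injEq] at hls
      subst hls
      refine ⟨fun _ => rfl, by simp [LLSC.ll], fun q hq => ?_⟩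
      exact I.ann q (I.announce_ne_none hq).1 (I.announce_ne_none hq).2.1
    · simp [PC.frame?]
    · simp [PC.frame?]
    · have := I.level p
      rw [h] at this
      simpa [LLSC.ll, PC.need, PC.loop?, PC.frame?] using this
    · exact fun _ _ => I.ann p (by simp [h]) (by simp [h])
  | readToggles a j ls h =>
    refine I.of_local p rfl (fun _ _ => rfl) (fun q hq => setLoc_loc_ne _ hq _) (fun _ h => h) rfl
      (by simp) ?_ ?_ ?_ ?_ ?_
    · intro ls' hls
      simp only [setLoc_loc_self, PC.snap?, PC.frame?, Option.map, Option.some.injEq,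
        firstFrame] at hls
      subst hls
      exact I.snap p ls (by rw [h]; rfl)
    · simp [PC.frame?, firstFrame]
    · intro f _ hf
      simp only [setLoc_loc_self, PC.frame?, Option.some.injEq] at hf
      subst hf
      refine .inl fun q => ?_
      simp only [firstFrame]
      rw [I.tog]
      exact testBit_sum_bits _ q
    · have := I.level p
      rw [h] at this
      simp only [setLoc_loc_self]
      exact this
    · exact fun _ _ => I.ann p (by simp [h]) (by simp [h])
  | readRet r h hr =>
    refine I.of_local p rfl (fun _ _ => rfl) (fun q hq => setLoc_loc_ne _ hq _) (fun _ h => h) rfl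
      (by simp) ?_ ?_ ?_ ?_ ?_
    · simp [PC.snap?, PC.frame?]
    · simp [PC.frame?]
    · simp [PC.frame?]
    · have := I.level p
      rw [h] at this
      simpa [PC.need, PC.loop?, PC.frame?] using this
    · exact fun _ _ => I.ann p (by simp [h]) (by simp [h])
  | _ =>
    have hf := congrArg PC.frame? ‹(C.loc p).pc = _›
    exact I.of_frame p hf rfl rfl rfl rfl rfl rfl rfl rfl

end LUC

namespace LUC

variable {n : ℕ} {Req Ret V Val σ : Type*}

/-- If `x` was allocated dynamically, then in a round before `s`. -/
def Before (G : Ghost n V Val) (s : ℕ) (x : Addr V) : Prop :=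
  ∀ r, x = .inr r → ∃ s' j, G.rank (.cell r) = some (s', j) ∧ s' < s

/-- If `x` was allocated dynamically, then at a position up to `(s, j)`. -/
def UpTo (G : Ghost n V Val) (s j : ℕ) (x : Addr V) : Prop :=
  ∀ r, x = .inr r → ∃ s' i, G.rank (.cell r) = some (s', i) ∧ (s' < s ∨ s' = s ∧ i ≤ j)

/-- The node `ltop` belongs to the list of the current round, and the variables that are in use in
the heap `h` precede it. -/
def TopOk (G : Ghost n V Val) (h : Heap V Val) (f : Frame n Ret V Val) : Prop :=
  ∃ j, G.rank f.ltop = some (f.ls.seq, j) ∧ ∀ x ∈ h.used, UpTo G f.ls.seq j x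

/-- Properties of the nodes that a thread at `pc` uses. -/
def RankPc (G : Ghost n V Val) (next : Node → Option Ref) (h : Heap V Val) :
    PC n Req Ret V Val σ → Prop
  | .readToggles _ _ ls => G.rank ls.varList = some (ls.seq, 0)
  | .allocNext f _ _ _ _ => TopOk G h f ∧ next f.ltop ≠ none
  | .allocVal f _ _ _ _ r => f.ltop = .cell r ∧
      ∃ j, G.rank f.ltop = some (f.ls.seq, j + 1) ∧ ∀ x ∈ h.used, UpTo G f.ls.seq j x
  | pc => ∀ f, pc.frame? = some f → TopOk G h f

/-- Invariant of the lists of allocated variables. -/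
structure RankInv (C : Config n Req Ret V Val σ) (G : Ghost n V Val) : Prop where
  fresh : ∀ (p : Fin n) (c : ℕ), (C.loc p).cnt ≤ c →
    G.rank (.cell ((p : ℕ), c)) = none ∧ G.rank (.head ((p : ℕ), c)) = none
  pv : ∀ p : Fin n, (∃ c < (C.loc p).cnt, (C.loc p).pvar = ((p : ℕ), c)) ∧
    G.rank (.cell (C.loc p).pvar) = none
  nxt : ∀ a r, C.next a = some r →
    ∃ s j, G.rank a = some (s, j) ∧ G.rank (.cell r) = some (s, j + 1)
  top : G.rank C.S.val.varList = some (C.S.val.seq, 0)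
  used : ∀ s ≤ C.S.val.seq, ∀ x ∈ (G.hist s).used, Before G s x
  pcs : ∀ p, RankPc G C.next (G.hp p) (C.loc p).pc

theorem Before.mono {G G' : Ghost n V Val} (hr : ∀ a i, G.rank a = some i → G'.rank a = some i)
    {s : ℕ} {x : Addr V} (h : Before G s x) : Before G' s x := fun r hx => by
  obtain ⟨s', j, h1, h2⟩ := h r hx
  exact ⟨s', j, hr _ _ h1, h2⟩

theorem UpTo.mono {G G' : Ghost n V Val} (hr : ∀ a i, G.rank a = some i → G'.rank a = some i)
    {s j : ℕ} {x : Addr V} (h : UpTo G s j x) : UpTo G' s j x := fun r hx => by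
  obtain ⟨s', i, h1, h2⟩ := h r hx
  exact ⟨s', i, hr _ _ h1, h2⟩

theorem TopOk.mono {G G' : Ghost n V Val} (hr : ∀ a i, G.rank a = some i → G'.rank a = some i)
    {h : Heap V Val} {f : Frame n Ret V Val} (H : TopOk G h f) : TopOk G' h f := by
  obtain ⟨j, h1, h2⟩ := H
  exact ⟨j, hr _ _ h1, fun x hx => (h2 x hx).mono hr⟩

theorem RankPc.mono {G G' : Ghost n V Val} (hr : ∀ a i, G.rank a = some i → G'.rank a = some i)
    {nx nx' : Node → Option Ref} (hn : ∀ a, nx a ≠ none → nx' a ≠ none)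
    {h : Heap V Val} {pc : PC n Req Ret V Val σ} (H : RankPc G nx h pc) : RankPc G' nx' h pc := by
  cases pc with
  | readToggles => exact hr _ _ H
  | allocNext => exact ⟨H.1.mono hr, hn _ H.2⟩
  | allocVal =>
    obtain ⟨h0, j, h1, h2⟩ := H
    exact ⟨h0, j, hr _ _ h1, fun x hx => (h2 x hx).mono hr⟩
  | _ => exact fun f hf => (H f hf).mono hr

theorem RankPc.of_none {G : Ghost n V Val} {nx : Node → Option Ref} {h : Heap V Val}
    {pc : PC n Req Ret V Val σ} (H : pc.snap? = none) : RankPc G nx h pc := by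
  cases pc <;> simp_all [PC.snap?, PC.frame?, RankPc]

theorem RankInv.of_local {C C' : Config n Req Ret V Val σ} {G G' : Ghost n V Val}
    (I : RankInv C G) (p : Fin n) (hS : C'.S.val = C.S.val) (hn : C'.next = C.next)
    (hloc : ∀ q, q ≠ p → C'.loc q = C.loc q) (hhp : ∀ q, q ≠ p → G'.hp q = G.hp q)
    (hr : G'.rank = G.rank) (hh : G'.hist = G.hist)
    (hpv : (C'.loc p).pvar = (C.loc p).pvar ∧ (C.loc p).cnt ≤ (C'.loc p).cnt ∨
      ∃ c, (C'.loc p).pvar = ((p : ℕ), c) ∧ (C.loc p).cnt ≤ c ∧ c < (C'.loc p).cnt)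
    (hp : RankPc G C.next (G'.hp p) (C'.loc p).pc) : RankInv C' G' := by
  have hr' : ∀ a i, G.rank a = some i → G'.rank a = some i := by rw [hr]; simp
  have hcnt : ∀ q, (C.loc q).cnt ≤ (C'.loc q).cnt := by
    intro q
    by_cases hq : q = p
    · subst hq; rcases hpv with h | ⟨_, h⟩ <;> omega
    · rw [hloc q hq]
  refine ⟨?_, ?_, ?_, ?_, ?_, ?_⟩
  · intro q c hc
    rw [hr]; exact I.fresh q c ((hcnt q).trans hc)
  · intro q
    rw [hr]
    by_cases hq : q = p
    · subst hq
      obtain ⟨⟨c, h1, h2⟩, h3⟩ := I.pv q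
      rcases hpv with h | ⟨c', h⟩
      · rw [h.1]; exact ⟨⟨c, by omega, h2⟩, h3⟩
      · rw [h.1]; exact ⟨⟨_, h.2.2, rfl⟩, (I.fresh q _ h.2.1).1⟩
    · rw [hloc q hq]; exact I.pv q
  · rw [hn, hr]; exact I.nxt
  · rw [hS, hr]; exact I.top
  · intro s hs x hx
    rw [hS] at hs; rw [hh] at hx
    exact (I.used s hs x hx).mono hr'
  · intro q
    rw [hn]
    by_cases hq : q = p
    · subst hq; exact hp.mono hr' fun _ h => h
    · rw [hloc q hq, hhp q hq]; exact (I.pcs q).mono hr' fun _ h => h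

theorem endLoc_pvar (p : Fin n) (L : Local n Req Ret V Val σ) (a j : Fin 2) :
    (endLoc p L a j).pvar = L.pvar ∧ L.cnt ≤ (endLoc p L a j).cnt ∨
      (endLoc p L a j).pvar = ((p : ℕ), L.cnt) ∧ L.cnt < (endLoc p L a j).cnt := by
  unfold endLoc; split_ifs <;> simp

theorem RankInv.notMem_used {C : Config n Req Ret V Val σ} {G : Ghost n V Val}
    (I : RankInv C G) {p : Fin n} {f : Frame n Ret V Val} {q : Fin n} {todo : List (Fin n)}
    {v : Val} {k : Addr V → σ} {r : Ref} (h : (C.loc p).pc = .allocVal f q todo v k r) :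
    (.inr r : Addr V) ∉ (G.hp p).used := by
  intro hr
  have := I.pcs p
  rw [h] at this
  obtain ⟨h0, j, h1, h2⟩ := this
  obtain ⟨s', i, h3, h4⟩ := h2 _ hr r rfl
  rw [h0, h3] at h1
  simp only [Option.some.injEq, Prod.mk.injEq] at h1
  omega

theorem RankInv.allocCas {C : Config n Req Ret V Val σ} {G : Ghost n V Val}
    (I : RankInv C G) (p : Fin n) (f : Frame n Ret V Val) (q : Fin n) (todo : List (Fin n))
    (c : σ) (v : Val) (k : Addr V → σ) (h : (C.loc p).pc = .simulate f q todo c) :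
    RankInv ({ C with next := Function.update C.next f.ltop (some (C.loc p).pvar) }.setLoc p
        ⟨.allocNext f q todo v k, (C.loc p).toggle, (C.loc p).cnt + 1, ((p : ℕ), (C.loc p).cnt)⟩)
        (G.setRank (.cell (C.loc p).pvar) ((G.rank f.ltop).map fun a => (a.1, a.2 + 1))) := by
  have hT : TopOk G (G.hp p) f := by
    have := I.pcs p
    rw [h] at this
    exact this f rfl
  obtain ⟨j, hj, hu⟩ := hT
  obtain ⟨⟨c₀, hc₀, hpv⟩, hrk⟩ := I.pv p
  have hne : ∀ a i, G.rank a = some i → a ≠ .cell (C.loc p).pvar := by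
    intro a i ha e; rw [e, hrk] at ha; cases ha
  have hr : ∀ a, a ≠ .cell (C.loc p).pvar → (G.setRank (.cell (C.loc p).pvar)
      ((G.rank f.ltop).map fun a => (a.1, a.2 + 1))).rank a = G.rank a := by
    intro a ha; simp [Ghost.setRank, ha]
  have hrp : (G.setRank (.cell (C.loc p).pvar)
      ((G.rank f.ltop).map fun a => (a.1, a.2 + 1))).rank (.cell (C.loc p).pvar) =
      some (f.ls.seq, j + 1) := by
    simp [Ghost.setRank, hj]
  have hr' : ∀ a i, G.rank a = some i → (G.setRank (.cell (C.loc p).pvar)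
      ((G.rank f.ltop).map fun a => (a.1, a.2 + 1))).rank a = some i := by
    intro a i ha; rw [hr a (hne a i ha), ha]
  have hhist : (G.setRank (.cell (C.loc p).pvar)
      ((G.rank f.ltop).map fun a => (a.1, a.2 + 1))).hist = G.hist := rfl
  have hhp : (G.setRank (.cell (C.loc p).pvar)
      ((G.rank f.ltop).map fun a => (a.1, a.2 + 1))).hp = G.hp := rfl
  generalize G.setRank (.cell (C.loc p).pvar)
      ((G.rank f.ltop).map fun a => (a.1, a.2 + 1)) = G' at *
  have hnx : ∀ a, C.next a ≠ none →
      Function.update C.next f.ltop (some (C.loc p).pvar) a ≠ none := by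
    intro a ha
    by_cases hq : a = f.ltop
    · subst hq; simp
    · simpa [hq] using ha
  refine ⟨?_, ?_, ?_, ?_, ?_, ?_⟩
  · intro q c hc
    have hc' : (C.loc q).cnt ≤ c := by
      by_cases hq : q = p
      · subst hq; simp only [setLoc_loc_self] at hc; omega
      · rwa [setLoc_loc_ne _ hq] at hc
    obtain ⟨h1, h2⟩ := I.fresh q c hc'
    refine ⟨?_, ?_⟩
    · rw [hr _ fun e => ?_, h1]
      rw [hpv] at e
      simp only [Node.cell.injEq, Prod.mk.injEq] at e
      have := Fin.ext e.1
      subst this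
      omega
    · rw [hr _ (by simp), h2]
  · intro q
    by_cases hq : q = p
    · subst hq
      rw [setLoc_loc_self]
      refine ⟨⟨(C.loc q).cnt, Nat.lt_succ_self _, rfl⟩, ?_⟩
      rw [hr _ fun e => ?_, (I.fresh q _ le_rfl).1]
      rw [hpv] at e
      simp only [Node.cell.injEq, Prod.mk.injEq, true_and] at e
      omega
    · rw [setLoc_loc_ne _ hq]
      refine ⟨(I.pv q).1, ?_⟩
      rw [hr _ fun e => ?_, (I.pv q).2]
      obtain ⟨⟨c', _, h'⟩, _⟩ := I.pv q
      rw [hpv, h'] at e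
      simp only [Node.cell.injEq, Prod.mk.injEq] at e
      exact hq (Fin.ext e.1)
  · intro a r ha
    by_cases hq : a = f.ltop
    · subst hq
      simp only [setLoc_next, Function.update_self, Option.some.injEq] at ha
      rw [← ha]
      exact ⟨_, _, hr' _ _ hj, hrp⟩
    · simp only [setLoc_next, ne_eq, hq, not_false_eq_true, Function.update_of_ne] at ha
      obtain ⟨s, i, h1, h2⟩ := I.nxt a r ha
      exact ⟨s, i, hr' _ _ h1, hr' _ _ h2⟩
  · exact hr' _ _ I.top
  · intro s hs x hx
    rw [hhist] at hx
    exact (I.used s hs x hx).mono hr'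
  · intro q
    rw [hhp]
    by_cases hq : q = p
    · subst hq
      rw [setLoc_loc_self]
      refine ⟨⟨j, hr' _ _ hj, fun x hx => (hu x hx).mono hr'⟩, ?_⟩
      simp
    · rw [setLoc_loc_ne _ hq]
      exact (I.pcs q).mono hr' hnx

theorem RankInv.commit {C : Config n Req Ret V Val σ} {G : Ghost n V Val}
    (I : RankInv C G) (J : CtlInv C) (p : Fin n) {f : Frame n Ret V Val}
    (h : (C.loc p).pc = .commit f) (hl : C.S.link p = true) :
    RankInv ({ C with
          S := ⟨{ f.tmp with varList := .head ((p : ℕ), (C.loc p).cnt) }, fun _ => false⟩ }.setLoc p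
        (endLoc p { C.loc p with cnt := (C.loc p).cnt + 1 } f.attempt f.iter))
        ((G.setHist (f.ls.seq + 1) (G.hp p)).setRank (.head ((p : ℕ), (C.loc p).cnt))
          (some (f.ls.seq + 1, 0))) := by
  have hls : f.ls = C.S.val := (J.snap p f.ls (by rw [h]; rfl)).1 hl
  have hseq : f.tmp.seq = f.ls.seq + 1 := (J.frm p f (by rw [h]; rfl)).1
  obtain ⟨j, hj, hu⟩ : TopOk G (G.hp p) f := by
    have := I.pcs p
    rw [h] at this
    exact this f rfl
  obtain ⟨hfc, hfh⟩ := I.fresh p _ le_rfl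
  have hr : ∀ a, a ≠ .head ((p : ℕ), (C.loc p).cnt) →
      ((G.setHist (f.ls.seq + 1) (G.hp p)).setRank (.head ((p : ℕ), (C.loc p).cnt))
        (some (f.ls.seq + 1, 0))).rank a = G.rank a := by
    intro a ha; simp [Ghost.setRank, Ghost.setHist, ha]
  have hrp : ((G.setHist (f.ls.seq + 1) (G.hp p)).setRank (.head ((p : ℕ), (C.loc p).cnt))
        (some (f.ls.seq + 1, 0))).rank (.head ((p : ℕ), (C.loc p).cnt)) =
      some (f.ls.seq + 1, 0) := by
    simp [Ghost.setRank]
  have hhist : ((G.setHist (f.ls.seq + 1) (G.hp p)).setRank (.head ((p : ℕ), (C.loc p).cnt))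
        (some (f.ls.seq + 1, 0))).hist = Function.update G.hist (f.ls.seq + 1) (G.hp p) := rfl
  have hhp : ((G.setHist (f.ls.seq + 1) (G.hp p)).setRank (.head ((p : ℕ), (C.loc p).cnt))
        (some (f.ls.seq + 1, 0))).hp = G.hp := rfl
  generalize (G.setHist (f.ls.seq + 1) (G.hp p)).setRank (.head ((p : ℕ), (C.loc p).cnt))
        (some (f.ls.seq + 1, 0)) = G' at *
  have hr' : ∀ a i, G.rank a = some i → G'.rank a = some i := by
    intro a i ha
    rw [hr a fun e => ?_, ha]
    rw [e, hfh] at ha; cases ha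
  have hend := endLoc_pvar p { C.loc p with cnt := (C.loc p).cnt + 1 } f.attempt f.iter
  refine ⟨?_, ?_, ?_, ?_, ?_, ?_⟩
  · intro q c hc
    by_cases hq : q = p
    · subst hq
      simp only [setLoc_loc_self] at hc
      have hc' : (C.loc q).cnt + 1 ≤ c := by rcases hend with h | h <;> simp at h <;> omega
      obtain ⟨h1, h2⟩ := I.fresh q c (by omega)
      refine ⟨by rw [hr _ (by simp), h1], ?_⟩
      rw [hr _ fun e => ?_, h2]
      simp only [Node.head.injEq, Prod.mk.injEq, true_and] at e
      omega
    · rw [setLoc_loc_ne _ hq] at hc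
      obtain ⟨h1, h2⟩ := I.fresh q c hc
      refine ⟨by rw [hr _ (by simp), h1], ?_⟩
      rw [hr _ fun e => ?_, h2]
      simp only [Node.head.injEq, Prod.mk.injEq] at e
      exact hq (Fin.ext e.1)
  · intro q
    rw [hr _ (by simp)]
    by_cases hq : q = p
    · subst hq
      simp only [setLoc_loc_self]
      obtain ⟨⟨c, h1, h2⟩, h3⟩ := I.pv q
      rcases hend with h | h
      · rw [h.1]; exact ⟨⟨c, lt_of_lt_of_le (by simp; omega) h.2, h2⟩, h3⟩
      · rw [h.1]; exact ⟨⟨_, h.2, rfl⟩, (I.fresh q _ (Nat.le_succ _)).1⟩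
    · rw [setLoc_loc_ne _ hq]; exact I.pv q
  · intro a r ha
    obtain ⟨s, i, h1, h2⟩ := I.nxt a r ha
    exact ⟨s, i, hr' _ _ h1, hr' _ _ h2⟩
  · simp only [setLoc_S]
    rw [hrp, hseq]
  · intro s hs x hx
    simp only [setLoc_S, hseq] at hs
    rw [hhist] at hx
    by_cases hq : s = f.ls.seq + 1
    · subst hq
      rw [Function.update_self] at hx
      intro r hxr
      obtain ⟨s', i, h1, h2⟩ := hu x hx r hxr
      exact ⟨s', i, hr' _ _ h1, by omega⟩
    · rw [Function.update_of_ne hq] at hx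
      exact (I.used s (by rw [← hls]; omega) x hx).mono hr'
  · intro q
    rw [hhp]
    by_cases hq : q = p
    · subst hq
      rw [setLoc_loc_self]
      exact RankPc.of_none (snap?_endLoc ..)
    · rw [setLoc_loc_ne _ hq]
      exact (I.pcs q).mono hr' fun _ h => h

/-- The auxiliary variables at the beginning. -/
def Ghost.init (O : SeqObject Req Ret V Val σ) (n : ℕ) : Ghost n V Val where
  hist := fun _ => Heap.initial O
  hp := fun _ => Heap.initial O
  rank := fun a => if a = .head0 then some (0, 0) else none

theorem RankInv.init (O : SeqObject Req Ret V Val σ) (n : ℕ) :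
    RankInv (initial O n) (Ghost.init O n) := by
  refine ⟨?_, ?_, ?_, ?_, ?_, ?_⟩
  · intro p c _; simp [Ghost.init]
  · intro p; exact ⟨⟨0, Nat.one_pos, rfl⟩, by simp [Ghost.init]⟩
  · intro a r h; cases h
  · simp [Ghost.init, initial]
  · rintro s - x ⟨v, rfl⟩ r h; cases h
  · intro p; exact RankPc.of_none rfl

theorem RankInv.invoke {C : Config n Req Ret V Val σ} {G : Ghost n V Val} (I : RankInv C G)
    (p : Fin n) {pc : PC n Req Ret V Val σ} (h : pc.snap? = none) : RankInv (C.goto p pc) G := by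
  refine I.of_local p rfl rfl (fun q hq => setLoc_loc_ne _ hq _) (fun _ _ => rfl) rfl rfl ?_ ?_
  · simp [Config.goto]
  · simp only [Config.goto, setLoc_loc_self]; exact RankPc.of_none h

variable [DecidableEq V] {O : SeqObject Req Ret V Val σ}

theorem RankInv.step {C C' : Config n Req Ret V Val σ} {G G' : Ghost n V Val} {p : Fin n}
    (I : RankInv C G) (J : CtlInv C) (hs : GStep O C G p C' G') : RankInv C' G' := by
  have hpc := I.pcs p
  cases hs with
  | selectStuck | allocStuck | retStuck => exact I
  | commit f h hl => exact I.commit J p h hl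
  | allocCas f q todo c v k h hc hn => exact I.allocCas p f q todo c v k h
  | validateFail f h hl =>
    refine I.of_local p rfl rfl (fun q hq => setLoc_loc_ne _ hq _) (fun _ _ => rfl) rfl rfl ?_ ?_
    · rw [setLoc_loc_self]
      exact (endLoc_pvar ..).imp_right fun h => ⟨_, h.1, le_rfl, h.2⟩
    · rw [setLoc_loc_self]; exact RankPc.of_none (snap?_endLoc ..)
  | commitFail f h hl =>
    refine I.of_local p rfl rfl (fun q hq => setLoc_loc_ne _ hq _) (fun _ _ => rfl) rfl rfl ?_ ?_
    · rw [setLoc_loc_self]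
      have := endLoc_pvar p { C.loc p with cnt := (C.loc p).cnt + 1 } f.attempt f.iter
      exact this.imp (fun h => ⟨h.1, (Nat.le_succ _).trans h.2⟩)
        fun h => ⟨_, h.1, Nat.le_succ _, h.2⟩
    · rw [setLoc_loc_self]; exact RankPc.of_none (snap?_endLoc ..)
  | fetchAdd h =>
    refine I.of_local p rfl rfl (fun q hq => setLoc_loc_ne _ hq _) (fun _ _ => rfl) rfl rfl ?_ ?_
    · rw [setLoc_loc_self]; exact .inr ⟨_, rfl, le_rfl, Nat.lt_succ_self _⟩
    · rw [setLoc_loc_self]; exact RankPc.of_none rfl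
  | announce req h =>
    refine I.of_local p rfl rfl (fun q hq => setLoc_loc_ne _ hq _) (fun _ _ => rfl) rfl rfl ?_ ?_
    · simp
    · rw [setLoc_loc_self]; exact RankPc.of_none rfl
  | readRet r h hr =>
    refine I.of_local p rfl rfl (fun q hq => setLoc_loc_ne _ hq _) (fun _ _ => rfl) rfl rfl ?_ ?_
    · simp
    · rw [setLoc_loc_self]; exact RankPc.of_none rfl
  | llS a j h =>
    refine I.of_local p rfl rfl (fun q hq => setLoc_loc_ne _ hq _) (fun _ _ => rfl) rfl rfl ?_ ?_
    · simp
    · rw [setLoc_loc_self]; exact I.top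
  | readToggles a j ls h =>
    rw [h] at hpc
    refine I.of_local p rfl rfl (fun q hq => setLoc_loc_ne _ hq _)
      (fun q hq => by simp [Ghost.setHeap, hq]) rfl rfl ?_ ?_
    · simp
    · rw [setLoc_loc_self]
      rintro f ⟨⟩
      refine ⟨0, hpc, fun x hx r hxr => ?_⟩
      simp only [Ghost.setHeap, Function.update_self] at hx
      have hle : ls.seq ≤ C.S.val.seq := by
        have := J.snap p ls (by rw [h]; rfl)
        cases hl : C.S.link p with
        | true => rw [this.1 hl]
        | false => exact (this.2.1 hl).le
      obtain ⟨s', i, h1, h2⟩ := I.used _ hle x hx r hxr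
      exact ⟨s', i, h1, .inl h2⟩
  | allocFail f q todo c v k h hc hn =>
    rw [h] at hpc
    refine I.of_local p rfl rfl (fun q hq => setLoc_loc_ne _ hq _) (fun _ _ => rfl) rfl rfl ?_ ?_
    · simp
    · rw [setLoc_loc_self]; exact ⟨hpc f rfl, hn⟩
  | allocNext f q todo v k r h hr =>
    rw [h] at hpc
    obtain ⟨⟨j, h1, h2⟩, -⟩ := hpc
    refine I.of_local p rfl rfl (fun q hq => setLoc_loc_ne _ hq _) (fun _ _ => rfl) rfl rfl ?_ ?_
    · simp
    · rw [setLoc_loc_self]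
      refine ⟨rfl, j, ?_, h2⟩
      obtain ⟨s, i, h3, h4⟩ := I.nxt _ _ hr
      rw [h1] at h3
      cases h3
      exact h4
  | allocVal f q todo v k r h =>
    rw [h] at hpc
    obtain ⟨h0, j, h1, h2⟩ := hpc
    refine I.of_local p rfl rfl (fun q hq => setLoc_loc_ne _ hq _)
      (fun q hq => by simp [Ghost.setHeap, hq]) rfl rfl ?_ ?_
    · simp
    · rw [setLoc_loc_self]
      rintro f ⟨⟩
      refine ⟨j + 1, h1, fun x hx r' hxr => ?_⟩
      simp only [Ghost.setHeap, Function.update_self, Set.mem_insert_iff] at hx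
      rcases hx with rfl | hx
      · cases hxr; exact ⟨_, _, h0 ▸ h1, .inr ⟨rfl, le_rfl⟩⟩
      · obtain ⟨s', i, h3, h4⟩ := h2 x hx r' hxr
        exact ⟨s', i, h3, h4.imp_right fun h => ⟨h.1, h.2.trans (Nat.le_succ _)⟩⟩
  | write f q todo c x v c₁ h hc =>
    rw [h] at hpc
    refine I.of_local p rfl rfl (fun q hq => setLoc_loc_ne _ hq _)
      (fun q hq => by simp [Ghost.setHeap, hq]) rfl rfl ?_ ?_
    · simp
    · rw [setLoc_loc_self]
      rintro f ⟨⟩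
      obtain ⟨j, h1, h2⟩ := hpc f rfl
      refine ⟨j, h1, fun x hx => ?_⟩
      simp only [Ghost.setHeap, Function.update_self] at hx
      exact h2 x hx
  | _ =>
    rw [‹(C.loc p).pc = _›] at hpc
    refine I.of_local p rfl rfl (fun q hq => setLoc_loc_ne _ hq _) (fun _ _ => rfl) rfl rfl ?_ ?_
    · simp
    · have := hpc _ rfl
      rw [setLoc_loc_self]
      rintro f ⟨⟩
      exact this

end LUC

namespace LUC

variable {n : ℕ} {Req Ret V Val σ : Type*} [DecidableEq V]

theorem SeqApplyList.append {O : SeqObject Req Ret V Val σ} {h h₁ h₂ : Heap V Val}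
    {l l' : List (Req × Ret)} (H : SeqApplyList O h l h₁) (H' : SeqApplyList O h₁ l' h₂) :
    SeqApplyList O h (l ++ l') h₂ := by
  induction H with
  | nil => exact H'
  | cons h h₁ _ req r l hd _ ih => exact .cons h h₁ _ req r _ hd (ih H')

theorem Reachable.trans {O : SeqObject Req Ret V Val σ} {h h₁ : Heap V Val}
    {l : List (Req × Ret)} (H : Reachable O h) (H' : SeqApplyList O h l h₁) : Reachable O h₁ :=
  let ⟨_, H⟩ := H; ⟨_, H.append H'⟩

/-- The contents of the memory `H` after the values in the directory `D` are written. -/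
def overlay (D : AList (fun _ : Addr V => Val)) (H : Addr V → Val) : Addr V → Val :=
  fun x => (D.lookup x).getD (H x)

theorem overlay_empty (H : Addr V → Val) : overlay ∅ H = H := by
  funext x; simp [overlay]

theorem overlay_insert (D : AList (fun _ : Addr V => Val)) (H : Addr V → Val) (x : Addr V)
    (v : Val) : overlay (D.insert x v) H = Function.update (overlay D H) x v := by
  funext y
  by_cases h : y = x
  · subst h; simp [overlay]
  · simp [overlay, AList.lookup_insert_ne h, h]

theorem overlay_insert_self (D : AList (fun _ : Addr V => Val)) (H : Addr V → Val) (x : Addr V)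
    (h : D.lookup x = none) : overlay (D.insert x (H x)) H = overlay D H := by
  rw [overlay_insert, Function.update_eq_self_iff]
  simp [overlay, h]

/-- Store the return values in `l`. -/
def applyLog (rv : Fin n → Option Ret) (l : List (Fin n × Req × Ret)) : Fin n → Option Ret :=
  l.foldl (fun rv e => Function.update rv e.1 (some e.2.2)) rv

theorem applyLog_append (rv : Fin n → Option Ret) (l : List (Fin n × Req × Ret))
    (e : Fin n × Req × Ret) :
    applyLog rv (l ++ [e]) = Function.update (applyLog rv l) e.1 (some e.2.2) := by
  simp [applyLog]

theorem applyLog_of_notMem (rv : Fin n → Option Ret) (l : List (Fin n × Req × Ret)) (q : Fin n)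
    (h : q ∉ l.map Prod.fst) : applyLog rv l q = rv q := by
  induction l using List.reverseRecOn with
  | nil => rfl
  | append_singleton l e ih =>
    simp only [List.map_append, List.map_cons, List.map_nil, List.mem_append,
      List.mem_singleton, not_or] at h
    rw [applyLog_append, Function.update_of_ne h.2, ih h.1]

theorem applyLog_of_mem (rv : Fin n → Option Ret) (l : List (Fin n × Req × Ret))
    (hl : (l.map Prod.fst).Nodup) (e : Fin n × Req × Ret) (h : e ∈ l) :
    applyLog rv l e.1 = some e.2.2 := by
  induction l using List.reverseRecOn with
  | nil => cases h
  | append_singleton l e' ih =>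
    rw [applyLog_append]
    simp only [List.map_append, List.map_cons, List.map_nil, List.nodup_append] at hl
    simp only [List.mem_append, List.mem_singleton] at h
    rcases h with h | rfl
    · have : e.1 ≠ e'.1 := hl.2.2 e.1 (List.mem_map_of_mem h) e'.1 (by simp)
      rw [Function.update_of_ne this, ih hl.1 h]
    · simp

/-- The announced requests that are pending in `S`. -/
def pendingReq (C : Config n Req Ret V Val σ) (q : Fin n) : Option Req :=
  if C.S.val.applied q = C.S.val.papplied q then none else C.announce q

/-- State of the simulation of the pending requests: the last node used in the list of new
variables, the directory, the requests that still have to be started, and the control state of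
the current one. -/
abbrev SimState (n : ℕ) (V Val σ : Type*) :=
  Node × AList (fun _ : Addr V => Val) × List (Fin n) × Option σ

/-- The next state of the simulation. -/
def simNext (O : SeqObject Req Ret V Val σ) (ann : Fin n → Option Req) (nx : Node → Option Ref)
    (H : Addr V → Val) : SimState n V Val σ → Option (SimState n V Val σ)
  | (_, _, [], none) => none
  | (a, D, q :: todo, none) => (ann q).map fun req => (a, D, todo, some (O.start req))
  | (a, D, todo, some c) =>
    match O.instr c with
    | .ret _ => some (a, D, todo, none)
    | .read x k =>
      match D.lookup x with
      | some v => some (a, D, todo, some (k v))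
      | none => some (a, D.insert x (H x), todo, some (k (H x)))
    | .write x v c₁ => some (a, D.insert x v, todo, some c₁)
    | .alloc v k => (nx a).map fun r => (.cell r, D.insert (.inr r) v, todo, some (k (.inr r)))

theorem simNext_mono {O : SeqObject Req Ret V Val σ} {ann : Fin n → Option Req}
    {nx nx' : Node → Option Ref} (hn : ∀ a r, nx a = some r → nx' a = some r)
    {H : Addr V → Val} {X Y : SimState n V Val σ} (h : simNext O ann nx H X = some Y) :
    simNext O ann nx' H X = some Y := by
  obtain ⟨a, D, todo, c⟩ := X
  cases c with
  | none => cases todo <;> simpa only [simNext] using h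
  | some c =>
    cases hc : O.instr c with
    | alloc v k =>
      simp only [simNext, hc, Option.map_eq_some_iff] at h ⊢
      obtain ⟨r, h1, h2⟩ := h
      exact ⟨r, hn _ _ h1, h2⟩
    | _ => simpa only [simNext, hc] using h

/-- States of the simulation in the current round. -/
def SimReach (O : SeqObject Req Ret V Val σ) (C : Config n Req Ret V Val σ) (G : Ghost n V Val)
    (X : SimState n V Val σ) : Prop :=
  Relation.ReflTransGen (fun X Y =>
    simNext O (pendingReq C) C.next (G.hist C.S.val.seq).val X = some Y)
    (C.S.val.varList, ∅, pend C.S.val, none) X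

theorem SimReach.tail {O : SeqObject Req Ret V Val σ} {C : Config n Req Ret V Val σ}
    {G : Ghost n V Val} {X Y : SimState n V Val σ} (h : SimReach O C G X)
    (h' : simNext O (pendingReq C) C.next (G.hist C.S.val.seq).val X = some Y) :
    SimReach O C G Y :=
  Relation.ReflTransGen.tail h h'

theorem SimReach.mono {O : SeqObject Req Ret V Val σ} {C C' : Config n Req Ret V Val σ}
    {G G' : Ghost n V Val} (hS : C'.S.val = C.S.val) (ha : pendingReq C' = pendingReq C)
    (hn : ∀ a r, C.next a = some r → C'.next a = some r)
    (hh : G'.hist C.S.val.seq = G.hist C.S.val.seq) {X : SimState n V Val σ}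
    (h : SimReach O C G X) : SimReach O C' G' X := by
  unfold SimReach
  rw [hS, ha, hh]
  exact Relation.ReflTransGen.mono (fun _ _ h => simNext_mono hn h) _ _ h

theorem eq_of_reflTransGen_of_terminal {α : Type*} {f : α → Option α} {a b c : α}
    (hb : Relation.ReflTransGen (fun x y => f x = some y) a b)
    (hc : Relation.ReflTransGen (fun x y => f x = some y) a c)
    (fb : f b = none) (fc : f c = none) : b = c := by
  induction hb using Relation.ReflTransGen.head_induction_on with
  | refl =>
    rcases hc.cases_head with h | ⟨d, h, -⟩
    · exact h
    · rw [fb] at h; cases h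
  | head h _ ih =>
    rcases hc.cases_head with rfl | ⟨d, h', h''⟩
    · rw [fc] at h; cases h
    · rw [h] at h'; cases h'; exact ih h''

theorem SimReach.eq {O : SeqObject Req Ret V Val σ} {C : Config n Req Ret V Val σ}
    {G : Ghost n V Val} {a a' : Node} {D D' : AList (fun _ : Addr V => Val)}
    (h : SimReach O C G (a, D, [], none)) (h' : SimReach O C G (a', D', [], none)) : D = D' := by
  have := eq_of_reflTransGen_of_terminal h h' rfl rfl
  simp only [Prod.mk.injEq] at this
  exact this.2.1

section Invariant

variable (O : SeqObject Req Ret V Val σ) (C : Config n Req Ret V Val σ) (G : Ghost n V Val)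
  (p : Fin n)

/-- The requests in `l` were applied in the current iteration and led to the heap `h₀`. -/
def LogOk (f : Frame n Ret V Val) (l : List (Fin n × Req × Ret)) (h₀ : Heap V Val) : Prop :=
  SeqApplyList O (G.hist f.ls.seq) (l.map Prod.snd) h₀ ∧ f.tmp.rvals = applyLog f.ls.rvals l ∧
    (C.S.link p = true → ∀ e ∈ l, pendingReq C e.1 = some e.2.1)

/-- The requests before `todo` have been applied. -/
def Selecting (f : Frame n Ret V Val) (todo : List (Fin n)) : Prop :=
  ∃ l, LogOk O C G p f l (G.hp p) ∧ l.map Prod.fst ++ todo = pend f.ls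

/-- The requests before `q` have been applied, and the code of the request of `q` is in
state `c`. -/
def Running (f : Frame n Ret V Val) (q : Fin n) (todo : List (Fin n)) (c : σ) : Prop :=
  ∃ l h₀ m req, LogOk O C G p f l h₀ ∧ l.map Prod.fst ++ q :: todo = pend f.ls ∧
    SeqSteps O m (h₀, O.start req) (G.hp p, c) ∧
    (C.S.link p = true → pendingReq C q = some req)

/-- The directory represents the heap that `p` has computed. -/
def DirOk (f : Frame n Ret V Val) : Prop :=
  (G.hp p).val = overlay f.D (G.hist f.ls.seq).val

/-- All pending requests have been applied. -/
def Finished (f : Frame n Ret V Val) : Prop :=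
  DirOk G p f ∧ Selecting O C G p f [] ∧ SimReach O C G (f.ltop, f.D, [], none)

/-- The record of `x` has been updated in the round of `f`. -/
def Flushed (f : Frame n Ret V Val) (x : Addr V) : Prop :=
  f.ls.seq + 1 ≤ (C.item x).val.seq

/-- The validation of the current iteration has succeeded. -/
def Validated (f : Frame n Ret V Val) : Prop :=
  (C.S.link p = true → Finished O C G p f) ∧
    (C.S.link p = false → ∀ x ∈ f.D, Flushed C f x)

/-- Properties of the simulation by `p`, with program counter `pc`. -/
def SimPc : PC n Req Ret V Val σ → Prop
  | .select f todo => DirOk G p f ∧ Selecting O C G p f todo ∧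
      (C.S.link p = true → SimReach O C G (f.ltop, f.D, todo, none))
  | .simulate f q todo c => DirOk G p f ∧ Running O C G p f q todo c ∧
      (C.S.link p = true → SimReach O C G (f.ltop, f.D, todo, some c))
  | .allocNext f q todo v k => ∃ c, O.instr c = .alloc v k ∧ DirOk G p f ∧
      Running O C G p f q todo c ∧
      (C.S.link p = true → SimReach O C G (f.ltop, f.D, todo, some c))
  | .allocVal f q todo v k r => ∃ c, O.instr c = .alloc v k ∧ DirOk G p f ∧
      Running O C G p f q todo c ∧
      (C.S.link p = true →
        SimReach O C G (f.ltop, f.D.insert (.inr r) v, todo, some (k (.inr r))))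
  | .validate f => C.S.link p = true → Finished O C G p f
  | .flush f recs => Validated O C G p f ∧ (∀ e ∈ recs, f.D.lookup e.1 = some e.2) ∧
      ∀ x ∈ f.D, x ∈ recs.map Sigma.fst ∨ Flushed C f x
  | .store f x v sv recs => Validated O C G p f ∧ f.D.lookup x = some v ∧
      (∀ e ∈ recs, f.D.lookup e.1 = some e.2) ∧
      (∀ y ∈ f.D, y = x ∨ y ∈ recs.map Sigma.fst ∨ Flushed C f y) ∧ sv.seq ≤ f.ls.seq ∧
      ((C.item x).link p = true → (C.item x).val = sv) ∧
      ((C.item x).link p = false → Flushed C f x)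
  | .commit f => Validated O C G p f ∧ (C.S.link p = true → ∀ x ∈ f.D, Flushed C f x)
  | _ => True

/-- Properties of the record of a variable. -/
structure ItemOk (x : Addr V) : Prop where
  le : (C.item x).val.seq ≤ C.S.val.seq + 1
  cur : ∀ s ≤ C.S.val.seq, (C.item x).val.seq ≤ s →
    (C.item x).val.val (C.item x).val.toggle = (G.hist s).val x
  old : ∀ s ≤ C.S.val.seq, (C.item x).val.seq = s + 1 →
    (C.item x).val.val (!(C.item x).val.toggle) = (G.hist s).val x
  new : (C.item x).val.seq = C.S.val.seq + 1 → ∃ a D, SimReach O C G (a, D, [], none) ∧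
    D.lookup x = some ((C.item x).val.val (C.item x).val.toggle)

/-- Invariant of the simulated memory. -/
structure MemInv : Prop where
  pcs : ∀ p, SimPc O C G p (C.loc p).pc
  reach : ∀ s ≤ C.S.val.seq, Reachable O (G.hist s)
  item : ∀ x, ItemOk O C G x

end Invariant

variable {O : SeqObject Req Ret V Val σ}

/-- What the steps of other threads preserve, from the point of view of `q`. -/
structure Extends (O : SeqObject Req Ret V Val σ) (C : Config n Req Ret V Val σ)
    (G : Ghost n V Val) (C' : Config n Req Ret V Val σ) (G' : Ghost n V Val) (q : Fin n)
    (pc : PC n Req Ret V Val σ) : Prop where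
  hp : G'.hp q = G.hp q
  hist : ∀ s ≤ C.S.val.seq, G'.hist s = G.hist s
  link : C'.S.link q = true → C.S.link q = true ∧ pendingReq C' = pendingReq C ∧
    ∀ X, SimReach O C G X → SimReach O C' G' X
  unlink : C'.S.link q = false → C.S.link q = false ∨
    ∀ f, pc.frame? = some f → Finished O C G q f → ∀ x ∈ f.D, Flushed C f x
  seq : ∀ x, (C.item x).val.seq ≤ (C'.item x).val.seq
  item : ∀ x, (C'.item x).val = (C.item x).val ∧ (C'.item x).link q = (C.item x).link q ∨
    (C'.item x).link q = false ∧ C.S.val.seq + 1 ≤ (C'.item x).val.seq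

section Extends

variable {C C' : Config n Req Ret V Val σ} {G G' : Ghost n V Val} {q : Fin n}
  {pc : PC n Req Ret V Val σ} (E : Extends O C G C' G' q pc) {f : Frame n Ret V Val}
  (hf : f.ls.seq ≤ C.S.val.seq)

include E

theorem Extends.flushed {x : Addr V} (h : Flushed C f x) : Flushed C' f x :=
  le_trans h (E.seq x)

include hf

theorem Extends.dirOk (h : DirOk G q f) : DirOk G' q f := by
  unfold DirOk; rw [E.hp, E.hist _ hf]; exact h

theorem Extends.logOk {l h₀} (h : LogOk O C G q f l h₀) : LogOk O C' G' q f l h₀ := by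
  refine ⟨by rw [E.hist _ hf]; exact h.1, h.2.1, fun hl => ?_⟩
  rw [(E.link hl).2.1]; exact h.2.2 (E.link hl).1

theorem Extends.selecting {todo} (h : Selecting O C G q f todo) : Selecting O C' G' q f todo := by
  obtain ⟨l, h1, h2⟩ := h
  exact ⟨l, by rw [E.hp]; exact E.logOk hf h1, h2⟩

theorem Extends.running {r todo c} (h : Running O C G q f r todo c) :
    Running O C' G' q f r todo c := by
  obtain ⟨l, h₀, m, req, h1, h2, h3, h4⟩ := h
  refine ⟨l, h₀, m, req, E.logOk hf h1, h2, by rw [E.hp]; exact h3, fun hl => ?_⟩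
  rw [(E.link hl).2.1]; exact h4 (E.link hl).1

theorem Extends.finished (hl : C'.S.link q = true) (h : Finished O C G q f) :
    Finished O C' G' q f :=
  ⟨E.dirOk hf h.1, E.selecting hf h.2.1, (E.link hl).2.2 _ h.2.2⟩

theorem Extends.validated (hfr : pc.frame? = some f) (h : Validated O C G q f) :
    Validated O C' G' q f := by
  refine ⟨fun hl => E.finished hf hl (h.1 (E.link hl).1), fun hl x hx => E.flushed ?_⟩
  rcases E.unlink hl with h' | h'
  · exact h.2 h' x hx
  · cases hl' : C.S.link q with
    | true => exact h' f hfr (h.1 hl') x hx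
    | false => exact h.2 hl' x hx

end Extends

theorem Extends.simPc {C C' : Config n Req Ret V Val σ} {G G' : Ghost n V Val} {q : Fin n}
    {pc : PC n Req Ret V Val σ} (E : Extends O C G C' G' q pc)
    (hs : ∀ f, pc.frame? = some f → f.ls.seq ≤ C.S.val.seq) (h : SimPc O C G q pc) :
    SimPc O C' G' q pc := by
  cases pc with
  | select f todo =>
    have hf := hs f rfl
    exact ⟨E.dirOk hf h.1, E.selecting hf h.2.1, fun hl => (E.link hl).2.2 _ (h.2.2 (E.link hl).1)⟩
  | simulate f q todo c =>
    have hf := hs f rfl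
    exact ⟨E.dirOk hf h.1, E.running hf h.2.1, fun hl => (E.link hl).2.2 _ (h.2.2 (E.link hl).1)⟩
  | allocNext f q todo v k =>
    have hf := hs f rfl
    obtain ⟨c, hc, h⟩ := h
    exact ⟨c, hc, E.dirOk hf h.1, E.running hf h.2.1,
      fun hl => (E.link hl).2.2 _ (h.2.2 (E.link hl).1)⟩
  | allocVal f q todo v k r =>
    have hf := hs f rfl
    obtain ⟨c, hc, h⟩ := h
    exact ⟨c, hc, E.dirOk hf h.1, E.running hf h.2.1,
      fun hl => (E.link hl).2.2 _ (h.2.2 (E.link hl).1)⟩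
  | validate f => exact fun hl => E.finished (hs f rfl) hl (h (E.link hl).1)
  | flush f recs =>
    exact ⟨E.validated (hs f rfl) rfl h.1, h.2.1, fun x hx => (h.2.2 x hx).imp_right E.flushed⟩
  | store f x v sv recs =>
    have hf := hs f rfl
    obtain ⟨h1, h2, h3, h4, h5, h6, h7⟩ := h
    refine ⟨E.validated hf rfl h1, h2, h3,
      fun y hy => (h4 y hy).imp_right (Or.imp_right E.flushed), h5, fun hl => ?_, fun hl => ?_⟩
    · rcases E.item x with h | h
      · rw [h.1]; exact h6 (h.2 ▸ hl)
      · rw [h.1] at hl; cases hl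
    · rcases E.item x with h | h
      · exact E.flushed (h7 (h.2 ▸ hl))
      · exact le_trans (Nat.succ_le_succ hf) h.2
  | commit f =>
    exact ⟨E.validated (hs f rfl) rfl h.1, fun hl x hx => E.flushed (h.2 (E.link hl).1 x hx)⟩
  | _ => trivial

end LUC

namespace LUC

variable {n : ℕ} {Req Ret V Val σ : Type*}

theorem CtlInv.seq_le {C : Config n Req Ret V Val σ} (J : CtlInv C) {p : Fin n}
    {ls : State n Ret} (h : (C.loc p).pc.snap? = some ls) : ls.seq ≤ C.S.val.seq := by
  have := J.snap p ls h
  cases hl : C.S.link p with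
  | true => rw [this.1 hl]
  | false => exact (this.2.1 hl).le

theorem PC.snap?_of_frame? {pc : PC n Req Ret V Val σ} {f : Frame n Ret V Val}
    (h : pc.frame? = some f) : pc.snap? = some f.ls := by
  cases pc <;> simp_all [PC.frame?, PC.snap?]

theorem setHeap_self (G : Ghost n V Val) (p : Fin n) : G.setHeap p (G.hp p) = G := by
  simp [Ghost.setHeap]

variable [DecidableEq V] {O : SeqObject Req Ret V Val σ}

theorem MemInv.of_local {C C' : Config n Req Ret V Val σ} {G G' : Ghost n V Val}
    (I : MemInv O C G) (J : CtlInv C) (p : Fin n) (hS : C'.S.val = C.S.val)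
    (hl : ∀ q, q ≠ p → C'.S.link q = C.S.link q) (hloc : ∀ q, q ≠ p → C'.loc q = C.loc q)
    (hhp : ∀ q, q ≠ p → G'.hp q = G.hp q) (hh : G'.hist = G.hist)
    (ha : pendingReq C' = pendingReq C) (hn : ∀ a r, C.next a = some r → C'.next a = some r)
    (hi : ∀ x, (C'.item x).val = (C.item x).val ∧
      ∀ q, q ≠ p → (C'.item x).link q = (C.item x).link q)
    (hp : SimPc O C' G' p (C'.loc p).pc) : MemInv O C' G' := by
  refine ⟨fun q => ?_, fun s hs => ?_, fun x => ?_⟩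
  · by_cases hq : q = p
    · subst hq; exact hp
    · rw [hloc q hq]
      refine Extends.simPc (C := C) (G := G) ⟨hhp q hq, fun s _ => by rw [hh], fun h => ?_,
        fun h => ?_, fun x => ?_, fun x => ?_⟩
        (fun f hf => J.seq_le (PC.snap?_of_frame? hf)) (I.pcs q)
      · exact ⟨hl q hq ▸ h, ha, fun X hX => hX.mono hS ha hn (by rw [hh])⟩
      · exact .inl (hl q hq ▸ h)
      · rw [(hi x).1]
      · exact .inl ⟨(hi x).1, (hi x).2 q hq⟩
  · rw [hS] at hs; rw [hh]; exact I.reach s hs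
  · obtain ⟨h1, h2, h3, h4⟩ := I.item x
    constructor
    · rw [hS, (hi x).1]; exact h1
    · rw [hS, (hi x).1, hh]; exact h2
    · rw [hS, (hi x).1, hh]; exact h3
    · rw [hS, (hi x).1]
      intro h
      obtain ⟨a, D, h5, h6⟩ := h4 h
      exact ⟨a, D, h5.mono hS ha hn (by rw [hh]), h6⟩

theorem MemInv.store {C : Config n Req Ret V Val σ} {G : Ghost n V Val}
    (I : MemInv O C G) (J : CtlInv C) (p : Fin n) (f : Frame n Ret V Val) (x : Addr V) (v : Val)
    (sv : ItemSV Val) (recs : List (Σ _ : Addr V, Val))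
    (h : (C.loc p).pc = .store f x v sv recs) (hl : (C.item x).link p = true) :
    MemInv O ({ C with
          item := Function.update C.item x
            ⟨⟨Function.update sv.val (!sv.toggle) v, !sv.toggle, f.tmp.seq⟩,
              fun _ => false⟩ }.setLoc p { C.loc p with pc := .flush f recs }) G := by
  have hpc := I.pcs p
  rw [h] at hpc
  obtain ⟨h1, h2, h3, h4, h5, h6, h7⟩ := hpc
  have hsv := h6 hl
  have hD : x ∈ f.D := AList.lookup_isSome.1 (by rw [h2]; rfl)
  have hlink : C.S.link p = true := by
    by_contra hn
    have := h1.2 (by simpa using hn) x hD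
    unfold Flushed at this
    rw [hsv] at this
    omega
  have hls : f.ls = C.S.val := (J.snap p f.ls (by rw [h]; rfl)).1 hlink
  have hseq : f.tmp.seq = C.S.val.seq + 1 := by rw [← hls]; exact (J.frm p f (by rw [h]; rfl)).1
  rw [hls] at h5
  set C' : Config n Req Ret V Val σ := { C with
          item := Function.update C.item x
            ⟨⟨Function.update sv.val (!sv.toggle) v, !sv.toggle, f.tmp.seq⟩,
              fun _ => false⟩ }.setLoc p { C.loc p with pc := .flush f recs } with hC'
  have hix : C'.item x = ⟨⟨Function.update sv.val (!sv.toggle) v, !sv.toggle, f.tmp.seq⟩,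
              fun _ => false⟩ := Function.update_self ..
  have hiy : ∀ y, y ≠ x → C'.item y = C.item y := fun y hy => Function.update_of_ne hy ..
  have hmono : ∀ y, (C.item y).val.seq ≤ (C'.item y).val.seq := by
    intro y
    by_cases hy : y = x
    · subst hy; rw [hix, hsv]; exact h5.trans (by simp [hseq])
    · rw [hiy y hy]
  refine ⟨fun q => ?_, I.reach, fun y => ?_⟩
  · by_cases hq : q = p
    · subst hq
      rw [setLoc_loc_self]
      refine ⟨⟨h1.1, fun hl y hy => le_trans (h1.2 hl y hy) (hmono y)⟩, h3, fun y hy => ?_⟩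
      by_cases hyx : y = x
      · subst hyx
        right
        unfold Flushed
        rw [hix, hls]
        exact hseq.ge
      · rcases h4 y hy with h | h | h
        · exact absurd h hyx
        · exact .inl h
        · exact .inr (le_trans h (hmono y))
    · rw [setLoc_loc_ne _ hq]
      refine Extends.simPc (C := C) (G := G) ⟨rfl, fun _ _ => rfl, fun h => ⟨h, rfl, fun _ h => h⟩,
        fun h => .inl h, hmono, fun y => ?_⟩
        (fun f hf => J.seq_le (PC.snap?_of_frame? hf)) (I.pcs q)
      by_cases hy : y = x
      · subst hy; right; rw [hix]; exact ⟨rfl, hseq.ge⟩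
      · rw [hiy y hy]; exact .inl ⟨rfl, rfl⟩
  · by_cases hy : y = x
    · subst hy
      obtain ⟨i1, i2, i3, i4⟩ := I.item y
      constructor
      · rw [hix]; exact hseq.le
      · rw [hix]
        intro s hs hs'
        simp only [setLoc_S, hC', hseq] at hs hs'
        omega
      · rw [hix]
        intro s hs hs'
        have : s = C.S.val.seq := by simp only at hs'; omega
        subst this
        have := i2 _ le_rfl (by rw [hsv]; exact h5)
        rw [hsv] at this
        simpa using this
      · rw [hix]
        intro _
        exact ⟨f.ltop, f.D, (h1.1 hlink).2.2, by simpa using h2⟩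
    · obtain ⟨i1, i2, i3, i4⟩ := I.item y
      constructor
      · rw [hiy y hy]; exact i1
      · rw [hiy y hy]; exact i2
      · rw [hiy y hy]; exact i3
      · rw [hiy y hy]; exact i4

theorem MemInv.commit {C : Config n Req Ret V Val σ} {G : Ghost n V Val}
    (I : MemInv O C G) (J : CtlInv C) (p : Fin n) {f : Frame n Ret V Val}
    (h : (C.loc p).pc = .commit f) (hl : C.S.link p = true) (hd : Node)
    (L : Local n Req Ret V Val σ) (i : Option (ℕ × ℕ)) (hL : L.pc.snap? = none) :
    MemInv O ({ C with S := ⟨{ f.tmp with varList := hd }, fun _ => false⟩ }.setLoc p L)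
      ((G.setHist (f.ls.seq + 1) (G.hp p)).setRank hd i) := by
  have hls : f.ls = C.S.val := (J.snap p f.ls (by rw [h]; rfl)).1 hl
  have hseq : f.tmp.seq = C.S.val.seq + 1 := by rw [← hls]; exact (J.frm p f (by rw [h]; rfl)).1
  have hpc := I.pcs p
  rw [h] at hpc
  obtain ⟨hv, hfl⟩ := hpc
  obtain ⟨hdir, ⟨l, hlog, hlp⟩, hreach⟩ := hv.1 hl
  have hfl := hfl hl
  unfold DirOk at hdir
  simp only [hls, Flushed] at hfl hdir
  set C' : Config n Req Ret V Val σ :=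
    { C with S := ⟨{ f.tmp with varList := hd }, fun _ => false⟩ }.setLoc p L with hC'
  have hlink : ∀ q, C'.S.link q = false := fun _ => rfl
  have hS : C'.S.val.seq = C.S.val.seq + 1 := hseq
  have hold : ∀ s ≤ C.S.val.seq,
      ((G.setHist (f.ls.seq + 1) (G.hp p)).setRank hd i).hist s = G.hist s := by
    intro s hs
    exact Function.update_of_ne (by rw [hls]; omega) ..
  have hnew : ((G.setHist (f.ls.seq + 1) (G.hp p)).setRank hd i).hist (C.S.val.seq + 1) =
      G.hp p := by
    rw [← hls]; exact Function.update_self ..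
  have hhp : ((G.setHist (f.ls.seq + 1) (G.hp p)).setRank hd i).hp = G.hp := rfl
  generalize (G.setHist (f.ls.seq + 1) (G.hp p)).setRank hd i = G' at *
  refine ⟨fun q => ?_, fun s hs => ?_, fun x => ?_⟩
  · by_cases hq : q = p
    · subst hq
      rw [setLoc_loc_self]
      cases hLp : L.pc <;> simp_all [PC.snap?, PC.frame?, SimPc]
    · rw [setLoc_loc_ne _ hq]
      refine Extends.simPc (C := C) (G := G) ⟨by rw [hhp], hold, fun h => ?_,
        fun h => ?_, fun _ => le_rfl, fun x => .inl ⟨rfl, rfl⟩⟩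
        (fun f hf => J.seq_le (PC.snap?_of_frame? hf)) (I.pcs q)
      · rw [hlink] at h; cases h
      · cases hlq : C.S.link q with
        | false => exact .inl rfl
        | true =>
          right
          intro g hg hgf x hx
          have hgs : g.ls = C.S.val := (J.snap q g.ls (PC.snap?_of_frame? hg)).1 hlq
          unfold Flushed
          rw [hgs]
          rw [hgf.2.2.eq hreach] at hx
          exact hfl x hx
  · rw [hS] at hs
    rcases Nat.lt_or_ge C.S.val.seq s with hs' | hs'
    · have : s = C.S.val.seq + 1 := by omega
      subst this
      rw [hnew]
      exact (I.reach _ (J.seq_le (p := p) (by rw [h]; rfl))).trans hlog.1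
    · rw [hold s hs']; exact I.reach s hs'
  · obtain ⟨i1, i2, i3, i4⟩ := I.item x
    constructor
    · rw [hS]; exact le_trans i1 (Nat.le_succ _)
    · intro s hs hs'
      rw [hS] at hs
      rcases Nat.lt_or_ge C.S.val.seq s with hs'' | hs''
      · have : s = C.S.val.seq + 1 := by omega
        subst this
        rw [hnew, hdir]
        cases hx : f.D.lookup x with
        | some v =>
          have hx' : x ∈ f.D := AList.lookup_isSome.1 (by rw [hx]; rfl)
          obtain ⟨a, D, h1, h2⟩ := i4 (le_antisymm i1 (hfl x hx'))
          rw [h1.eq hreach, hx] at h2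
          simp only [Option.some.injEq] at h2
          simp only [overlay, hx, Option.getD_some]
          exact h2.symm
        | none =>
          simp only [overlay, hx, Option.getD_none]
          refine i2 _ le_rfl ?_
          by_contra hlt
          obtain ⟨a, D, h1, h2⟩ := i4 (by omega)
          rw [h1.eq hreach, hx] at h2
          cases h2
      · rw [hold s hs'']; exact i2 s hs'' hs'
    · intro s hs hs'
      have hs'' : s ≤ C.S.val.seq := by
        change (C.item x).val.seq = s + 1 at hs'
        omega
      rw [hold s hs'']; exact i3 s hs'' hs'
    · intro hx
      change (C.item x).val.seq = C'.S.val.seq + 1 at hx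
      omega

theorem SimPc.of_none {C : Config n Req Ret V Val σ} {G : Ghost n V Val} {p : Fin n}
    {pc : PC n Req Ret V Val σ} (h : pc.snap? = none) : SimPc O C G p pc := by
  cases pc <;> simp_all [PC.snap?, PC.frame?, SimPc]

theorem MemInv.silent {C : Config n Req Ret V Val σ} {G : Ghost n V Val} (I : MemInv O C G)
    (J : CtlInv C) (p : Fin n) {L : Local n Req Ret V Val σ} (h : Heap V Val)
    (hL : SimPc O (C.setLoc p L) (G.setHeap p h) p L.pc) :
    MemInv O (C.setLoc p L) (G.setHeap p h) :=
  I.of_local J p rfl (fun _ _ => rfl) (fun q hq => setLoc_loc_ne _ hq _)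
    (fun q hq => by simp [Ghost.setHeap, hq]) rfl rfl (fun _ _ h => h)
    (fun _ => ⟨rfl, fun _ _ => rfl⟩) (by rwa [setLoc_loc_self])

theorem MemInv.silent_self {C : Config n Req Ret V Val σ} {G : Ghost n V Val} (I : MemInv O C G)
    (J : CtlInv C) (p : Fin n) {L : Local n Req Ret V Val σ}
    (hL : SimPc O C G p L.pc) : MemInv O (C.setLoc p L) G := by
  have := I.silent J p (L := L) (G.hp p)
  rw [setHeap_self] at this
  exact this hL

theorem MemInv.llItem {C : Config n Req Ret V Val σ} {G : Ghost n V Val} (I : MemInv O C G)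
    (J : CtlInv C) (p : Fin n) {L : Local n Req Ret V Val σ} (x : Addr V)
    (hL : SimPc O (C.llItem p x) G p L.pc) :
    MemInv O ((C.llItem p x).setLoc p L) G := by
  refine I.of_local J p rfl (fun _ _ => rfl) (fun q hq => setLoc_loc_ne _ hq _)
    (fun _ _ => rfl) rfl rfl (fun _ _ h => h) (fun y => ?_) (by rw [setLoc_loc_self]; exact hL)
  by_cases hy : y = x
  · subst hy
    exact ⟨by simp [Config.llItem, LLSC.ll], fun q hq => by simp [Config.llItem, LLSC.ll, hq]⟩
  · simp [Config.llItem, hy]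

theorem llItem_val (C : Config n Req Ret V Val σ) (p : Fin n) (x y : Addr V) :
    ((C.llItem p x).item y).val = (C.item y).val := by
  by_cases hy : y = x
  · subst hy; simp [Config.llItem, LLSC.ll]
  · simp [Config.llItem, hy]

theorem llItem_link (C : Config n Req Ret V Val σ) (p : Fin n) (x : Addr V) :
    ((C.llItem p x).item x).link p = true := by
  simp [Config.llItem, LLSC.ll]

/-- The value that a read takes from a record. -/
theorem MemInv.read_eq {C : Config n Req Ret V Val σ} {G : Ghost n V Val} (I : MemInv O C G)
    {x : Addr V} {s : ℕ} (hs : s ≤ C.S.val.seq) {v : Val}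
    (hv : s + 1 = (C.item x).val.seq ∧ v = (C.item x).val.val (!(C.item x).val.toggle) ∨
        (C.item x).val.seq < s + 1 ∧ v = (C.item x).val.val (C.item x).val.toggle) :
    v = (G.hist s).val x := by
  rcases hv with ⟨h, rfl⟩ | ⟨h, rfl⟩
  · exact (I.item x).old s hs h.symm
  · exact (I.item x).cur s hs (Nat.lt_succ_iff.1 h)

theorem MemInv.init (O : SeqObject Req Ret V Val σ) (n : ℕ) :
    MemInv O (initial O n) (Ghost.init O n) := by
  refine ⟨fun p => trivial, fun s _ => ⟨[], .nil _⟩, fun x => ?_⟩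
  constructor
  · exact Nat.zero_le _
  · intro s hs _; rfl
  · intro s hs h; cases h
  · intro h; cases h

end LUC

namespace LUC

variable {n : ℕ} {Req Ret V Val σ : Type*}

theorem pendingReq_of_mem {C : Config n Req Ret V Val σ} {q : Fin n} (h : q ∈ pend C.S.val) :
    pendingReq C q = C.announce q := by
  simp [pendingReq, mem_pend.1 h]

variable [DecidableEq V] {O : SeqObject Req Ret V Val σ}

theorem MemInv.step {C C' : Config n Req Ret V Val σ} {G G' : Ghost n V Val} {p : Fin n}
    (I : MemInv O C G) (J : CtlInv C) (R : RankInv C G) (hs : GStep O C G p C' G') :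
    MemInv O C' G' := by
  have hpc := I.pcs p
  have hsnap : ∀ ls, (C.loc p).pc.snap? = some ls → C.S.link p = true → ls = C.S.val :=
    fun ls h => (J.snap p ls h).1
  have hle : ∀ ls, (C.loc p).pc.snap? = some ls → ls.seq ≤ C.S.val.seq := fun ls h => J.seq_le h
  have hts : ∀ f, (C.loc p).pc.frame? = some f → f.tmp.seq = f.ls.seq + 1 :=
    fun f h => (J.frm p f h).1
  cases hs with
  | selectStuck | allocStuck | retStuck => exact I
  | commit f h hl => exact I.commit J p h hl _ _ _ (snap?_endLoc ..)
  | store f x v sv recs h hl => exact I.store J p f x v sv recs h hl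
  | validateFail f h hl => exact I.silent_self J p (SimPc.of_none (snap?_endLoc ..))
  | commitFail f h hl => exact I.silent_self J p (SimPc.of_none (snap?_endLoc ..))
  | readRet r h hr => exact I.silent_self J p trivial
  | fetchAdd h =>
    exact I.of_local J p rfl (fun _ _ => rfl) (fun q hq => setLoc_loc_ne _ hq _)
      (fun q hq => rfl) rfl rfl (fun _ _ h => h)
      (fun _ => ⟨rfl, fun _ _ => rfl⟩) (by rw [setLoc_loc_self]; trivial)
  | announce req h =>
    have hpr : C.S.val.applied p = C.S.val.papplied p := by
      by_contra hne; exact (J.announce_ne_none hne).2.1 req h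
    refine I.of_local J p rfl (fun _ _ => rfl) (fun q hq => setLoc_loc_ne _ hq _)
      (fun q hq => rfl) rfl ?_ (fun _ _ h => h)
      (fun _ => ⟨rfl, fun _ _ => rfl⟩) (by rw [setLoc_loc_self]; trivial)
    funext q
    by_cases hq : q = p
    · subst hq; simp [pendingReq, hpr]
    · simp [pendingReq, hq]
  | llS a j h =>
    exact I.of_local J p rfl (fun q hq => by simp [LLSC.ll, hq])
      (fun q hq => setLoc_loc_ne _ hq _)
      (fun q hq => rfl) rfl rfl (fun _ _ h => h)
      (fun _ => ⟨rfl, fun _ _ => rfl⟩) (by rw [setLoc_loc_self]; trivial)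
  | readToggles a j ls h =>
    refine I.silent J p _ ⟨?_, ⟨[], ⟨?_, rfl, by simp⟩, rfl⟩, fun hl => ?_⟩
    · simp [DirOk, Ghost.setHeap, firstFrame, overlay_empty]
    · simp only [Ghost.setHeap, Function.update_self]; exact .nil _
    · have := hsnap ls (by rw [h]; rfl) hl
      subst this
      exact Relation.ReflTransGen.refl
  | selectNil f h =>
    rw [h] at hpc
    exact I.silent_self J p fun hl => ⟨hpc.1, hpc.2.1, hpc.2.2 hl⟩
  | selectCons f q todo req h hq =>
    have hls := hsnap f.ls (by rw [h]; rfl)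
    rw [h] at hpc
    obtain ⟨h1, ⟨l, h2, h3⟩, h4⟩ := hpc
    have hpq : C.S.link p = true → pendingReq C q = some req := by
      intro hl
      have hm : q ∈ pend f.ls := by rw [← h3]; simp
      rw [hls hl] at hm
      rw [pendingReq_of_mem hm, hq]
    refine I.silent_self J p ⟨h1, ⟨l, G.hp p, 0, req, h2, h3, .refl _, hpq⟩, fun hl => ?_⟩
    exact (h4 hl).tail (by simp [simNext, hpq hl])
  | ret f q todo c r h hc =>
    rw [h] at hpc
    obtain ⟨h1, ⟨l, h₀, m, req, h2, h3, h4, h5⟩, h6⟩ := hpc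
    refine I.silent_self J p ⟨h1, ⟨l ++ [(q, req, r)], ⟨?_, ?_, fun hl => ?_⟩, ?_⟩, fun hl => ?_⟩
    · rw [List.map_append]
      exact h2.1.append (.cons _ _ _ _ _ _ ⟨m, c, h4, hc⟩ (.nil _))
    · rw [applyLog_append]
      change Function.update f.tmp.rvals q (some r) = Function.update (applyLog f.ls.rvals l) _ _
      rw [h2.2.1]
    · intro e he
      rcases List.mem_append.1 he with he | he
      · exact h2.2.2 hl e he
      · rw [List.mem_singleton.1 he]; exact h5 hl
    · rw [List.map_append, List.append_assoc]; exact h3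
    · exact (h6 hl).tail (by simp only [simNext, hc, Frame.setRet])
  | readDir f q todo c x k v h hc hv =>
    rw [h] at hpc
    obtain ⟨h1, ⟨l, h₀, m, req, h2, h3, h4, h5⟩, h6⟩ := hpc
    refine I.silent_self J p ⟨h1, ⟨l, h₀, m + 1, req, h2, h3, h4.tail _ _ _ _ ?_, h5⟩,
      fun hl => ?_⟩
    · have : v = (G.hp p).val x := by unfold DirOk at h1; simp [h1, overlay, hv]
      rw [this]
      exact .read _ _ _ _ hc
    · exact (h6 hl).tail (by simp [simNext, hc, hv])
  | readItem f q todo c x k v h hc hx hv =>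
    rw [hts f (by rw [h]; rfl)] at hv
    have hvx := I.read_eq (hle f.ls (by rw [h]; rfl)) hv
    have hls := hsnap f.ls (by rw [h]; rfl)
    rw [h] at hpc
    obtain ⟨h1, ⟨l, h₀, m, req, h2, h3, h4, h5⟩, h6⟩ := hpc
    refine I.llItem J p x ⟨?_, ⟨l, h₀, m + 1, req, h2, h3, h4.tail _ _ _ _ ?_, h5⟩, fun hl => ?_⟩
    · unfold DirOk at h1 ⊢
      rw [h1, hvx, overlay_insert_self _ _ _ hx]
    · have : v = (G.hp p).val x := by unfold DirOk at h1; simp [h1, overlay, hx, hvx]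
      rw [this]
      exact .read _ _ _ _ hc
    · rw [hls hl] at hvx
      exact (h6 hl).tail (by simp [simNext, hc, hx, hvx])
  | readLate f q todo c x k h hc hx hv =>
    rw [hts f (by rw [h]; rfl)] at hv
    have hls := hsnap f.ls (by rw [h]; rfl)
    refine I.llItem J p x fun hl => ?_
    have := (I.item x).le
    rw [hls hl] at hv
    omega
  | write f q todo c x v c₁ h hc =>
    rw [h] at hpc
    obtain ⟨h1, ⟨l, h₀, m, req, h2, h3, h4, h5⟩, h6⟩ := hpc
    refine I.silent J p _ ⟨?_, ⟨l, h₀, m + 1, req, h2, h3, h4.tail _ _ _ _ ?_, h5⟩, fun hl => ?_⟩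
    · unfold DirOk at h1 ⊢
      simp only [Ghost.setHeap, Function.update_self]
      rw [overlay_insert, h1]
    · simp only [Ghost.setHeap, Function.update_self]
      exact .write _ _ _ _ _ hc
    · exact (h6 hl).tail (by simp only [simNext, hc])
  | allocCas f q todo c v k h hc hn =>
    rw [h] at hpc
    obtain ⟨h1, ⟨l, h₀, m, req, h2, h3, h4, h5⟩, h6⟩ := hpc
    have hnx : ∀ a r, C.next a = some r →
        Function.update C.next f.ltop (some (C.loc p).pvar) a = some r := by
      intro a r ha
      rw [Function.update_of_ne, ha]
      rintro rfl; rw [hn] at ha; cases ha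
    refine I.of_local J p rfl (fun _ _ => rfl) (fun q hq => setLoc_loc_ne _ hq _)
      (fun q hq => rfl) rfl rfl hnx (fun _ => ⟨rfl, fun _ _ => rfl⟩) ?_
    rw [setLoc_loc_self]
    refine ⟨c, hc, h1, ⟨l, h₀, m, req, h2, h3, h4, h5⟩, fun hl => ?_⟩
    refine SimReach.mono ?_ ?_ ?_ ?_ (h6 hl)
    exacts [rfl, rfl, hnx, rfl]
  | allocFail f q todo c v k h hc hn =>
    rw [h] at hpc
    exact I.silent_self J p ⟨c, hc, hpc⟩
  | allocNext f q todo v k r h hr =>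
    rw [h] at hpc
    obtain ⟨c, hc, h1, h2, h6⟩ := hpc
    exact I.silent_self J p ⟨c, hc, h1, h2, fun hl => (h6 hl).tail (by simp [simNext, hc, hr])⟩
  | allocVal f q todo v k r h =>
    have hfresh := R.notMem_used h
    rw [h] at hpc
    obtain ⟨c, hc, h1, ⟨l, h₀, m, req, h2, h3, h4, h5⟩, h6⟩ := hpc
    refine I.silent J p _ ⟨?_, ⟨l, h₀, m + 1, req, h2, h3, h4.tail _ _ _ _ ?_, h5⟩, h6⟩
    · unfold DirOk at h1 ⊢
      simp only [Ghost.setHeap, Function.update_self]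
      rw [overlay_insert, h1]
    · simp only [Ghost.setHeap, Function.update_self]
      exact .alloc _ _ _ _ _ hc hfresh
  | validate f h hl =>
    rw [h] at hpc
    refine I.silent_self J p ⟨⟨hpc, fun hl' => ?_⟩, fun e he => AList.mem_lookup_iff.2 he,
      fun x hx => .inl (AList.mem_keys.1 hx)⟩
    rw [hl] at hl'; cases hl'
  | flushNil f h =>
    rw [h] at hpc
    refine I.silent_self J p ⟨hpc.1, fun hl x hx => ?_⟩
    simpa using hpc.2.2 x hx
  | flushLate f x v recs h hlt =>
    rw [hts f (by rw [h]; rfl)] at hlt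
    have hls := hsnap f.ls (by rw [h]; rfl)
    rw [h] at hpc
    have hfl : ∀ y, Flushed C f y → Flushed (C.llItem p x) f y := by
      intro y hy; unfold Flushed; rw [llItem_val]; exact hy
    refine I.llItem J p x ⟨⟨hpc.1.1, fun hl y hy => hfl y (hpc.1.2 hl y hy)⟩, fun hl => ?_⟩
    have := (I.item x).le
    have hls : f.ls = C.S.val := hls hl
    rw [hls] at hlt
    omega
  | flushSkip f x v recs h heq =>
    rw [hts f (by rw [h]; rfl)] at heq
    rw [h] at hpc
    have hfl : ∀ y, Flushed C f y → Flushed (C.llItem p x) f y := by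
      intro y hy; unfold Flushed; rw [llItem_val]; exact hy
    refine I.llItem J p x ⟨⟨hpc.1.1, fun hl y hy => hfl y (hpc.1.2 hl y hy)⟩,
      fun e he => hpc.2.1 e (List.mem_cons_of_mem _ he), fun y hy => ?_⟩
    rcases hpc.2.2 y hy with h | h
    · rw [List.map_cons, List.mem_cons] at h
      rcases h with rfl | h
      · exact .inr (hfl _ heq.ge)
      · exact .inl h
    · exact .inr (hfl _ h)
  | flushStore f x v recs h hlt =>
    rw [hts f (by rw [h]; rfl)] at hlt
    rw [h] at hpc
    have hfl : ∀ y, Flushed C f y → Flushed (C.llItem p x) f y := by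
      intro y hy; unfold Flushed; rw [llItem_val]; exact hy
    refine I.llItem J p x ⟨⟨hpc.1.1, fun hl y hy => hfl y (hpc.1.2 hl y hy)⟩,
      hpc.2.1 ⟨x, v⟩ List.mem_cons_self, fun e he => hpc.2.1 e (List.mem_cons_of_mem _ he),
      fun y hy => ?_, Nat.lt_succ_iff.1 hlt, fun _ => llItem_val .., fun hl => ?_⟩
    · rcases hpc.2.2 y hy with h | h
      · rw [List.map_cons, List.mem_cons] at h
        exact h.imp_right .inl
      · exact .inr (.inr (hfl _ h))
    · rw [llItem_link] at hl; cases hl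
  | storeFail f x v sv recs h hl =>
    rw [h] at hpc
    obtain ⟨h1, h2, h3, h4, h5, h6, h7⟩ := hpc
    refine I.silent_self J p ⟨h1, h3, fun y hy => ?_⟩
    rcases h4 y hy with rfl | h | h
    · exact .inr (h7 hl)
    · exact .inl h
    · exact .inr h

/-- The invariant of the algorithm. -/
structure Inv (O : SeqObject Req Ret V Val σ) (C : Config n Req Ret V Val σ)
    (G : Ghost n V Val) : Prop where
  ctl : CtlInv C
  rank : RankInv C G
  mem : MemInv O C G

/-- Transitions, together with the changes of the auxiliary variables. -/
inductive GTrans (O : SeqObject Req Ret V Val σ) (C : Config n Req Ret V Val σ)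
    (G : Ghost n V Val) : Event n Req Ret → Config n Req Ret V Val σ → Ghost n V Val → Prop
  | inv (p : Fin n) (req : Req) (h : (C.loc p).pc = .idle) :
      GTrans O C G (.inv p req) (C.goto p (.announce req)) G
  | step (p : Fin n) (C' : Config n Req Ret V Val σ) (G' : Ghost n V Val)
      (h : (C.loc p).pc ≠ .idle) (h₁ : ∀ r, (C.loc p).pc ≠ .respond r)
      (hs : GStep O C G p C' G') : GTrans O C G (.step p) C' G'
  | res (p : Fin n) (r : Ret) (h : (C.loc p).pc = .respond r) :
      GTrans O C G (.res p r) (C.goto p .idle) G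

theorem Inv.trans {C C' : Config n Req Ret V Val σ} {G G' : Ghost n V Val}
    {e : Event n Req Ret} (I : Inv O C G) (h : GTrans O C G e C' G') : Inv O C' G' := by
  obtain ⟨J, R, M⟩ := I
  cases h with
  | inv p req h =>
    exact ⟨J.invoke p req h, R.invoke p rfl, M.silent_self J p trivial⟩
  | step p C' G' h h₁ hs => exact ⟨J.step hs, R.step J hs, M.step J R hs⟩
  | res p r h =>
    exact ⟨J.respond p r h, R.invoke p rfl, M.silent_self J p trivial⟩

theorem Trans.exists_ghost {C C' : Config n Req Ret V Val σ} {e : Event n Req Ret}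
    (h : Trans O C e C') (G : Ghost n V Val) : ∃ G', GTrans O C G e C' G' := by
  cases h with
  | inv p req h => exact ⟨G, .inv p req h⟩
  | step p h h₁ =>
    obtain ⟨G', hG⟩ := exists_gstep O C G p h h₁
    exact ⟨G', .step p _ G' h h₁ hG⟩
  | res p r h => exact ⟨G, .res p r h⟩

/-- The auxiliary variables along an execution. -/
theorem IsExecution.exists_ghost {N : ℕ∞} {C : ℕ → Config n Req Ret V Val σ}
    {e : ℕ → Event n Req Ret} (h : IsExecution O N C e) : ∃ G : ℕ → Ghost n V Val,
      G 0 = Ghost.init O n ∧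
      (∀ t : ℕ, (t : ℕ∞) < N → GTrans O (C t) (G t) (e t) (C (t + 1)) (G (t + 1))) ∧
      ∀ t : ℕ, (t : ℕ∞) ≤ N → Inv O (C t) (G t) := by
  classical
  have key : ∀ (t : ℕ) (g : Ghost n V Val), ∃ g', (t : ℕ∞) < N →
      GTrans O (C t) g (e t) (C (t + 1)) g' := by
    intro t g
    by_cases ht : (t : ℕ∞) < N
    · obtain ⟨g', hg⟩ := (h.2 t ht).exists_ghost g
      exact ⟨g', fun _ => hg⟩
    · exact ⟨g, fun h => absurd h ht⟩
  choose next hnext using key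
  let G : ℕ → Ghost n V Val := fun t => Nat.rec (Ghost.init O n) (fun t g => next t g) t
  have hG : ∀ t : ℕ, (t : ℕ∞) < N → GTrans O (C t) (G t) (e t) (C (t + 1)) (G (t + 1)) :=
    fun t ht => hnext t (G t) ht
  refine ⟨G, rfl, hG, fun t => ?_⟩
  induction t with
  | zero =>
    intro _
    rw [h.1]
    exact ⟨CtlInv.init O, RankInv.init O n, MemInv.init O n⟩
  | succ t ih =>
    intro ht
    have ht' : (t : ℕ∞) < N := lt_of_lt_of_le (by exact_mod_cast Nat.lt_succ_self t) ht
    exact (ih ht'.le).trans (hG t ht')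

end LUC

namespace LUC

variable {n : ℕ} {Req Ret V Val σ : Type*}

/-- The current operation of `q` has been applied to the object. -/
def Served (C : Config n Req Ret V Val σ) (q : Fin n) : Prop :=
  C.S.val.applied q = bit C q ∧ C.S.val.papplied q = bit C q

theorem Served.notMem_pend {C : Config n Req Ret V Val σ} {q : Fin n} (h : Served C q) :
    q ∉ pend C.S.val := fun hq => mem_pend.1 hq (h.1.trans h.2.symm)

/-- The operation has been announced in `Toggles`. -/
def PC.Started : PC n Req Ret V Val σ → Prop
  | .idle => False
  | .announce _ => False
  | .fetchAdd => False
  | _ => True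

theorem PC.Started.ne_idle {pc : PC n Req Ret V Val σ} (h : pc.Started) : pc ≠ .idle := by
  rintro rfl; exact h

theorem endLoc_started (p : Fin n) (L : Local n Req Ret V Val σ) (a j : Fin 2) :
    (endLoc p L a j).pc.Started ∧ ∀ r, (endLoc p L a j).pc ≠ .respond r := by
  unfold endLoc; split_ifs <;> simp [PC.Started]

theorem CtlInv.served {C : Config n Req Ret V Val σ} (J : CtlInv C) {q : Fin n}
    (h : (C.loc q).pc.need (C.S.link q) = 3) : Served C q := by
  have := J.level q
  rw [h] at this
  exact ⟨this.2.1 (by omega), this.2.2 le_rfl⟩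

theorem CtlInv.started_of_mem_pend {C : Config n Req Ret V Val σ} (J : CtlInv C) {q : Fin n}
    (h : q ∈ pend C.S.val) : (C.loc q).pc.Started := by
  have := J.announce_ne_none (mem_pend.1 h)
  cases hpc : (C.loc q).pc <;> simp_all [PC.Started]

variable [DecidableEq V] {O : SeqObject Req Ret V Val σ}

theorem GStep.evolution {C C' : Config n Req Ret V Val σ} {G G' : Ghost n V Val} {p : Fin n}
    (h : GStep O C G p C' G') :
    (∀ q, q ≠ p → C'.loc q = C.loc q ∧ C'.announce q = C.announce q) ∧
    ((∃ req, (C.loc p).pc = .announce req ∧ (C'.loc p).pc = .fetchAdd ∧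
        C'.announce p = some req) ∨
      C'.announce p = C.announce p ∧ (C'.loc p).pc.Started ∧
        ((C.loc p).pc = .fetchAdd ∨ (C.loc p).pc.Started) ∧
        ∀ r, (C'.loc p).pc = .respond r → C'.S.val.rvals p = some r) := by
  cases h with
  | announce req h =>
    refine ⟨fun q hq => ⟨setLoc_loc_ne _ hq _, by simp [hq]⟩, .inl ⟨req, h, ?_⟩⟩
    simp
  | selectStuck f q todo h | allocStuck f q todo v k h | retStuck h =>
    refine ⟨fun _ _ => ⟨rfl, rfl⟩, .inr ⟨rfl, ?_, .inr ?_, ?_⟩⟩ <;> simp [h, PC.Started]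
  | fetchAdd h =>
    refine ⟨fun q hq => ⟨setLoc_loc_ne _ hq _, rfl⟩, .inr ⟨rfl, ?_, .inl h, ?_⟩⟩
    · simp [PC.Started]
    · simp
  | readRet r h hr =>
    refine ⟨fun q hq => ⟨setLoc_loc_ne _ hq _, rfl⟩, .inr ⟨rfl, ?_, .inr ?_, ?_⟩⟩
    · simp [PC.Started]
    · simp [h, PC.Started]
    · simpa using hr
  | validateFail f h hl =>
    refine ⟨fun q hq => ⟨setLoc_loc_ne _ hq _, rfl⟩, .inr ⟨rfl, ?_, .inr ?_, ?_⟩⟩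
    · simp [endLoc_started]
    · simp [h, PC.Started]
    · simp [endLoc_started]
  | commitFail f h hl =>
    refine ⟨fun q hq => ⟨setLoc_loc_ne _ hq _, rfl⟩, .inr ⟨rfl, ?_, .inr ?_, ?_⟩⟩
    · simp [endLoc_started]
    · simp [h, PC.Started]
    · simp [endLoc_started]
  | commit f h hl =>
    refine ⟨fun q hq => ⟨setLoc_loc_ne _ hq _, rfl⟩, .inr ⟨rfl, ?_, .inr ?_, ?_⟩⟩
    · simp [endLoc_started]
    · simp [h, PC.Started]
    · simp [endLoc_started]
  | _ =>
    refine ⟨fun q hq => ⟨setLoc_loc_ne _ hq _, rfl⟩, .inr ⟨rfl, ?_, .inr ?_, ?_⟩⟩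
    · simp [PC.Started]
    · simp [‹(C.loc p).pc = _›, PC.Started]
    · simp

/-- The operations that take effect in a transition. -/
structure EffectLog (O : SeqObject Req Ret V Val σ) (C : Config n Req Ret V Val σ)
    (G : Ghost n V Val) (e : Event n Req Ret) (C' : Config n Req Ret V Val σ)
    (G' : Ghost n V Val) (l : List (Fin n × Req × Ret)) : Prop where
  apply : SeqApplyList O (G.hist C.S.val.seq) (l.map Prod.snd) (G'.hist C'.S.val.seq)
  nodup : (l.map Prod.fst).Nodup
  mem : ∀ x ∈ l, C.announce x.1 = some x.2.1 ∧ x.1 ∈ pend C.S.val ∧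
    C'.S.val.rvals x.1 = some x.2.2 ∧ Served C' x.1
  notMem : ∀ q, q ∉ l.map Prod.fst → C'.S.val.rvals q = C.S.val.rvals q ∧
    (Served C' q → Served C q ∧ (e = .step q → (C.loc q).pc ≠ .fetchAdd)) ∧
    (Served C q → Served C' q ∨ (C.loc q).pc = .fetchAdd)

theorem EffectLog.nil {C C' : Config n Req Ret V Val σ} {G G' : Ghost n V Val}
    {e : Event n Req Ret} (hS : C'.S.val = C.S.val) (hh : G'.hist = G.hist)
    (ht : ∀ q, (C'.loc q).toggle = (C.loc q).toggle)
    (he : ∀ q, e = .step q → (C.loc q).pc ≠ .fetchAdd) : EffectLog O C G e C' G' [] := by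
  refine ⟨by rw [hS, hh]; exact .nil _, by simp, by simp, fun q _ => ?_⟩
  simp only [Served, hS, bit, ht]
  exact ⟨trivial, fun h => ⟨h, he q⟩, .inl⟩

theorem EffectLog.nil_setLoc {C D : Config n Req Ret V Val σ} {G G' : Ghost n V Val} {p : Fin n}
    {L : Local n Req Ret V Val σ}
    (hp : (C.loc p).pc ≠ .fetchAdd) (hS : D.S.val = C.S.val) (hh : G'.hist = G.hist)
    (hD : D.loc = C.loc) (ht : L.toggle = (C.loc p).toggle) :
    EffectLog O C G (.step p) (D.setLoc p L) G' [] := by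
  refine EffectLog.nil hS hh (fun q => ?_) (fun q hq => ?_)
  · by_cases hq : q = p
    · subst hq; rw [setLoc_loc_self, ht]
    · rw [setLoc_loc_ne _ hq, hD]
  · cases hq; exact hp

theorem EffectLog.commit {C : Config n Req Ret V Val σ} {G : Ghost n V Val} (I : Inv O C G)
    (p : Fin n) {f : Frame n Ret V Val}
    (h : (C.loc p).pc = .commit f) (hl : C.S.link p = true) (hd : Node)
    (L : Local n Req Ret V Val σ) (i : Option (ℕ × ℕ)) (hL : L.toggle = (C.loc p).toggle) :
    ∃ l, EffectLog O C G (.step p)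
      ({ C with S := ⟨{ f.tmp with varList := hd }, fun _ => false⟩ }.setLoc p L)
      ((G.setHist (f.ls.seq + 1) (G.hp p)).setRank hd i) l := by
  have hf : (C.loc p).pc.frame? = some f := by rw [h]; rfl
  have hls : f.ls = C.S.val := (I.ctl.snap p f.ls (by rw [h]; rfl)).1 hl
  obtain ⟨fs, fp, fa⟩ := I.ctl.frm p f hf
  have fa := fa hl
  have hpc := I.mem.pcs p
  rw [h] at hpc
  obtain ⟨hdir, ⟨l, ⟨hlog, hrv, hreq⟩, hlp⟩, hreach⟩ := hpc.1.1 hl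
  rw [List.append_nil, hls] at hlp
  have hreq := hreq hl
  rw [hls] at fs fp hlog hrv
  have hbit : ∀ q, bit ({ C with S := ⟨{ f.tmp with varList := hd }, fun _ => false⟩ }.setLoc p L)
      q = bit C q := by
    intro q
    by_cases hq : q = p
    · subst hq; simp [bit, hL]
    · simp [bit, setLoc_loc_ne _ hq]
  have hnd : (l.map Prod.fst).Nodup := by rw [hlp]; exact nodup_pend _
  refine ⟨l, ?_, hnd, fun x hx => ?_, fun q hq => ?_⟩
  · have : ((G.setHist (f.ls.seq + 1) (G.hp p)).setRank hd i).hist f.tmp.seq = G.hp p := by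
      rw [fs, hls]; exact Function.update_self ..
    simp only [setLoc_S]
    rw [this]
    exact hlog
  · have hm : x.1 ∈ pend C.S.val := by rw [← hlp]; exact List.mem_map_of_mem hx
    have ha : C.S.val.applied x.1 = bit C x.1 := by
      rcases I.ctl.phase x.1 with h | h
      · exact h
      · exact absurd h.symm (mem_pend.1 hm)
    refine ⟨?_, hm, ?_, ?_, ?_⟩
    · rw [← pendingReq_of_mem hm]; exact hreq x hx
    · simp only [setLoc_S, hrv]; exact applyLog_of_mem _ l hnd x hx
    · rw [hbit]; exact fa _ ha
    · rw [hbit]; simp only [setLoc_S, fp]; exact ha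
  · have hm : C.S.val.applied q = C.S.val.papplied q := by
      rw [hlp, mem_pend] at hq; simpa using hq
    refine ⟨?_, fun hs => ⟨?_, ?_⟩, fun hs => .inl ⟨?_, ?_⟩⟩
    · simp only [setLoc_S, hrv]; exact applyLog_of_notMem _ l q hq
    · have := hs.2
      rw [hbit] at this
      simp only [setLoc_S, fp] at this
      exact ⟨this, hm ▸ this⟩
    · rintro ⟨⟩; rw [h]; simp
    · rw [hbit]; exact fa _ hs.1
    · rw [hbit]; simp only [setLoc_S, fp]; exact hs.1

theorem GTrans.exists_log {C C' : Config n Req Ret V Val σ} {G G' : Ghost n V Val}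
    {e : Event n Req Ret} (I : Inv O C G) (h : GTrans O C G e C' G') :
    ∃ l, EffectLog O C G e C' G' l := by
  cases h with
  | inv p req h =>
    refine ⟨[], .nil rfl rfl (fun q => ?_) (by simp)⟩
    by_cases hq : q = p
    · subst hq; simp [Config.goto]
    · simp [Config.goto, setLoc_loc_ne _ hq]
  | res p r h =>
    refine ⟨[], .nil rfl rfl (fun q => ?_) (by simp)⟩
    by_cases hq : q = p
    · subst hq; simp [Config.goto]
    · simp [Config.goto, setLoc_loc_ne _ hq]
  | step p _ _ h h₁ hs =>
    cases hs with
    | fetchAdd h =>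
      have hsv : Served C p := I.ctl.served (by rw [h]; rfl)
      refine ⟨[], .nil _, by simp, by simp, fun q _ => ⟨rfl, fun hs => ?_, fun hs => ?_⟩⟩
      · by_cases hq : q = p
        · subst hq
          exfalso
          have hpos : (0 : ℤ) < 2 ^ (q : ℕ) := by positivity
          have h1 := hsv.1
          have h2 := hs.1
          simp only [setLoc_S] at h2
          rw [h1] at h2
          simp only [bit, setLoc_loc_self] at h2
          rcases I.ctl.abs q with h | h <;> simp [h, hpos] at h2 <;> linarith
        · simp only [Served, bit, setLoc_loc_ne _ hq] at hs
          exact ⟨hs, by rintro ⟨⟩; exact absurd rfl hq⟩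
      · by_cases hq : q = p
        · subst hq; exact .inr h
        · left; simp only [Served, bit, setLoc_loc_ne _ hq]; exact hs
    | commit f h hl =>
      exact EffectLog.commit I p h hl _ _ _ (by rw [toggle_endLoc])
    | selectStuck f q todo h | allocStuck f q todo v k h | retStuck h =>
      refine ⟨[], .nil rfl rfl (fun _ => rfl) ?_⟩
      rintro q ⟨⟩; simp [h]
    | _ =>
      exact ⟨[], .nil_setLoc (by simp [‹(C.loc p).pc = _›]) rfl rfl rfl
        (by first | rfl | exact toggle_endLoc ..)⟩

/-- The event that invoked the latest operation of `q` before event `t`. -/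
noncomputable def opIdx (e : ℕ → Event n Req Ret) (q : Fin n) : ℕ → ℕ
  | 0 => 0
  | t + 1 => open Classical in if ∃ req, e t = .inv q req then t else opIdx e q t

theorem opIdx_le (e : ℕ → Event n Req Ret) (q : Fin n) (t : ℕ) : opIdx e q t ≤ t := by
  induction t with
  | zero => exact le_rfl
  | succ t ih => unfold opIdx; split_ifs <;> omega

theorem opIdx_succ_of_ne {e : ℕ → Event n Req Ret} {q : Fin n} {t : ℕ}
    (h : ∀ req, e t ≠ .inv q req) : opIdx e q (t + 1) = opIdx e q t := by
  rw [opIdx, if_neg]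
  rintro ⟨req, hr⟩; exact h req hr

theorem opIdx_succ_of_eq {e : ℕ → Event n Req Ret} {q : Fin n} {t : ℕ} {req : Req}
    (h : e t = .inv q req) : opIdx e q (t + 1) = t := by
  rw [opIdx, if_pos ⟨req, h⟩]

/-- The current operation of `q` at configuration `t`, given the operations `l m` that take effect
in the transitions `m`. -/
structure OpOk (e : ℕ → Event n Req Ret) (l : ℕ → List (Fin n × Req × Ret))
    (C : Config n Req Ret V Val σ) (t : ℕ) (q : Fin n) : Prop where
  inv : ∃ req, e (opIdx e q t) = .inv q req ∧
    ((C.loc q).pc = .announce req ∨ (∀ r, (C.loc q).pc ≠ .announce r) ∧ C.announce q = some req)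
  lt : opIdx e q t < t
  res : ∀ s r, opIdx e q t < s → s < t → e s ≠ .res q r
  served : (C.loc q).pc.Started → Served C q → ∃ m < t, ∃ x ∈ l m, x.1 = q ∧
    opIdx e q m = opIdx e q t ∧ C.S.val.rvals q = some x.2.2
  unserved : (¬ (C.loc q).pc.Started ∨ ¬ Served C q) → ∀ m < t, ∀ x ∈ l m, x.1 = q →
    opIdx e q m ≠ opIdx e q t
  rval : ∀ r, (C.loc q).pc = .respond r → C.S.val.rvals q = some r

/-- The transitions that do not start or end an operation of `q`. -/
theorem GTrans.evolution {C C' : Config n Req Ret V Val σ} {G G' : Ghost n V Val}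
    {e : Event n Req Ret} (h : GTrans O C G e C' G') (q : Fin n)
    (h₁ : ∀ req, e ≠ .inv q req) (h₂ : ∀ r, e ≠ .res q r) :
    (C'.loc q = C.loc q ∧ C'.announce q = C.announce q ∧ e ≠ .step q) ∨
    (∃ req, (C.loc q).pc = .announce req ∧ (C'.loc q).pc = .fetchAdd ∧
        C'.announce q = some req) ∨
      e = .step q ∧ C'.announce q = C.announce q ∧ (C'.loc q).pc.Started ∧
        ((C.loc q).pc = .fetchAdd ∨ (C.loc q).pc.Started) ∧
        ∀ r, (C'.loc q).pc = .respond r → C'.S.val.rvals q = some r := by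
  cases h with
  | inv p req h =>
    have hq : q ≠ p := by rintro rfl; exact h₁ req rfl
    exact .inl ⟨setLoc_loc_ne _ hq _, rfl, by simp⟩
  | res p r h =>
    have hq : q ≠ p := by rintro rfl; exact h₂ r rfl
    exact .inl ⟨setLoc_loc_ne _ hq _, rfl, by simp⟩
  | step p _ _ h h₁ hs =>
    by_cases hq : q = p
    · subst hq
      right
      exact hs.evolution.2.imp_right fun h => ⟨rfl, h⟩
    · have := hs.evolution.1 q hq
      exact .inl ⟨this.1, this.2, fun he => hq (by cases he; rfl)⟩

theorem OpOk.next {e : ℕ → Event n Req Ret} {l : ℕ → List (Fin n × Req × Ret)}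
    {C C' : Config n Req Ret V Val σ} {G G' : Ghost n V Val} {t : ℕ} {q : Fin n}
    (I : Inv O C G) (I' : Inv O C' G') (h : GTrans O C G (e t) C' G')
    (hl : EffectLog O C G (e t) C' G' (l t))
    (H : (C.loc q).pc ≠ .idle → OpOk e l C t q) (hpc : (C'.loc q).pc ≠ .idle) :
    OpOk e l C' (t + 1) q := by
  by_cases hinv : ∃ req, e t = .inv q req
  · obtain ⟨req, he⟩ := hinv
    have hop := opIdx_succ_of_eq he
    rw [he] at h
    cases h with
    | inv _ _ h =>
    refine ⟨⟨req, ?_, ?_⟩, ?_, ?_, ?_, ?_, ?_⟩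
    · rw [hop, he]
    · left; simp [Config.goto]
    · rw [hop]; exact Nat.lt_succ_self t
    · rw [hop]; intro s r h1 h2; omega
    · simp [Config.goto, PC.Started]
    · intro _ m hm x hx hxq
      rw [hop]
      rcases Nat.lt_succ_iff_lt_or_eq.1 hm with hm | rfl
      · have := opIdx_le e q m; omega
      · exfalso
        have := I.ctl.started_of_mem_pend (hl.mem x hx).2.1
        rw [hxq, h] at this
        exact this
    · simp [Config.goto]
  · have hinv : ∀ req, e t ≠ .inv q req := fun req he => hinv ⟨req, he⟩
    have hres : ∀ r, e t ≠ .res q r := by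
      intro r he
      rw [he] at h
      cases h
      simp [Config.goto] at hpc
    have hop := opIdx_succ_of_ne hinv
    have hev := h.evolution q hinv hres
    have hidle : (C.loc q).pc ≠ .idle := by
      rcases hev with h | ⟨req, h, -⟩ | ⟨-, -, -, h, -⟩
      · rw [← h.1]; exact hpc
      · rw [h]; simp
      · rcases h with h | h
        · rw [h]; simp
        · exact h.ne_idle
    obtain ⟨⟨req, K1, K1'⟩, K2, K3, K4, K5, K6⟩ := H hidle
    have hst : (C'.loc q).pc.Started → (C.loc q).pc.Started ∨
        e t = .step q ∧ (C.loc q).pc = .fetchAdd := by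
      intro hs
      rcases hev with h | ⟨req, -, h, -⟩ | ⟨h', -, -, h, -⟩
      · rw [← h.1]; exact .inl hs
      · rw [h] at hs; exact hs.elim
      · rcases h with h | h
        · exact .inr ⟨h', h⟩
        · exact .inl h
    have hst' : (C.loc q).pc.Started → (C'.loc q).pc.Started := by
      intro hs
      rcases hev with h | ⟨req, h, -⟩ | ⟨-, -, h, -⟩
      · rw [h.1]; exact hs
      · rw [h] at hs; exact hs.elim
      · exact h
    refine ⟨⟨req, by rw [hop, K1], ?_⟩, by rw [hop]; omega, ?_, ?_, ?_, ?_⟩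
    · rcases hev with ⟨h1, h2, -⟩ | ⟨req', h1, h2, h3⟩ | ⟨-, h1, h2, h3, -⟩
      · rw [h1, h2]; exact K1'
      · right
        rcases K1' with h | h
        · rw [h] at h1; cases h1; exact ⟨by simp [h2], h3⟩
        · exact absurd h1 (h.1 _)
      · right
        refine ⟨?_, ?_⟩
        · intro r hr; rw [hr] at h2; exact h2
        · rcases K1' with h | h
          · rw [h] at h3; rcases h3 with h3 | h3
            · cases h3
            · exact h3.elim
          · rw [h1]; exact h.2
    · rw [hop]
      intro s r h1 h2
      rcases Nat.lt_succ_iff_lt_or_eq.1 h2 with h2 | rfl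
      · exact K3 s r h1 h2
      · exact hres r
    · rw [hop]
      intro hs hsv
      by_cases hq : q ∈ (l t).map Prod.fst
      · obtain ⟨x, hx, hxq⟩ := List.mem_map.1 hq
        refine ⟨t, Nat.lt_succ_self t, x, hx, hxq, rfl, ?_⟩
        rw [← hxq]; exact (hl.mem x hx).2.2.1
      · obtain ⟨h1, h2, -⟩ := hl.notMem q hq
        obtain ⟨h3, h4⟩ := h2 hsv
        rcases hst hs with h5 | h5
        · obtain ⟨m, hm, x, hx, h6, h7, h8⟩ := K4 h5 h3
          exact ⟨m, hm.trans (Nat.lt_succ_self t), x, hx, h6, h7, h1.trans h8⟩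
        · exact absurd h5.2 (h4 h5.1)
    · rw [hop]
      intro hs
      by_cases hq : q ∈ (l t).map Prod.fst
      · exfalso
        obtain ⟨x, hx, hxq⟩ := List.mem_map.1 hq
        obtain ⟨-, h1, -, h2⟩ := hl.mem x hx
        rw [hxq] at h1 h2
        rcases hs with hs | hs
        · exact hs (hst' (I.ctl.started_of_mem_pend h1))
        · exact hs h2
      · obtain ⟨-, -, h1⟩ := hl.notMem q hq
        have hold : ¬ (C.loc q).pc.Started ∨ ¬ Served C q := by
          rcases hs with hs | hs
          · exact .inl fun h => hs (hst' h)
          · by_contra hcon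
            push Not at hcon
            rcases h1 hcon.2 with h | h
            · exact hs h
            · rw [h] at hcon; exact hcon.1
        intro m hm x hx hxq
        rcases Nat.lt_succ_iff_lt_or_eq.1 hm with hm | rfl
        · exact K5 hold m hm x hx hxq
        · exact absurd (hxq ▸ List.mem_map_of_mem hx) hq
    · intro r hr
      rcases hev with ⟨h1, -⟩ | ⟨_, -, h1, -⟩ | ⟨-, -, -, -, h1⟩
      · rw [h1] at hr
        have hsv : Served C q := I.ctl.served (by rw [hr]; rfl)
        have hq : q ∉ (l t).map Prod.fst := by
          intro hq
          obtain ⟨x, hx, hxq⟩ := List.mem_map.1 hq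
          have := (hl.mem x hx).2.1
          rw [hxq] at this
          exact hsv.notMem_pend this
        rw [(hl.notMem q hq).1]
        exact K6 r hr
      · rw [h1] at hr; cases hr
      · exact h1 r hr

end LUC

namespace LUC

variable {n : ℕ} {Req Ret V Val σ : Type*} [DecidableEq V] {O : SeqObject Req Ret V Val σ}

theorem GTrans.ne_idle {C C' : Config n Req Ret V Val σ} {G G' : Ghost n V Val}
    {e : Event n Req Ret} (h : GTrans O C G e C' G') {q : Fin n} (hq : (C.loc q).pc ≠ .idle)
    (hr : ∀ r, e ≠ .res q r) : (C'.loc q).pc ≠ .idle ∧ ∀ req, e ≠ .inv q req := by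
  have hi : ∀ req, e ≠ .inv q req := by
    rintro req rfl
    cases h with
    | inv _ _ h => exact hq h
  refine ⟨?_, hi⟩
  rcases h.evolution q hi hr with h | ⟨req, -, h, -⟩ | ⟨-, -, h, -⟩
  · rw [h.1]; exact hq
  · rw [h]; simp
  · exact h.ne_idle

/-- The auxiliary variables and the operations that take effect along an execution. -/
theorem IsExecution.exists_run {N : ℕ∞} {C : ℕ → Config n Req Ret V Val σ}
    {e : ℕ → Event n Req Ret} (hE : IsExecution O N C e) :
    ∃ (G : ℕ → Ghost n V Val) (l : ℕ → List (Fin n × Req × Ret)), G 0 = Ghost.init O n ∧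
      (∀ t : ℕ, (t : ℕ∞) < N → GTrans O (C t) (G t) (e t) (C (t + 1)) (G (t + 1))) ∧
      (∀ t : ℕ, (t : ℕ∞) ≤ N → Inv O (C t) (G t)) ∧
      (∀ t : ℕ, (t : ℕ∞) < N →
        EffectLog O (C t) (G t) (e t) (C (t + 1)) (G (t + 1)) (l t)) ∧
      (∀ t : ℕ, ¬ (t : ℕ∞) < N → l t = []) ∧
      ∀ t : ℕ, (t : ℕ∞) ≤ N → ∀ q, ((C t).loc q).pc ≠ .idle → OpOk e l (C t) t q := by
  classical
  obtain ⟨G, hG0, hG, hI⟩ := hE.exists_ghost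
  have hlog : ∀ t : ℕ, ∃ l, ((t : ℕ∞) < N →
      EffectLog O (C t) (G t) (e t) (C (t + 1)) (G (t + 1)) l) ∧ (¬ (t : ℕ∞) < N → l = []) := by
    intro t
    by_cases ht : (t : ℕ∞) < N
    · obtain ⟨l, hl⟩ := (hG t ht).exists_log (hI t ht.le)
      exact ⟨l, fun _ => hl, fun h => absurd ht h⟩
    · exact ⟨[], fun h => absurd h ht, fun _ => rfl⟩
  choose l hl hl' using hlog
  refine ⟨G, l, hG0, hG, hI, hl, hl', fun t => ?_⟩
  induction t with
  | zero =>
    intro _ q hq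
    rw [hE.1] at hq
    exact absurd rfl hq
  | succ t ih =>
    intro ht q hq
    have ht' : (t : ℕ∞) < N := lt_of_lt_of_le (by exact_mod_cast Nat.lt_succ_self t) ht
    exact OpOk.next (hI t ht'.le) (hI _ ht) (hG t ht') (hl t ht') (ih ht'.le q) hq

theorem linearizable {N : ℕ∞} {C : ℕ → Config n Req Ret V Val σ}
    {e : ℕ → Event n Req Ret} (hE : IsExecution O N C e) : Linearizable O N e := by
  classical
  obtain ⟨G, l, hG0, hG, hI, hl, hl', hop⟩ := hE.exists_run
  have hsucc : ∀ {t : ℕ}, (t : ℕ∞) < N → ((t + 1 : ℕ) : ℕ∞) ≤ N := by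
    intro t ht
    have := Order.add_one_le_of_lt ht
    exact_mod_cast this
  have hlN : ∀ {m x}, x ∈ l m → (m : ℕ∞) < N := by
    intro m x hx
    by_contra hm
    rw [hl' m hm] at hx; cases hx
  -- an operation in a log is the current operation of its thread
  have hcur : ∀ {m x}, x ∈ l m → OpOk e l (C m) m x.1 ∧
      e (opIdx e x.1 m) = .inv x.1 x.2.1 ∧ ((C m).loc x.1).pc ≠ .idle ∧ ¬ Served (C m) x.1 := by
    intro m x hx
    have hm := hlN hx
    obtain ⟨h1, h2, -⟩ := (hl m hm).mem x hx
    have hst := (hI m hm.le).ctl.started_of_mem_pend h2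
    have hO := hop m hm.le x.1 hst.ne_idle
    refine ⟨hO, ?_, hst.ne_idle, fun hs => hs.notMem_pend h2⟩
    obtain ⟨req, h3, h4 | h4⟩ := hO.inv
    · rw [h4] at hst; exact hst.elim
    · rw [h1] at h4
      rw [h3]; simpa using h4.2.symm
  have huniq : ∀ {m₁ m₂ x₁ x₂}, x₁ ∈ l m₁ → x₂ ∈ l m₂ → x₁.1 = x₂.1 →
      opIdx e x₁.1 m₁ = opIdx e x₂.1 m₂ → m₁ = m₂ := by
    have : ∀ {m₁ m₂ x₁ x₂}, x₁ ∈ l m₁ → x₂ ∈ l m₂ → x₁.1 = x₂.1 →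
        opIdx e x₁.1 m₁ = opIdx e x₂.1 m₂ → ¬ m₁ < m₂ := by
      intro m₁ m₂ x₁ x₂ h₁ h₂ hx ho hlt
      obtain ⟨hO, -, -, hs⟩ := hcur h₂
      exact hO.unserved (.inr hs) m₁ hlt x₁ h₁ hx (hx ▸ ho)
    intro m₁ m₂ x₁ x₂ h₁ h₂ hx ho
    exact le_antisymm (not_lt.1 (this h₂ h₁ hx.symm ho.symm)) (not_lt.1 (this h₁ h₂ hx ho))
  have hsame : ∀ {m x₁ x₂}, x₁ ∈ l m → x₂ ∈ l m → x₁.1 = x₂.1 → x₁ = x₂ := by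
    intro m x₁ x₂ h₁ h₂ hx
    exact List.inj_on_of_nodup_map (hl m (hlN h₁)).nodup h₁ h₂ hx
  -- an operation stays the current one until it returns
  have hstay : ∀ (q : Fin n) (m : ℕ), ((C m).loc q).pc ≠ .idle → ∀ u, m ≤ u → (u : ℕ∞) ≤ N →
      (∀ s, m ≤ s → s < u → ∀ r, e s ≠ .res q r) →
      ((C u).loc q).pc ≠ .idle ∧ opIdx e q u = opIdx e q m := by
    intro q m hm u hu
    induction u, hu using Nat.le_induction with
    | base => exact fun _ _ => ⟨hm, rfl⟩
    | succ u hu ih =>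
      intro hN hr
      have hN' : (u : ℕ∞) < N := lt_of_lt_of_le (by exact_mod_cast Nat.lt_succ_self u) hN
      obtain ⟨h1, h2⟩ := ih hN'.le fun s hs hsu => hr s hs (hsu.trans (Nat.lt_succ_self u))
      obtain ⟨h3, h4⟩ := (hG u hN').ne_idle h1 (hr u hu (Nat.lt_succ_self u))
      exact ⟨h3, (opIdx_succ_of_ne h4).trans h2⟩
  have hret : ∀ (q : Fin n) (m u : ℕ) (r : Ret), ((C m).loc q).pc ≠ .idle → m ≤ u →
      (u : ℕ∞) < N → e u = .res q r → (∀ s, m ≤ s → s < u → ∀ r, e s ≠ .res q r) →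
      ∃ m' < u, ∃ x ∈ l m', x.1 = q ∧ opIdx e q m' = opIdx e q m ∧ x.2.2 = r := by
    intro q m u r hm hmu hu heu hs
    obtain ⟨h1, h2⟩ := hstay q m hm u hmu hu.le hs
    have hO := hop u hu.le q h1
    have htr := hG u hu
    have hpc : ((C u).loc q).pc = .respond r := by
      rw [heu] at htr
      generalize C (u + 1) = C', G (u + 1) = G' at htr
      cases htr with
      | res _ _ h => exact h
    have hsv : Served (C u) q := (hI u hu.le).ctl.served (by rw [hpc]; rfl)
    obtain ⟨m', hm', x, hx, h3, h4, h5⟩ := hO.served (by rw [hpc]; trivial) hsv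
    refine ⟨m', hm', x, hx, h3, h4.trans h2, ?_⟩
    have := hO.rval r hpc
    rw [h5] at this
    simpa using this
  let at' : ℕ → ℕ := fun t => if (t : ℕ∞) ≤ N then t else N.toNat
  let H : ℕ → Heap V Val := fun t => (G (at' t)).hist (C (at' t)).S.val.seq
  refine ⟨fun m => (l m).map fun x => (opIdx e x.1 m, x.2), H, ?_, ?_, ?_, ?_, ?_, ?_⟩
  · have : at' 0 = 0 := by simp [at']
    simp only [H, this, hG0]
    rfl
  · intro m
    have hmap : ((l m).map fun x => (opIdx e x.1 m, x.2)).map Prod.snd =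
        (l m).map Prod.snd := by simp [Function.comp_def]
    rw [hmap]
    by_cases hm : (m : ℕ∞) < N
    · have h1 : at' m = m := if_pos hm.le
      have h2 : at' (m + 1) = m + 1 := if_pos (hsucc hm)
      simp only [H, h1, h2]
      exact (hl m hm).apply
    · have h1 : at' (m + 1) = at' m := by
        have hN : N ≤ m := not_lt.1 hm
        lift N to ℕ using ne_top_of_le_ne_top (ENat.natCast_ne_top m) hN
        simp only [at', Nat.cast_le, ENat.toNat_natCast] at hN ⊢
        split_ifs <;> omega
      simp only [H, h1, hl' m hm]
      exact .nil _
  · rintro m op hop'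
    obtain ⟨x, hx, rfl⟩ := List.mem_map.1 hop'
    have hm := hlN hx
    obtain ⟨hO, h1, h2, h3⟩ := hcur hx
    refine ⟨hO.lt, hm.le, x.1, h1, ?_⟩
    rintro u r ⟨htu, huN, heu, hns⟩
    have hmu : m ≤ u := by
      by_contra hlt
      exact hO.res u r htu (not_le.1 hlt) heu
    refine ⟨hmu, ?_⟩
    obtain ⟨m', hm', x', hx', h4, h5, h6⟩ := hret x.1 m u r h2 hmu huN heu
      fun s hs => hns s (lt_of_lt_of_le hO.lt hs)
    have hmm : m = m' := huniq hx hx' h4.symm (h4 ▸ h5.symm)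
    subst hmm
    rw [← hsame hx' hx h4, h6]
  · intro m
    rw [List.map_map]
    by_cases hm : (m : ℕ∞) < N
    · refine List.Nodup.map_on ?_ (List.Nodup.of_map _ (hl m hm).nodup)
      intro x hx y hy hxy
      refine hsame hx hy ?_
      have h1 := (hcur hx).2.1
      have h2 := (hcur hy).2.1
      simp only [Function.comp] at hxy
      rw [hxy, h2] at h1
      exact (Event.inv.inj h1).1.symm
    · rw [hl' m hm]; exact List.nodup_nil
  · intro m₁ m₂ op₁ h₁ op₂ h₂ heq
    obtain ⟨x₁, hx₁, rfl⟩ := List.mem_map.1 h₁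
    obtain ⟨x₂, hx₂, rfl⟩ := List.mem_map.1 h₂
    simp only at heq
    refine huniq hx₁ hx₂ ?_ heq
    have h1 := (hcur hx₁).2.1
    have h2 := (hcur hx₂).2.1
    rw [heq, h2] at h1
    exact (Event.inv.inj h1).1.symm
  · rintro t p req u r ht het ⟨htu, huN, heu, hns⟩
    have htr := hG t ht
    rw [het] at htr
    have hpc : ((C (t + 1)).loc p).pc ≠ .idle := by
      generalize C (t + 1) = C', G (t + 1) = G' at htr
      cases htr with
      | inv _ _ h => simp [Config.goto]
    obtain ⟨m', -, x, hx, h1, h2, -⟩ := hret p (t + 1) u r hpc htu huN heu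
      fun s hs => hns s hs
    refine ⟨m', _, List.mem_map_of_mem hx, ?_⟩
    simp only [h1, h2]
    exact opIdx_succ_of_eq het

end LUC

namespace LUC

variable {n : ℕ} {Req Ret V Val σ : Type*}

/-- The program counter after an iteration of the loop of `Attempt`. -/
def endPc (a j : Fin 2) : PC n Req Ret V Val σ :=
  if j = 0 then .llS a 1 else if a = 0 then .llS 1 0 else .readRet

theorem endLoc_pc (p : Fin n) (L : Local n Req Ret V Val σ) (a j : Fin 2) :
    (endLoc p L a j).pc = endPc a j := by
  unfold endLoc endPc; split_ifs <;> rfl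

theorem OpOk.rvals_ne_none {e : ℕ → Event n Req Ret} {l : ℕ → List (Fin n × Req × Ret)}
    {C : Config n Req Ret V Val σ} {t : ℕ} {q : Fin n} (H : OpOk e l C t q) (J : CtlInv C)
    (h : (C.loc q).pc = .readRet) : C.S.val.rvals q ≠ none := by
  obtain ⟨_, _, x, _, _, _, h4⟩ := H.served (by rw [h]; trivial) (J.served (by rw [h]; rfl))
  simp [h4]

variable [DecidableEq V] {O : SeqObject Req Ret V Val σ}

theorem length_insert_le (D : AList (fun _ : Addr V => Val)) (x : Addr V) (v : Val) :
    (D.insert x v).entries.length ≤ D.entries.length + 1 := by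
  rw [AList.entries_insert, List.length_cons]
  exact Nat.succ_le_succ (List.kerase_sublist ..).length_le

/-- `Move O S pc h i pc' h'`: a thread at `pc` that has computed the heap `h` proceeds to `pc'` and
`h'` with `i` accesses, while the value of the object `S` is `S`. -/
inductive Move (O : SeqObject Req Ret V Val σ) (S : State n Ret) :
    PC n Req Ret V Val σ → Heap V Val → ℕ → PC n Req Ret V Val σ → Heap V Val → Prop
  | announce (req h) : Move O S (.announce req) h 1 .fetchAdd h
  | fetchAdd (h) : Move O S .fetchAdd h 1 (.llS 0 0) h
  | llS (a j h) : Move O S (.llS a j) h (3 * n + 2) (.readToggles a j S) h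
  | readToggles (ls f h h') (hls : f.ls = ls) (hD : f.D = ∅) :
      Move O S (.readToggles f.attempt f.iter ls) h n (.select f (pend ls)) h'
  | selectNil (f h) : Move O S (.select f []) h 0 (.validate f) h
  | selectCons (f q todo req h) (hr : Reachable O h) :
      Move O S (.select f (q :: todo)) h 1 (.simulate f q todo (O.start req)) h
  | ret (f q todo c r h) (hc : O.instr c = .ret r) :
      Move O S (.simulate f q todo c) h 0 (.select (f.setRet q r) todo) h
  | access (f q todo c c' D h h' i) (hs : SeqStep O (h, c) (h', c'))
      (hD : D.entries.length ≤ f.D.entries.length + 1) (hi : i ≤ 4) :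
      Move O S (.simulate f q todo c) h i (.simulate { f with D := D } q todo c') h'
  | readLate (f q todo c h) : Move O S (.simulate f q todo c) h 4 (.validate f) h
  | allocCas (f q todo c v k h) (hc : O.instr c = .alloc v k) :
      Move O S (.simulate f q todo c) h 1 (.allocNext f q todo v k) h
  | allocNext (f q todo v k r h) : Move O S (.allocNext f q todo v k) h 1
      (.allocVal { f with ltop := .cell r } q todo v k r) h
  | allocVal (f q todo v k r c' D h h')
      (hs : ∀ c, O.instr c = .alloc v k → SeqStep O (h, c) (h', c'))
      (hD : D.entries.length ≤ f.D.entries.length + 1) :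
      Move O S (.allocVal f q todo v k r) h 2 (.simulate { f with D := D } q todo c') h'
  | validate (f h) : Move O S (.validate f) h 1 (.flush f f.D.entries) h
  | validateFail (f h) : Move O S (.validate f) h 1 (endPc f.attempt f.iter) h
  | flushNil (f h) : Move O S (.flush f []) h 0 (.commit f) h
  | flushLate (f y recs h) : Move O S (.flush f (y :: recs)) h 4 (.commit f) h
  | flushSkip (f y recs h) : Move O S (.flush f (y :: recs)) h 4 (.flush f recs) h
  | flushStore (f x v sv recs h) :
      Move O S (.flush f (⟨x, v⟩ :: recs)) h 4 (.store f x v sv recs) h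
  | store (f x v sv recs h) : Move O S (.store f x v sv recs) h 4 (.flush f recs) h
  | commit (f h) : Move O S (.commit f) h (3 * n + 2) (endPc f.attempt f.iter) h
  | readRet (r h) : Move O S .readRet h (3 * n + 2) (.respond r) h

theorem GStep.move {C C' : Config n Req Ret V Val σ} {G G' : Ghost n V Val} {p : Fin n}
    (I : Inv O C G) (h : GStep O C G p C' G')
    (hrv : (C.loc p).pc = .readRet → C.S.val.rvals p ≠ none) :
    Move O C.S.val (C.loc p).pc (G.hp p) (accesses O C p) (C'.loc p).pc (G'.hp p) := by
  have hpc := I.mem.pcs p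
  have hrk := I.rank.pcs p
  cases h with
  | announce req h => simp only [h, accesses, setLoc_loc_self]; exact .announce ..
  | fetchAdd h => simp only [h, accesses, setLoc_loc_self]; exact .fetchAdd ..
  | llS a j h => simp only [h, accesses, setLoc_loc_self]; exact .llS ..
  | readToggles a j ls h =>
    simp only [h, accesses, setLoc_loc_self]
    exact .readToggles ls (firstFrame C a j ls) _ _ rfl rfl
  | selectNil f h => simp only [h, accesses, setLoc_loc_self]; exact .selectNil ..
  | selectCons f q todo req h hq =>
    have hle := I.ctl.seq_le (p := p) (ls := f.ls) (by rw [h]; rfl)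
    rw [h] at hpc
    obtain ⟨-, ⟨l, h2, -⟩, -⟩ := hpc
    simp only [h, accesses, setLoc_loc_self]
    exact .selectCons _ _ _ _ _ ((I.mem.reach _ hle).trans h2.1)
  | selectStuck f q todo h hq =>
    exfalso
    refine (I.ctl.snap p f.ls (by rw [h]; rfl)).2.2 q (mem_pend.1 ?_) hq
    rw [h] at hpc
    obtain ⟨-, ⟨l, -, h3⟩, -⟩ := hpc
    rw [← h3]; simp
  | ret f q todo c r h hc =>
    simp only [h, accesses, hc, setLoc_loc_self]; exact .ret _ _ _ _ _ _ hc
  | readDir f q todo c x k v h hc hv =>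
    rw [h] at hpc
    have : v = (G.hp p).val x := by
      have h1 := hpc.1
      unfold DirOk at h1; simp [h1, overlay, hv]
    simp only [h, accesses, hc, hv, setLoc_loc_self]
    rw [this]
    exact .access f q todo c _ f.D _ _ _ (.read _ _ _ _ hc) (Nat.le_succ _) (by simp)
  | readItem f q todo c x k v h hc hx hv =>
    rw [(I.ctl.frm p f (by rw [h]; rfl)).1] at hv
    have hvx := I.mem.read_eq (I.ctl.seq_le (p := p) (ls := f.ls) (by rw [h]; rfl)) hv
    rw [h] at hpc
    have : v = (G.hp p).val x := by
      have h1 := hpc.1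
      unfold DirOk at h1; simp [h1, overlay, hx, hvx]
    have hs : SeqStep O (G.hp p, c) (G.hp p, k v) := by rw [this]; exact .read _ _ _ _ hc
    simp only [h, accesses, hc, hx, setLoc_loc_self]
    exact .access f q todo c _ _ _ _ _ hs (length_insert_le ..) (by simp)
  | readLate f q todo c x k h hc hx hv =>
    simp only [h, accesses, hc, hx, setLoc_loc_self]; exact .readLate ..
  | write f q todo c x v c₁ h hc =>
    simp only [h, accesses, hc, setLoc_loc_self, Ghost.setHeap, Function.update_self]
    exact .access f q todo c _ _ _ _ _ (.write _ _ _ _ _ hc) (length_insert_le ..) (by simp)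
  | allocCas f q todo c v k h hc hn =>
    simp only [h, accesses, hc, setLoc_loc_self]; exact .allocCas _ _ _ _ _ _ _ hc
  | allocFail f q todo c v k h hc hn =>
    simp only [h, accesses, hc, setLoc_loc_self]; exact .allocCas _ _ _ _ _ _ _ hc
  | allocNext f q todo v k r h hr =>
    simp only [h, accesses, setLoc_loc_self]; exact .allocNext ..
  | allocStuck f q todo v k h hr =>
    rw [h] at hrk
    exact absurd hr hrk.2
  | allocVal f q todo v k r h =>
    have hfresh := I.rank.notMem_used h
    simp only [h, accesses, setLoc_loc_self, Ghost.setHeap, Function.update_self]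
    exact .allocVal f q todo v k r _ _ _ _ (fun c hc => .alloc _ _ _ _ _ hc hfresh)
      (length_insert_le ..)
  | validate f h hl => simp only [h, accesses, setLoc_loc_self]; exact .validate ..
  | validateFail f h hl =>
    rw [setLoc_loc_self, endLoc_pc]
    simp only [h, accesses]; exact .validateFail ..
  | flushNil f h => simp only [h, accesses, setLoc_loc_self]; exact .flushNil ..
  | flushLate f x v recs h hs => simp only [h, accesses, setLoc_loc_self]; exact .flushLate ..
  | flushSkip f x v recs h hs => simp only [h, accesses, setLoc_loc_self]; exact .flushSkip ..
  | flushStore f x v recs h hs => simp only [h, accesses, setLoc_loc_self]; exact .flushStore ..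
  | store f x v sv recs h hl => simp only [h, accesses, setLoc_loc_self]; exact .store ..
  | storeFail f x v sv recs h hl => simp only [h, accesses, setLoc_loc_self]; exact .store ..
  | commit f h hl =>
    rw [setLoc_loc_self, endLoc_pc]
    simp only [h, accesses]; exact .commit ..
  | commitFail f h hl =>
    rw [setLoc_loc_self, endLoc_pc]
    simp only [h, accesses]; exact .commit ..
  | readRet r h hr => simp only [h, accesses, setLoc_loc_self]; exact .readRet ..
  | retStuck h hr => exact absurd hr (hrv h)

theorem GStep.hp_of_ne {C C' : Config n Req Ret V Val σ} {G G' : Ghost n V Val} {p : Fin n}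
    (h : GStep O C G p C' G') {q : Fin n} (hq : q ≠ p) : G'.hp q = G.hp q := by
  cases h <;> first | rfl | simp [Ghost.setHeap, hq]

/-- While an operation of `p` is executed, each transition is a move of `p` or does not
concern `p`. -/
theorem GTrans.move {C C' : Config n Req Ret V Val σ} {G G' : Ghost n V Val}
    {e : Event n Req Ret} (I : Inv O C G) (h : GTrans O C G e C' G') {p : Fin n}
    (hi : (C.loc p).pc ≠ .idle) (hr : ∀ r, e ≠ .res p r)
    (hrv : (C.loc p).pc = .readRet → C.S.val.rvals p ≠ none) :
    e = .step p ∧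
      Move O C.S.val (C.loc p).pc (G.hp p) (accesses O C p) (C'.loc p).pc (G'.hp p) ∨
    e.thread ≠ p ∧ C'.loc p = C.loc p ∧ G'.hp p = G.hp p := by
  cases h with
  | inv q req h =>
    have hq : p ≠ q := by rintro rfl; exact hi h
    exact .inr ⟨hq.symm, setLoc_loc_ne _ hq _, rfl⟩
  | res q r h =>
    have hq : p ≠ q := by rintro rfl; exact hr r rfl
    exact .inr ⟨hq.symm, setLoc_loc_ne _ hq _, rfl⟩
  | step q _ _ h h₁ hs =>
    by_cases hq : p = q
    · subst hq; exact .inl ⟨rfl, hs.move I hrv⟩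
    · exact .inr ⟨fun h => hq h.symm, (hs.evolution.1 p hq).1, hs.hp_of_ne hq⟩

theorem GTrans.announce_of_inv {C C' : Config n Req Ret V Val σ} {G G' : Ghost n V Val}
    {e : Event n Req Ret} (h : GTrans O C G e C' G') {p : Fin n} {req : Req}
    (he : e = .inv p req) : (C'.loc p).pc = .announce req := by
  subst he
  cases h; simp [Config.goto]

/-- One move of a thread, from `x` to `y`. -/
def MoveRel (O : SeqObject Req Ret V Val σ) (y x : PC n Req Ret V Val σ × Heap V Val) : Prop :=
  ∃ S i, Move O S x.1 x.2 i y.1 y.2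

theorem SeqTerminates.acc (hT : SeqTerminates O) {h : Heap V Val} (hr : Reachable O h)
    (req : Req) : Acc (fun b a => SeqStep O a b) (h, O.start req) := by
  by_contra hn
  obtain ⟨f, h0, h1⟩ := not_acc_iff_exists_descending_chain.1 hn
  exact hT h req hr ⟨f, h0, h1⟩

section Termination

variable {f : Frame n Ret V Val} {h : Heap V Val}

theorem acc_readRet : Acc (MoveRel O) ((.readRet : PC n Req Ret V Val σ), h) := by
  refine ⟨_, fun y hy => ?_⟩
  obtain ⟨pc, h'⟩ := y
  obtain ⟨S, i, hm⟩ := hy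
  cases hm
  refine ⟨_, fun y hy => ?_⟩
  obtain ⟨S, i, hm⟩ := hy
  cases hm

theorem acc_commit (H : ∀ h, Acc (MoveRel O) ((endPc f.attempt f.iter : PC n Req Ret V Val σ), h))
    (h : Heap V Val) :
    Acc (MoveRel O) (.commit f, h) := by
  refine ⟨_, fun y hy => ?_⟩
  obtain ⟨pc, h'⟩ := y
  obtain ⟨S, i, hm⟩ := hy
  cases hm
  exact H _

theorem acc_flush (H : ∀ h, Acc (MoveRel O) ((endPc f.attempt f.iter : PC n Req Ret V Val σ), h))
    (recs : List (Σ _ : Addr V, Val)) (h : Heap V Val) :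
    Acc (MoveRel O) (.flush f recs, h) := by
  induction recs generalizing h with
  | nil =>
    refine ⟨_, fun y hy => ?_⟩
    obtain ⟨pc, h'⟩ := y
    obtain ⟨S, i, hm⟩ := hy
    cases hm
    exact acc_commit H _
  | cons z recs ih =>
    refine ⟨_, fun y hy => ?_⟩
    obtain ⟨pc, h'⟩ := y
    obtain ⟨S, i, hm⟩ := hy
    cases hm with
    | flushLate => exact acc_commit H _
    | flushSkip => exact ih _
    | flushStore =>
      refine ⟨_, fun y hy => ?_⟩
      obtain ⟨pc, h'⟩ := y
      obtain ⟨S, i, hm⟩ := hy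
      cases hm
      exact ih _

theorem acc_validate (H : ∀ h, Acc (MoveRel O) ((endPc f.attempt f.iter : PC n Req Ret V Val σ), h))
    (h : Heap V Val) :
    Acc (MoveRel O) (.validate f, h) := by
  refine ⟨_, fun y hy => ?_⟩
  obtain ⟨pc, h'⟩ := y
  obtain ⟨S, i, hm⟩ := hy
  cases hm with
  | validate => exact acc_flush H _ _
  | validateFail => exact H _

theorem acc_simulate {a j : Fin 2}
    (H : ∀ h, Acc (MoveRel O) ((endPc a j : PC n Req Ret V Val σ), h)) (q : Fin n)
    (todo : List (Fin n))
    (H' : ∀ (f : Frame n Ret V Val) h, f.attempt = a → f.iter = j →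
      Acc (MoveRel O) (.select f todo, h))
    {x : Heap V Val × σ} (hx : Acc (fun b a => SeqStep O a b) x) (f : Frame n Ret V Val)
    (ha : f.attempt = a) (hj : f.iter = j) :
    Acc (MoveRel O) (.simulate f q todo x.2, x.1) := by
  induction hx generalizing f with
  | intro x _ ih =>
    obtain ⟨h, c⟩ := x
    refine ⟨_, fun y hy => ?_⟩
    obtain ⟨pc, h'⟩ := y
    obtain ⟨S, i, hm⟩ := hy
    cases hm with
    | ret => exact H' _ _ ha hj
    | access _ _ _ _ c' D _ _ _ hs => exact ih (h', c') hs { f with D := D } ha hj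
    | readLate => subst ha hj; exact acc_validate H _
    | allocCas _ _ _ _ v k _ hc =>
      refine ⟨_, fun y hy => ?_⟩
      obtain ⟨pc, h'⟩ := y
      obtain ⟨S, i, hm⟩ := hy
      cases hm with
      | allocNext =>
        refine ⟨_, fun y hy => ?_⟩
        obtain ⟨pc, h'⟩ := y
        obtain ⟨S, i, hm⟩ := hy
        cases hm with
        | allocVal _ _ _ _ _ _ c' D _ _ hs =>
          exact ih (h', c') (hs _ hc) _ ha hj

theorem acc_select (hT : SeqTerminates O) {a j : Fin 2}
    (H : ∀ h, Acc (MoveRel O) ((endPc a j : PC n Req Ret V Val σ), h)) (todo : List (Fin n))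
    (f : Frame n Ret V Val) (h : Heap V Val) (ha : f.attempt = a) (hj : f.iter = j) :
    Acc (MoveRel O) (.select f todo, h) := by
  induction todo generalizing f h with
  | nil =>
    refine ⟨_, fun y hy => ?_⟩
    obtain ⟨pc, h'⟩ := y
    obtain ⟨S, i, hm⟩ := hy
    cases hm
    subst ha hj; exact acc_validate H _
  | cons q todo ih =>
    refine ⟨_, fun y hy => ?_⟩
    obtain ⟨pc, h'⟩ := y
    obtain ⟨S, i, hm⟩ := hy
    cases hm with
    | selectCons _ _ _ req _ hr => exact acc_simulate H q todo ih (hT.acc hr req) f ha hj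

theorem acc_llS (hT : SeqTerminates O) {a j : Fin 2}
    (H : ∀ h, Acc (MoveRel O) ((endPc a j : PC n Req Ret V Val σ), h)) (h : Heap V Val) :
    Acc (MoveRel O) ((.llS a j : PC n Req Ret V Val σ), h) := by
  refine ⟨_, fun y hy => ?_⟩
  obtain ⟨pc, h'⟩ := y
  obtain ⟨S, i, hm⟩ := hy
  cases hm
  refine ⟨_, fun y hy => ?_⟩
  obtain ⟨pc, h'⟩ := y
  obtain ⟨S', i, hm⟩ := hy
  cases hm
  exact acc_select hT H _ _ _ rfl rfl

theorem acc_announce (hT : SeqTerminates O) (req : Req) (h : Heap V Val) :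
    Acc (MoveRel O) ((.announce req : PC n Req Ret V Val σ), h) := by
  refine ⟨_, fun y hy => ?_⟩
  obtain ⟨pc, h'⟩ := y
  obtain ⟨S, i, hm⟩ := hy
  cases hm
  refine ⟨_, fun y hy => ?_⟩
  obtain ⟨pc, h'⟩ := y
  obtain ⟨S', i, hm⟩ := hy
  cases hm
  exact acc_llS hT (acc_llS hT (acc_llS hT (acc_llS hT fun _ => acc_readRet))) _

end Termination

theorem waitFree (hT : SeqTerminates O) {C : ℕ → Config n Req Ret V Val σ}
    {e : ℕ → Event n Req Ret} (hE : IsExecution O ⊤ C e) : WaitFree e := by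
  classical
  intro t p req het hinf
  by_contra hno
  have hres : ∀ s, t < s → ∀ r, e s ≠ .res p r := by
    intro s hs r hr
    have hex : ∃ s, t < s ∧ ∃ r, e s = .res p r := ⟨s, hs, r, hr⟩
    obtain ⟨h1, r', h2⟩ := Nat.find_spec hex
    exact hno ⟨_, r', h1, ENat.natCast_lt_top _, h2, fun u hu hlt r hr =>
      Nat.find_min hex hlt ⟨hu, r, hr⟩⟩
  obtain ⟨G, l, -, hG, hI, -, -, hop⟩ := hE.exists_run
  have hG := fun t : ℕ => hG t (ENat.natCast_lt_top t)
  have hI := fun t : ℕ => hI t le_top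
  have hop := fun t : ℕ => hop t le_top
  have hstart : ((C (t + 1)).loc p).pc = .announce req := (hG t).announce_of_inv het
  have hidle : ∀ s, t < s → ((C s).loc p).pc ≠ .idle := by
    intro s hs
    induction s, hs using Nat.le_induction with
    | base => rw [hstart]; simp
    | succ s hs ih => exact ((hG s).ne_idle ih (hres s hs)).1
  have hmove := fun s (hs : t < s) => (hG s).move (hI s) (hidle s hs) (hres s hs)
    fun h => (hop s p (hidle s hs)).rvals_ne_none (hI s).ctl h
  have hnext : ∀ s, t < s → ∃ u, t < u ∧ MoveRel O (((C u).loc p).pc, (G u).hp p)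
      (((C s).loc p).pc, (G s).hp p) := by
    intro s hs
    obtain ⟨u, hu, hsu⟩ := hinf.exists_gt s
    have hex : ∃ u, s ≤ u ∧ (e u).thread = p := ⟨u, hsu.le, hu⟩
    obtain ⟨h1, h2⟩ := Nat.find_spec hex
    have hmin := fun {m} => Nat.find_min hex (m := m)
    generalize Nat.find hex = u at h1 h2 hmin
    have hsame : ∀ v, s ≤ v → v ≤ u → (C v).loc p = (C s).loc p ∧ (G v).hp p = (G s).hp p := by
      intro v hv
      induction v, hv using Nat.le_induction with
      | base => exact fun _ => ⟨rfl, rfl⟩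
      | succ v hv ih =>
        intro hvu
        obtain ⟨h3, h4⟩ := ih (Nat.le_of_succ_le hvu)
        rcases hmove v (lt_of_lt_of_le hs hv) with h | ⟨-, h5, h6⟩
        · exact absurd ⟨hv, by rw [h.1]; rfl⟩ (hmin hvu)
        · exact ⟨h5.trans h3, h6.trans h4⟩
    obtain ⟨h3, h4⟩ := hsame u h1 le_rfl
    rcases hmove u (lt_of_lt_of_le hs h1) with ⟨-, h⟩ | h
    · refine ⟨u + 1, by omega, ?_, ?_, ?_⟩
      · exact (C u).S.val
      · exact accesses O (C u) p
      · rw [← h3, ← h4]; exact h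
    · exact absurd h2 h.1
  have key : ∀ x, Acc (MoveRel O) x → ∀ s, t < s → (((C s).loc p).pc, (G s).hp p) ≠ x := by
    intro x hx
    induction hx with
    | intro x _ ih =>
      rintro s hs rfl
      obtain ⟨u, hu, hm⟩ := hnext s hs
      exact ih _ hm u hu rfl
  exact key _ (acc_announce hT req ((G (t + 1)).hp p)) (t + 1) (Nat.lt_succ_self t)
    (by rw [hstart])

end LUC

namespace LUC

variable {n : ℕ} {Req Ret V Val σ : Type*}

/-- The requests found pending in the course of an operation belong to threads that are active. -/
theorem CtlInv.length_pend_le {C : ℕ → Config n Req Ret V Val σ} {t s m : ℕ}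
    (J : CtlInv (C s)) (ht : t < s) (hm : s ≤ m) :
    (pend (C s).S.val).length ≤ contention C t m := by
  classical
  rw [← List.toFinset_card_of_nodup (nodup_pend _), ← Set.ncard_coe_finset]
  refine Set.ncard_le_ncard (fun q hq => ⟨s, ht, hm, ?_⟩) (Set.toFinite _)
  exact (J.started_of_mem_pend (List.mem_toFinset.1 hq)).ne_idle

theorem contention_le (C : ℕ → Config n Req Ret V Val σ) (t m : ℕ) : contention C t m ≤ n := by
  unfold contention
  exact (Set.ncard_le_card _).trans (by simp)

variable [DecidableEq V]

/-- A bound on the accesses of one iteration of the loop of `Attempt` that finds at most `k`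
pending requests, each with code of at most `w` accesses. -/
def iterCost (n k w : ℕ) : ℕ := 7 * n + k * (4 * w + 1) + 8 * (k * w) + 9

/-- A bound on the accesses of an operation before iteration `j` of call `a` of `Attempt`. -/
def prefixCost (n k w : ℕ) (a j : Fin 2) : ℕ := 2 + (2 * a + j) * iterCost n k w

/-- `CostOk O k w pc h A`: an operation that has reached `pc` and computed the heap `h` with `A`
accesses is within the bounds for at most `k` pending requests, each with code of at most `w`
accesses. -/
def CostOk (O : SeqObject Req Ret V Val σ) (k w : ℕ) :
    PC n Req Ret V Val σ → Heap V Val → ℕ → Prop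
  | .idle, _, _ => False
  | .announce _, _, A => A ≤ 0
  | .fetchAdd, _, A => A ≤ 1
  | .llS a j, _, A => A ≤ prefixCost n k w a j
  | .readToggles a j ls, _, A => A ≤ prefixCost n k w a j + 3 * n + 2 ∧ (pend ls).length ≤ k
  | .select f todo, _, A => ∃ d, d + todo.length ≤ k ∧ f.D.entries.length ≤ d * w ∧
      A ≤ prefixCost n k w f.attempt f.iter + 4 * n + 2 + d * (4 * w + 1)
  | .simulate f _ todo c, h, A => ∃ (d m : ℕ) (x : Heap V Val × Req),
      d + 1 + todo.length ≤ k ∧ Reachable O x.1 ∧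
      SeqSteps O m (x.1, O.start x.2) (h, c) ∧ f.D.entries.length ≤ d * w + m ∧
      A ≤ prefixCost n k w f.attempt f.iter + 4 * n + 2 + d * (4 * w + 1) + 1 + 4 * m
  | .allocNext f _ todo v g, h, A => ∃ (c : σ) (d m : ℕ) (x : Heap V Val × Req),
      O.instr c = .alloc v g ∧ d + 1 + todo.length ≤ k ∧ Reachable O x.1 ∧
      SeqSteps O m (x.1, O.start x.2) (h, c) ∧ f.D.entries.length ≤ d * w + m ∧
      A ≤ prefixCost n k w f.attempt f.iter + 4 * n + 2 + d * (4 * w + 1) + 2 + 4 * m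
  | .allocVal f _ todo v g _, h, A => ∃ (c : σ) (d m : ℕ) (x : Heap V Val × Req),
      O.instr c = .alloc v g ∧ d + 1 + todo.length ≤ k ∧ Reachable O x.1 ∧
      SeqSteps O m (x.1, O.start x.2) (h, c) ∧ f.D.entries.length ≤ d * w + m ∧
      A ≤ prefixCost n k w f.attempt f.iter + 4 * n + 2 + d * (4 * w + 1) + 3 + 4 * m
  | .validate f, _, A => f.D.entries.length ≤ k * w ∧
      A ≤ prefixCost n k w f.attempt f.iter + 4 * n + 6 + k * (4 * w + 1)
  | .flush f recs, _, A => A + 8 * recs.length + 3 * n + 2 ≤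
      prefixCost n k w f.attempt f.iter + iterCost n k w
  | .store f _ _ _ recs, _, A => A + 4 + 8 * recs.length + 3 * n + 2 ≤
      prefixCost n k w f.attempt f.iter + iterCost n k w
  | .commit f, _, A => A + 3 * n + 2 ≤ prefixCost n k w f.attempt f.iter + iterCost n k w
  | .readRet, _, A => A ≤ 2 + 4 * iterCost n k w
  | .respond _, _, A => A ≤ 2 + 4 * iterCost n k w + 3 * n + 2

theorem prefixCost_add_le (n k w : ℕ) (a j : Fin 2) :
    prefixCost n k w a j + iterCost n k w ≤ 2 + 4 * iterCost n k w := by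
  unfold prefixCost
  fin_cases a <;> fin_cases j <;> simp <;> omega

variable {O : SeqObject Req Ret V Val σ} {k w : ℕ}

theorem costOk_endPc {a j : Fin 2} {A : ℕ} (h : Heap V Val)
    (hA : A ≤ prefixCost n k w a j + iterCost n k w) :
    CostOk O k w (endPc a j : PC n Req Ret V Val σ) h A := by
  unfold prefixCost at hA
  fin_cases a <;> fin_cases j <;> simp [endPc, CostOk, prefixCost] at hA ⊢ <;> omega

theorem Move.costOk {S : State n Ret} {pc pc' : PC n Req Ret V Val σ}
    {h h' : Heap V Val} {i A : ℕ} (hw : SeqTimeBound O w) (hS : (pend S).length ≤ k)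
    (hm : Move O S pc h i pc' h') (H : CostOk O k w pc h A) : CostOk O k w pc' h' (A + i) := by
  have hle : ∀ d, d ≤ k → d * (4 * w + 1) ≤ k * (4 * w + 1) := fun d => Nat.mul_le_mul_right _
  have hle' : ∀ d, d ≤ k → d * w ≤ k * w := fun d => Nat.mul_le_mul_right _
  have hi : iterCost n k w = 7 * n + k * (4 * w + 1) + 8 * (k * w) + 9 := rfl
  cases hm with
  | announce | fetchAdd => simp only [CostOk, prefixCost] at H ⊢; simp; omega
  | llS a j => exact ⟨by simp only [CostOk] at H; omega, hS⟩
  | readToggles ls f _ _ hls hD =>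
    obtain ⟨h1, h2⟩ := H
    exact ⟨0, by omega, by simp [hD], by omega⟩
  | selectNil =>
    obtain ⟨d, h1, h2, h3⟩ := H
    have := hle d h1
    have := hle' d h1
    exact ⟨by omega, by omega⟩
  | selectCons f q todo req _ hr =>
    obtain ⟨d, h1, h2, h3⟩ := H
    rw [List.length_cons] at h1
    exact ⟨d, 0, (h, req), by omega, hr, .refl _, h2, by omega⟩
  | ret =>
    obtain ⟨d, m, x, h1, h2, h3, h4, h5⟩ := H
    have := hw _ _ h2 _ _ h3
    refine ⟨d + 1, h1, ?_, ?_⟩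
    · rw [Nat.succ_mul d]; exact h4.trans (by omega)
    · rw [Nat.succ_mul d]; exact h5.trans (by simp only [Frame.setRet]; omega)
  | access f q todo c c' D _ _ _ hs hD hi =>
    obtain ⟨d, m, x, h1, h2, h3, h4, h5⟩ := H
    exact ⟨d, m + 1, x, h1, h2, .tail _ _ _ _ h3 hs, by simp only; omega, by simp only; omega⟩
  | readLate =>
    obtain ⟨d, m, x, h1, h2, h3, h4, h5⟩ := H
    have := hw _ _ h2 _ _ h3
    have h6 := hle (d + 1) (by omega)
    have h7 := hle' (d + 1) (by omega)
    rw [Nat.succ_mul d] at h6 h7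
    exact ⟨by omega, by omega⟩
  | allocCas _ _ _ c v g _ hc =>
    obtain ⟨d, m, x, h1, h2, h3, h4, h5⟩ := H
    exact ⟨c, d, m, x, hc, h1, h2, h3, h4, by omega⟩
  | allocNext =>
    obtain ⟨c, d, m, x, hc, h1, h2, h3, h4, h5⟩ := H
    exact ⟨c, d, m, x, hc, h1, h2, h3, h4, by simp only; omega⟩
  | allocVal _ _ _ _ _ _ _ _ _ _ hs hD =>
    obtain ⟨c, d, m, x, hc, h1, h2, h3, h4, h5⟩ := H
    exact ⟨d, m + 1, x, h1, h2, .tail _ _ _ _ h3 (hs c hc), by simp only; omega,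
      by simp only; omega⟩
  | validate f =>
    obtain ⟨h1, h2⟩ := H
    simp only [CostOk]; omega
  | validateFail f =>
    obtain ⟨h1, h2⟩ := H
    exact costOk_endPc _ (by omega)
  | commit f =>
    simp only [CostOk] at H
    exact costOk_endPc _ (by omega)
  | readRet => simp only [CostOk] at H ⊢; omega
  | flushNil | flushLate | flushSkip | flushStore | store =>
    simp only [CostOk, List.length_cons, List.length_nil] at H ⊢; omega

theorem CostOk.le {pc : PC n Req Ret V Val σ} {h : Heap V Val} {A : ℕ} (hw : SeqTimeBound O w)
    (H : CostOk O k w pc h A) : A ≤ 2 + 4 * iterCost n k w + 3 * n + 2 := by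
  have hle : ∀ d, d ≤ k → d * (4 * w + 1) ≤ k * (4 * w + 1) := fun d => Nat.mul_le_mul_right _
  have hi : iterCost n k w = 7 * n + k * (4 * w + 1) + 8 * (k * w) + 9 := rfl
  have hp := prefixCost_add_le n k w
  cases pc with
  | idle => exact H.elim
  | announce | fetchAdd | readRet | respond => simp only [CostOk] at H; omega
  | llS a j => have := hp a j; simp only [CostOk] at H; omega
  | readToggles a j => have := hp a j; have := H.1; omega
  | select f =>
    obtain ⟨d, h1, h2, h3⟩ := H
    have := hp f.attempt f.iter
    have := hle d (by omega)
    omega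
  | simulate f =>
    obtain ⟨d, m, x, h1, h2, h3, h4, h5⟩ := H
    have := hp f.attempt f.iter
    have := hw _ _ h2 _ _ h3
    have := hle (d + 1) (by omega)
    rw [Nat.succ_mul d] at this
    omega
  | allocNext f | allocVal f =>
    obtain ⟨c, d, m, x, hc, h1, h2, h3, h4, h5⟩ := H
    have := hp f.attempt f.iter
    have := hw _ _ h2 _ _ h3
    have := hle (d + 1) (by omega)
    rw [Nat.succ_mul d] at this
    omega
  | validate f => have := hp f.attempt f.iter; have := H.2; omega
  | flush f | store f | commit f =>
    have := hp f.attempt f.iter; simp only [CostOk] at H; omega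

theorem accessesIn_le (hw : SeqTimeBound O w) {N : ℕ∞}
    {C : ℕ → Config n Req Ret V Val σ} {e : ℕ → Event n Req Ret} (hE : IsExecution O N C e)
    {t m : ℕ} {p : Fin n} {req : Req} (het : e t = .inv p req) (htm : t < m)
    (hmN : (m : ℕ∞) ≤ N) (hres : ∀ s r, t < s → s < m → e s ≠ .res p r) :
    accessesIn O C e p t m ≤ 75 * (n + contention C t m * w) := by
  obtain ⟨G, l, -, hG, hI, -, -, hop⟩ := hE.exists_run
  have hlt : ∀ {s : ℕ}, s < m → (s : ℕ∞) < N := fun hs =>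
    lt_of_lt_of_le (by exact_mod_cast hs) hmN
  have key : ∀ s, t < s → s ≤ m → ((C s).loc p).pc ≠ .idle ∧
      CostOk O (contention C t m) w ((C s).loc p).pc ((G s).hp p) (accessesIn O C e p t s) := by
    intro s hs
    induction s, hs using Nat.le_induction with
    | base =>
      intro _
      rw [(hG t (hlt htm)).announce_of_inv het]
      exact ⟨by simp, by simp [accessesIn, het, CostOk]⟩
    | succ s hs ih =>
      intro hsm
      obtain ⟨h1, h2⟩ := ih (Nat.le_of_succ_le hsm)
      have hsN := hlt hsm
      have hr := fun r => hres s r hs hsm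
      refine ⟨((hG s hsN).ne_idle h1 hr).1, ?_⟩
      have hA : accessesIn O C e p t (s + 1) = accessesIn O C e p t s +
          open Classical in if e s = .step p then accesses O (C s) p else 0 :=
        Finset.sum_Ico_succ_top (Nat.le_of_succ_le hs) _
      rw [hA]
      have hI := hI s hsN.le
      rcases (hG s hsN).move hI h1 hr
        fun h => (hop s hsN.le p h1).rvals_ne_none hI.ctl h with ⟨h3, h4⟩ | ⟨h3, h4, h5⟩
      · rw [if_pos h3]
        exact h4.costOk hw (hI.ctl.length_pend_le hs (Nat.le_of_succ_le hsm)) h2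
      · rw [if_neg (fun h => h3 (by rw [h]; rfl)), h4, h5]
        exact h2
  have h1 := (key m htm le_rfl).2.le hw
  have h2 := contention_le C t m
  have h3 : 0 < n := p.pos
  unfold iterCost at h1
  generalize contention C t m = k at *
  have h4 : k * (4 * w + 1) = 4 * (k * w) + k := by ring
  omega

end LUC

open LUC in
theorem theorem1 :
    -- one constant for all numbers of threads, objects and executions
    ∃ K : ℕ, ∀ (n : ℕ) (Req Ret V Val σ : Type*) [DecidableEq V]
      (O : SeqObject Req Ret V Val σ),
      -- every execution is linearizable
      (∀ (N : ℕ∞) (C : ℕ → Config n Req Ret V Val σ) (e : ℕ → Event n Req Ret),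
        IsExecution O N C e → Linearizable O N e) ∧
      (SeqTerminates O →
        ∀ (C : ℕ → Config n Req Ret V Val σ) (e : ℕ → Event n Req Ret),
          IsExecution O ⊤ C e → WaitFree e) ∧
      -- every operation performs `O(n + k w)` shared-memory accesses: the accesses by event `m`,
      -- up to which the operation of `p` that was invoked by event `t` has not returned (for
      -- the whole operation, let `m` be the event by which it returns)
      (∀ w : ℕ, SeqTimeBound O w →
        ∀ (N : ℕ∞) (C : ℕ → Config n Req Ret V Val σ) (e : ℕ → Event n Req Ret),
          IsExecution O N C e →
          ∀ (t : ℕ) (p : Fin n) (req : Req) (m : ℕ), e t = .inv p req → t < m → (m : ℕ∞) ≤ N →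
            (∀ s r, t < s → s < m → e s ≠ .res p r) →
            accessesIn O C e p t m ≤ K * (n + contention C t m * w)) := by
  refine ⟨75, fun n Req Ret V Val σ _ O => ⟨fun N C e => linearizable,
    fun hT C e => waitFree hT, ?_⟩⟩
  intro w hw N C e hE t p req m het htm hm hres
  exact accessesIn_le hw hE het htm hm fun s r => hres s r
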